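/- **Setting.** Let $K$ be a separably closed field of characteristic $p>0$ with algebraic closure $\overline K$, let $C$ be a regular, geometrically integral curve over $K$ (separated, of finite type, of dimension one), and let $P\in C$. For $i\ge 0$ let $C^{(p^i)}$ be the base change of $C$ along the $i$-th iterate of the Frobenius of $K$, let $F^i\colon C\to C^{(p^i)}$ be the $i$-th iterate of the relative Frobenius morphism, let $C_i$ be the normalization of $C^{(p^i)}$ (so $C_0=C$), and let $P_i$ be the point of $C_i$ lying over $F^i(P)$ (so $P_0=P$). For a point $R$ of a geometrically integral curve $D$ over $K$ that is not its generic point, let $\overline K\mathcal O_{D,R}=\overline K\otimes_K\mathcal O_{D,R}$ be the local ring of $D\times_K\overline K$ at the unique point over $R$, let $\widetilde{\mathcal O}$ be its normalization in its field of fractions, which is a discrete valuation ring, and let $\nu$ be its valuation. * The *differential degree* is $d(D,R)=1+\dim_{\overline K}\operatorname{Coker}(\alpha)$, where $\alpha\colon \widetilde{\mathcal O}\otimes_{\overline K\mathcal O_{D,R}}\Omega_{\overline K\mathcal O_{D,R}/\overline K}\to\Omega_{\widetilde{\mathcal O}/\overline K}$ is the natural map of modules of Kähler differentials. * The *conductor*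 $c(D,R)$ is the conductor of the semigroup $\Gamma=\{\nu(x) : 0\ne x\in \overline K\mathcal O_{D,R}\}\subseteq\mathbb Z_{\ge 0}$, that is, the largest positive integer $c\in\Gamma$ with $c-1\notin\Gamma$, or $0$ if $\Gamma=\mathbb Z_{\ge0}$. **Theorem.** Suppose that $n$ is a positive integer such that $P_n$ is a rational point of $C_n$ (its residue field is $K$). Then $\Gamma$ at $P$ contains all sufficiently large integers, the cokernels defining $d(C_i,P_i)$ for $0\le i<n$ are finite-dimensional over $\overline K$, and $$c(C,P)=\sum_{0\le i<n}(p-1)\,\bigl(d(C_i,P_i)-1\bigr)\,p^{i}.$$ -/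

import Mathlib

open CategoryTheory CategoryTheory.Limits AlgebraicGeometry TensorProduct

universe u

noncomputable section

namespace FrobeniusTower

/-! ### Invariants of an algebra over an algebraically closed field -/

section Ring

variable (L A : Type u) [Field L] [CommRing A] [Algebra L A]

/-- The normalization of a domain `A` in its field of fractions. -/
abbrev Normalized : Type u := integralClosure A (FractionRing A)

/-- The natural map `α : B ⊗ Ω_{A/L} → Ω_{B/L}`, where `B` is the normalization of `A`. -/
abbrev alphaMap : Normalized A ⊗[A] Ω[A⁄L] →ₗ[Normalized A] Ω[Normalized A⁄L] :=
  KaehlerDifferential.mapBaseChange L A (Normalized A)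

/-- The cokernel of `α`. -/
abbrev AlphaCoker : Type u := Ω[Normalized A⁄L] ⧸ LinearMap.range (alphaMap L A)

/-- The set of the values, at the nonzero elements of `A`, of the discrete valuation whose
valuation ring is the normalization of `A` (`addVal` takes the value `⊤` exactly at `0`). -/
def valueSemigroup : Set ℕ :=
  {l | ∃ (_ : IsDomain (Normalized A)) (_ : IsDiscreteValuationRing (Normalized A)) (x : A),
      IsDiscreteValuationRing.addVal (Normalized A) (algebraMap A (Normalized A) x) = (l : ℕ∞)}

end Ring

/-- The conductor of a set `S` of natural numbers: the largest positive integer `c ∈ S` such that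
`c - 1` is a gap of `S`. If there is no such `c` (for instance `S = ℕ`), the value is `0`. -/
def setConductor (S : Set ℕ) : ℕ := sSup {c | 0 < c ∧ c ∈ S ∧ c - 1 ∉ S}

/-! ### Points of schemes over a field -/

section Points

variable {K : Type u} [Field K] {X : Scheme.{u}} (f : X ⟶ Spec (CommRingCat.of K))

/-- The map from `K` to the sections of a `K`-scheme over an open subset. -/
def toSections (U : X.Opens) : CommRingCat.of K ⟶ Γ(X, U) :=
  (Scheme.ΓSpecIso (CommRingCat.of K)).inv ≫ f.appTop ≫ X.presheaf.map (homOfLE le_top).op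

/-- The map from `K` to the local ring of a `K`-scheme at a point. -/
def toStalk (x : X) : CommRingCat.of K ⟶ X.presheaf.stalk x :=
  (Scheme.ΓSpecIso (CommRingCat.of K)).inv ≫ f.appTop ≫ X.presheaf.germ ⊤ x trivial

/-- A point of a `K`-scheme is rational if its residue field is `K`. -/
def IsRationalPoint (x : X) : Prop :=
  Function.Bijective (toStalk f x ≫ X.residue x).hom

/-- The local ring at a point of a `K`-scheme, as a `K`-algebra. -/
def LocalRing (_ : X ⟶ Spec (CommRingCat.of K)) (x : X) : Type u := X.presheaf.stalk x

instance (x : X) : CommRing (LocalRing f x) :=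
  inferInstanceAs (CommRing (X.presheaf.stalk x))

instance (x : X) : Algebra K (LocalRing f x) :=
  RingHom.toAlgebra (S := LocalRing f x) (toStalk f x).hom

/-- The ring `K̄ O = K̄ ⊗ O`, where `O` is the local ring at `x`. On a geometrically integral
`K`-scheme with `K` separably closed, this is the local ring of the base change to `K̄` at the
unique point over `x`. -/
abbrev GeomLocalRing (x : X) : Type u := AlgebraicClosure K ⊗[K] LocalRing f x

/-- The cokernel of `α : B ⊗ Ω_{K̄O/K̄} → Ω_{B/K̄}`, where `O` is the local ring at `x` and `B` is
the normalization of `K̄ O`. -/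
abbrev DifferentialCoker (x : X) : Type u :=
  AlphaCoker (AlgebraicClosure K) (GeomLocalRing f x)

/-- The differential degree `d(X, x) = 1 + dim Coker α`, the dimension being over `K̄`. -/
def differentialDegree (x : X) : ℕ :=
  1 + Module.finrank (AlgebraicClosure K) (DifferentialCoker f x)

/-- The semigroup of values of `K̄ O`, where `O` is the local ring at `x`. -/
def geomSemigroup (x : X) : Set ℕ := valueSemigroup (GeomLocalRing f x)

/-- The conductor `c(X, x)` of the semigroup of values of `K̄ O`. -/
def conductor (x : X) : ℕ := setConductor (geomSemigroup f x)

end Points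

/-! ### Frobenius -/

section Frobenius

variable {K : Type u} [Field K] (p : ℕ) [Fact p.Prime] [CharP K p]

/-- On a ring that receives a ring homomorphism from a field of characteristic `p`, the ring
endomorphism `x ↦ x ^ (p ^ n)`. -/
def powHom {R : CommRingCat.{u}} (φ : CommRingCat.of K ⟶ R) (n : ℕ) : R ⟶ R :=
  CommRingCat.ofHom
    { toFun := fun x => x ^ p ^ n
      map_one' := one_pow _
      map_mul' := fun x y => mul_pow x y _
      map_zero' := zero_pow (pow_ne_zero n (Fact.out : p.Prime).ne_zero)
      map_add' := fun x y => by
        rcases subsingleton_or_nontrivial R with h | h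
        · exact Subsingleton.elim _ _
        · have : CharP R p := charP_of_injective_ringHom φ.hom.injective p
          exact add_pow_char_pow x y p n }

lemma powHom_apply {R : CommRingCat.{u}} (φ : CommRingCat.of K ⟶ R) (n : ℕ) (x : R) :
    (powHom p φ n).hom x = x ^ p ^ n := rfl

variable {X : Scheme.{u}} (f : X ⟶ Spec (CommRingCat.of K))

/-- The map `s ↦ s ^ (p ^ n)` on the structure sheaf. -/
def frobeniusSheafMap (n : ℕ) : X.presheaf ⟶ X.presheaf where
  app := fun U => powHom p (toSections f U.unop) n
  naturality := fun U V i => by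
    ext s
    exact (map_pow (X.presheaf.map i).hom s (p ^ n)).symm

/-- The `n`-th iterate of the absolute Frobenius morphism of a `K`-scheme: the identity on points,
and `s ↦ s ^ (p ^ n)` on sections. -/
def absFrobenius (n : ℕ) : X ⟶ X where
  base := 𝟙 _
  c := frobeniusSheafMap p f n
  prop := fun x => by
    constructor
    intro a ha
    obtain ⟨U, hxU, s, rfl⟩ := X.presheaf.exists_germ_eq a
    have h1 := PresheafedSpace.stalkMap_germ_apply (X := X.toPresheafedSpace)
      (Y := X.toPresheafedSpace) ⟨𝟙 _, frobeniusSheafMap p f n⟩ U x hxU s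
    have h2 : X.presheaf.germ U x hxU (s ^ p ^ n) = (X.presheaf.germ U x hxU s) ^ p ^ n :=
      map_pow (X.presheaf.germ U x hxU).hom s (p ^ n)
    have h3 : IsUnit (X.presheaf.germ U x hxU (s ^ p ^ n)) := by
      refine Eq.mp ?_ ha
      exact congrArg IsUnit h1
    rw [h2] at h3
    exact (isUnit_pow_iff (pow_ne_zero n (Fact.out : p.Prime).ne_zero)).1 h3

lemma absFrobenius_comp (n : ℕ) :
    absFrobenius p f n ≫ f =
      f ≫ Spec.map (CommRingCat.ofHom (iterateFrobenius K p n)) := by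
  apply ext_of_isAffine
  have h1 : (absFrobenius p f n).appTop = powHom p (toSections f ⊤) n := rfl
  rw [Scheme.Hom.comp_appTop, Scheme.Hom.comp_appTop, h1]
  have h2 : (Spec.map (CommRingCat.ofHom (iterateFrobenius K p n))).appTop =
      (Scheme.ΓSpecIso (CommRingCat.of K)).hom ≫ CommRingCat.ofHom (iterateFrobenius K p n) ≫
        (Scheme.ΓSpecIso (CommRingCat.of K)).inv := by
    rw [← Scheme.ΓSpecIso_naturality_assoc, Iso.hom_inv_id, Category.comp_id]
  rw [h2, ← cancel_epi (Scheme.ΓSpecIso (CommRingCat.of K)).inv]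
  simp only [Category.assoc, Iso.inv_hom_id_assoc]
  ext x
  simp only [CommRingCat.hom_comp, RingHom.comp_apply, powHom_apply, CommRingCat.hom_ofHom,
    iterateFrobenius_def, map_pow]

/-- The Frobenius twist `X^(p^n)`: the base change of the `K`-scheme `X` along the `n`-th iterate
of the Frobenius of `K`. -/
abbrev twist (n : ℕ) : Scheme.{u} :=
  pullback f (Spec.map (CommRingCat.ofHom (iterateFrobenius K p n)))

/-- The structure morphism of the Frobenius twist. -/
abbrev twistHom (n : ℕ) : twist p f n ⟶ Spec (CommRingCat.of K) :=
  pullback.snd f (Spec.map (CommRingCat.ofHom (iterateFrobenius K p n)))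

/-- The `n`-th iterate of the relative Frobenius morphism, `X ⟶ X^(p^n)`. -/
def relFrobenius (n : ℕ) : X ⟶ twist p f n :=
  pullback.lift (absFrobenius p f n) f (absFrobenius_comp p f n)

end Frobenius

/-! ### Normalization -/

section Normalization

variable (X : Scheme.{u}) [IsIntegral X] [QuasiSeparatedSpace X]

/-- The inclusion of the generic point, `Spec K(X) ⟶ X`. -/
abbrev genericInclusion : Spec X.functionField ⟶ X := X.fromSpecStalk (genericPoint X)

/-- The normalization of an integral scheme (in its function field). -/
abbrev normalization : Scheme.{u} := (genericInclusion X).normalization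

/-- The normalization morphism. -/
abbrev normalizationHom : normalization X ⟶ X := (genericInclusion X).fromNormalization

end Normalization

/-! ### The Frobenius tower of a curve -/

section Tower

variable {K : Type u} [Field K] (p : ℕ) [Fact p.Prime] [CharP K p]
variable {C : Scheme.{u}} (f : C ⟶ Spec (CommRingCat.of K)) [GeometricallyIntegral f]

instance (n : ℕ) : IsIntegral (twist p f n) :=
  GeometricallyIntegral.geometrically_isIntegral _ _ _ (.of_hasPullback _ _)

variable [QuasiSeparated f]

instance (n : ℕ) : QuasiSeparatedSpace (twist p f n) :=
  quasiSeparatedSpace_of_quasiSeparated (twistHom p f n)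

/-- The curve `C_n`, the normalization of `C^(p^n)`. -/
abbrev towerCurve (n : ℕ) : Scheme.{u} := normalization (twist p f n)

/-- The morphism `C_n ⟶ C^(p^n)`. -/
abbrev towerToTwist (n : ℕ) : towerCurve p f n ⟶ twist p f n := normalizationHom (twist p f n)

/-- The structure morphism of `C_n`. -/
abbrev towerHom (n : ℕ) : towerCurve p f n ⟶ Spec (CommRingCat.of K) :=
  towerToTwist p f n ≫ twistHom p f n

end Tower

end FrobeniusTower

end

/-! Let A be the local ring of C at P, L = K̄ and M the fraction field of L ⊗ A. The local ring of
C_i at P_i is the ring A_i of those elements of A that are fractions of elements of K[A^(p^i)]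
(`frobSub`, `nonempty_algEquiv_localRing_tower`). As L is perfect, the elements of L ⊗ A_i have
p^i-th roots in M; these roots form a ring W_i (`rootSub`) isomorphic to L ⊗ A_i. So the whole tower
lives inside M: L ⊗ A = W_0 ⊆ W_1 ⊆ … ⊆ W_n, with W_(i+1)^p ⊆ W_i. Rationality of P_n makes B = W_n
a discrete valuation ring with residue field L (`exists_uniformizer_rootSub`), and since B^(p^n) ⊆
W_0 it is the common normalization of all W_i. The theorem becomes a recursion for the exponents c_i
of the conductors of W_i in B, namely c_i = (p - 1) e_i + p c_(i+1), where e_i is the dimension of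
the cokernel of α at level i and c_n = 0.

Two facts make the recursion available. First, M has degree at most p over M^p, being of
transcendence degree at most one over a perfect field (`finrank_fieldRange_frobenius_le`). Hence B =
∑ B^p t^j (j < p) for a uniformizer t (`isPBasis_of_dependent`), which yields the derivation d/dt
and the Cartier operator κ on B. Secondly, A_i is generated by the powers 1, ζ, …, ζ^(p-1) of one
element over A_(i+1): this is the relation ef = p for the two discrete valuation rings, once an
immediate extension is excluded (`exists_monogenic_generator`, `not_dense_frobSub`). After extension
of scalars and extraction of roots, W_i = ∑ W_(i+1)^p z^j (`exists_isPMonogenic_rootSub`).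

Write z' = dz/dt = unit · t^e. On the one hand Ω_(B/W_i), which is the cokernel of α, is B/z'B and
has dimension e (`kaehlerEquiv`, `finrank_alphaCoker`). On the other hand κ(z^k z' z^(p-1-j)) is z'
for k = j and 0 otherwise, for k, j < p, so that x lies in W_i if and only if κ(x z' z^j) ∈ z'
W_(i+1) for all j < p (`mem_iff_cartier`). For x running through t^N B this says κ(t^(N+e) B) ⊆ t^e
W_(i+1); as κ(t^m B) = t^⌊m/p⌋ B, it means ⌊(N+e)/p⌋ ≥ e + c_(i+1), that is N ≥ (p - 1) e + p
c_(i+1) (`conductor_step`). Summation gives `IsPBasis.conductor_tower`.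

Finally, the conductor of the semigroup of values is the exponent of the conductor ideal, because L
represents all residues (`setConductor_valueSemigroup`). -/

set_option linter.unusedSectionVars false

open FrobeniusTower

/-! ### Expansions in powers of a uniformizer -/

section Expansion

open Polynomial

/-- If the orders of the coefficients `a j` at a prime `t` are multiples of `p`, then no cancellation
occurs in `∑ j < p, a j * t ^ j`. -/
lemma pow_dvd_of_pow_dvd_sum {D : Type*} [CommRing D] [IsDomain D] {t : D} (ht : Prime t) {p : ℕ}
    {a : ℕ → D} (ha : ∀ j < p, ∀ k, t ^ (p * k + 1) ∣ a j → t ^ (p * k + p) ∣ a j) (k : ℕ)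
    (h : t ^ (p * k) ∣ ∑ j ∈ Finset.range p, a j * t ^ j) : ∀ j < p, t ^ (p * k) ∣ a j := by
  suffices H : ∀ k' ≤ k, ∀ j < p, t ^ (p * k') ∣ a j from H k le_rfl
  intro k'
  induction k' with
  | zero => simp
  | succ k' ih =>
    intro hk j
    have ih := ih (by omega)
    induction j using Nat.strong_induction_on with
    | _ j ihj =>
      intro hj
      have hpk : p * (k' + 1) = p * k' + p := by ring
      have h1 : t ^ (p * k' + (j + 1)) ∣ ∑ i ∈ Finset.range p, a i * t ^ i := by
        refine (pow_dvd_pow t ?_).trans h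
        have := Nat.mul_le_mul_left p hk
        omega
      rw [← Finset.add_sum_erase _ _ (Finset.mem_range.2 hj)] at h1
      -- Modulo t^(pk'+j+1) only the j-th term survives: for i < j the coefficient a i has already
      -- gained a factor t^p, and for i > j the factor t^i suffices.
      have h2 : t ^ (p * k' + (j + 1)) ∣ ∑ i ∈ (Finset.range p).erase j, a i * t ^ i := by
        refine Finset.dvd_sum fun i hi => ?_
        rw [Finset.mem_erase, Finset.mem_range] at hi
        rcases lt_or_gt_of_ne hi.1 with hij | hij
        · have := ihj i hij hi.2
          exact Dvd.dvd.mul_right ((pow_dvd_pow t (by omega)).trans this) _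
        · refine (pow_dvd_pow t (?_ : _ ≤ p * k' + i)).trans ?_
          · omega
          · rw [pow_add]
            exact mul_dvd_mul (ih i hi.2) dvd_rfl
      have h3 := (dvd_add_left h2).1 h1
      rw [show p * k' + (j + 1) = (p * k' + 1) + j by ring, pow_add] at h3
      have h4 := (mul_dvd_mul_iff_right (pow_ne_zero j ht.ne_zero)).1 h3
      rw [hpk]
      exact ha j hj k' h4

lemma pow_dvd_pow_prime {D : Type*} [CommRing D] [IsDomain D] {t : D} (ht : Prime t) {p : ℕ}
    (c : D) (k : ℕ) (h : t ^ (p * k + 1) ∣ c ^ p) : t ^ (p * k + p) ∣ c ^ p := by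
  suffices t ^ (k + 1) ∣ c by
    have := pow_dvd_pow_of_dvd this p
    rwa [← pow_mul, add_mul, one_mul, mul_comm] at this
  induction k generalizing c with
  | zero => simpa using ht.dvd_of_dvd_pow (by simpa using h)
  | succ k ih =>
    have h1 : t ∣ c := ht.dvd_of_dvd_pow ((dvd_pow_self t (by omega)).trans h)
    obtain ⟨d, rfl⟩ := h1
    rw [mul_pow, show p * (k + 1) + 1 = p + (p * k + 1) by ring, pow_add] at h
    have := ih d ((mul_dvd_mul_iff_left (pow_ne_zero p ht.ne_zero)).1 h)
    rw [pow_succ']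
    exact mul_dvd_mul dvd_rfl this

variable {B : Type*} [CommRing B] (p : ℕ) [Fact p.Prime] [CharP B p] (t : B)

/-- The evaluation `∑ c j X ^ j ↦ ∑ c j ^ p t ^ j`. -/
noncomputable abbrev frobEval : B[X] →+* B := eval₂RingHom (frobenius B p) t

variable {p t}

lemma frobEval_C (b : B) : frobEval p t (C b) = b ^ p := by simp [frobEval, frobenius_def]

lemma frobEval_X : frobEval p t X = t := by simp [frobEval]

lemma frobEval_X_pow_sub_C : frobEval p t (X ^ p - C t) = 0 := by
  rw [map_sub, map_pow, frobEval_C, frobEval_X, sub_self]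

lemma frobEval_eq_sum {R : B[X]} {n : ℕ} (hR : R.natDegree < n) :
    frobEval p t R = ∑ j ∈ Finset.range n, R.coeff j ^ p * t ^ j := by
  simp only [frobEval, coe_eval₂RingHom]
  rw [eval₂_eq_sum_range' _ hR]
  rfl

lemma monic_X_pow_sub_C_self (t : B) : (X ^ p - C t : B[X]).Monic :=
  monic_X_pow_sub_C t (Fact.out : p.Prime).ne_zero

lemma exists_eq_sum_of_surjective [IsDomain B] (hs : Function.Surjective (frobEval p t)) (b : B) :
    ∃ c : ℕ → B, b = ∑ j ∈ Finset.range p, c j ^ p * t ^ j := by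
  obtain ⟨R, rfl⟩ := hs b
  have hp := (Fact.out : p.Prime)
  refine ⟨(R %ₘ (X ^ p - C t)).coeff, ?_⟩
  rw [← frobEval_eq_sum]
  · conv_lhs => rw [← modByMonic_add_div R (X ^ p - C t)]
    rw [map_add, map_mul, frobEval_X_pow_sub_C, zero_mul, add_zero]
  · have := natDegree_modByMonic_lt R (monic_X_pow_sub_C_self (p := p) t) (by
      intro h
      have := congrArg natDegree h
      rw [natDegree_X_pow_sub_C, natDegree_one] at this
      exact hp.ne_zero this)
    rwa [natDegree_X_pow_sub_C] at this

variable [IsDomain B]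

lemma eq_zero_of_sum_eq_zero [IsDiscreteValuationRing B] (ht : Irreducible t) {c : ℕ → B}
    (h : ∑ j ∈ Finset.range p, c j ^ p * t ^ j = 0) (j : ℕ) (hj : j < p) : c j = 0 := by
  by_contra h0
  obtain ⟨n, u, hu⟩ := IsDiscreteValuationRing.eq_unit_mul_pow_irreducible h0 ht
  have := pow_dvd_of_pow_dvd_sum ht.prime (a := fun j => c j ^ p)
    (fun j _ k => pow_dvd_pow_prime ht.prime (c j) k) (n + 1) (h ▸ dvd_zero _) j hj
  rw [hu, mul_pow, ← pow_mul, mul_add, mul_one, add_comm, pow_add, mul_comm n,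
    mul_dvd_mul_iff_right (pow_ne_zero _ ht.ne_zero)] at this
  exact ht.not_isUnit (isUnit_of_dvd_unit
    ((dvd_pow_self t (Fact.out : p.Prime).ne_zero).trans this) (u.isUnit.pow p))

/-- The kernel of `frobEval` is thus generated by X^p - t. An operator on B can therefore be defined
on representing polynomials as soon as it kills the multiples of X^p - t. -/
lemma X_pow_sub_C_dvd_of_frobEval_eq_zero [IsDiscreteValuationRing B] (ht : Irreducible t) {R : B[X]}
    (h : frobEval p t R = 0) : X ^ p - C t ∣ R := by
  have hm := monic_X_pow_sub_C_self (p := p) t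
  rw [← modByMonic_eq_zero_iff_dvd hm]
  have hd : (R %ₘ (X ^ p - C t)).natDegree < p := by
    have := natDegree_modByMonic_lt R hm (by
      intro h
      have := congrArg natDegree h
      rw [natDegree_X_pow_sub_C, natDegree_one] at this
      exact (Fact.out : p.Prime).ne_zero this)
    rwa [natDegree_X_pow_sub_C] at this
  rw [← modByMonic_add_div R (X ^ p - C t), map_add, map_mul, frobEval_X_pow_sub_C, zero_mul,
    add_zero, frobEval_eq_sum hd] at h
  ext j
  rcases lt_or_ge j p with hj | hj
  · simpa using eq_zero_of_sum_eq_zero ht h j hj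
  · simpa using coeff_eq_zero_of_natDegree_lt (hd.trans_le hj)

end Expansion

/-! ### The derivation `d/dt` and the Cartier operator -/

section Cartier

open Polynomial

/-- In characteristic `p`, the coefficient of `X ^ (m p + p - 1)` in `R ^ (p - 1) R'` is
`(m + 1) c ^ p`, where `c` is the coefficient of `X ^ (m + 1)` in `R`. -/
lemma coeff_pow_mul_derivative {B : Type*} [CommRing B] (p : ℕ) [hp : Fact p.Prime] [CharP B p]
    (R : B[X]) (m : ℕ) :
    (R ^ (p - 1) * derivative R).coeff (m * p + (p - 1)) = (m + 1 : ℕ) * R.coeff (m + 1) ^ p := by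
  have hp0 := hp.out.pos
  have hR : ∀ k, (R ^ p).coeff (k * p) = R.coeff k ^ p := by
    intro k
    rw [← map_frobenius_expand, coeff_map, coeff_expand_mul hp0, frobenius_def]
  let φ : MvPolynomial B ℤ →+* B := MvPolynomial.eval₂Hom (Int.castRingHom B) id
  have hφ : Function.Surjective φ := fun b => ⟨MvPolynomial.X b, by simp [φ]⟩
  obtain ⟨S, rfl⟩ := map_surjective φ hφ R
  have h1 : ((S ^ (p - 1) * derivative S).coeff (m * p + (p - 1))) =
      (m + 1 : ℕ) * (S ^ p).coeff ((m + 1) * p) := by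
    have h2 : (derivative (S ^ p)).coeff (m * p + (p - 1)) =
        p * ((S ^ (p - 1) * derivative S).coeff (m * p + (p - 1))) := by
      rw [derivative_pow, mul_assoc, coeff_C_mul]
    rw [coeff_derivative, show m * p + (p - 1) + 1 = (m + 1) * p by
      rw [add_mul, add_assoc, Nat.sub_add_cancel hp0, one_mul]] at h2
    have h3 : (p : MvPolynomial B ℤ) ≠ 0 := by
      exact_mod_cast hp.out.ne_zero
    apply mul_left_cancel₀ h3
    rw [← h2]
    have : ((m * p + (p - 1) : ℕ) : MvPolynomial B ℤ) + 1 = (m + 1 : ℕ) * p := by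
      rw [← Nat.cast_mul, ← Nat.cast_succ]
      congr 1
      rw [add_mul, Nat.succ_eq_add_one, add_assoc, Nat.sub_add_cancel hp0, one_mul]
    rw [this]
    ring
  have h4 := congrArg φ h1
  rw [← coeff_map, Polynomial.map_mul, Polynomial.map_pow, ← derivative_map, map_mul, map_natCast,
    ← coeff_map, Polynomial.map_pow, hR] at h4
  exact h4

variable {B : Type*} [CommRing B] [IsDomain B] [IsDiscreteValuationRing B]
  {p : ℕ} [hp : Fact p.Prime] [CharP B p] {t : B}

/-- The operator `∑ a k X ^ k ↦ ∑ a (m p + p - 1) t ^ m` on polynomials. -/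
noncomputable def cartierPoly (p : ℕ) (t : B) : B[X] →ₗ[B] B :=
  Polynomial.lsum fun k => if k % p = p - 1 then LinearMap.mulRight B (t ^ (k / p)) else 0

lemma cartierPoly_monomial (k : ℕ) (a : B) :
    cartierPoly p t (monomial k a) = if k % p = p - 1 then a * t ^ (k / p) else 0 := by
  rw [cartierPoly, lsum_apply, sum_monomial_index]
  · split_ifs <;> simp
  · simp

/-- Multiplying by X^p shifts the block index m by one, which has the same effect as multiplying by
t. So the operator descends from polynomials to B. -/
lemma cartierPoly_mul (S : B[X]) : cartierPoly p t ((X ^ p - C t) * S) = 0 := by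
  rw [sub_mul, map_sub, sub_eq_zero]
  induction S using Polynomial.induction_on' with
  | add a b ha hb => rw [mul_add, mul_add, map_add, map_add, ha, hb]
  | monomial k a =>
    rw [X_pow_mul_monomial, C_mul_monomial, cartierPoly_monomial, cartierPoly_monomial]
    simp only [Nat.add_mod_right]
    rw [Nat.add_div_right _ hp.out.pos, pow_succ]
    split_ifs <;> ring

/-- The data attached to a uniformizer `t` of a discrete valuation ring `B` such that `B` is
generated by `t` over the subring of `p`-th powers. -/
structure IsPBasis (p : ℕ) [Fact p.Prime] [CharP B p] (t : B) : Prop where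
  irreducible : Irreducible t
  surjective : Function.Surjective (frobEval p t)

namespace IsPBasis

variable (ht : IsPBasis p t)

include ht in
lemma lift_eq {G : Type*} [AddCommGroup G] (F : B[X] →+ G)
    (hF : ∀ S, F ((X ^ p - C t) * S) = 0) {R R' : B[X]} (h : frobEval p t R = frobEval p t R') :
    F R = F R' := by
  rw [← sub_eq_zero, ← map_sub] at h
  obtain ⟨S, hS⟩ := X_pow_sub_C_dvd_of_frobEval_eq_zero ht.irreducible h
  rw [← sub_eq_zero, ← map_sub, hS, hF]

/-- A polynomial representing an element. -/
noncomputable def repr (b : B) : B[X] := (ht.surjective b).choose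

lemma frobEval_repr (b : B) : frobEval p t (ht.repr b) = b := (ht.surjective b).choose_spec

/-- The Cartier operator. -/
noncomputable def cartier (b : B) : B := cartierPoly p t (ht.repr b)

lemma cartier_frobEval (R : B[X]) : ht.cartier (frobEval p t R) = cartierPoly p t R :=
  ht.lift_eq (cartierPoly p t).toAddMonoidHom cartierPoly_mul (ht.frobEval_repr _)

/-- The derivation `d/dt`, as a function. -/
noncomputable def deriv (b : B) : B := frobEval p t (derivative (ht.repr b))

lemma deriv_frobEval (R : B[X]) : ht.deriv (frobEval p t R) = frobEval p t (derivative R) := by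
  refine ht.lift_eq ((frobEval p t).toAddMonoidHom.comp
    (derivative (R := B)).toAddMonoidHom) (fun S => ?_) (ht.frobEval_repr _)
  change frobEval p t (derivative ((X ^ p - C t) * S)) = 0
  rw [derivative_mul, map_add, map_mul, map_mul, frobEval_X_pow_sub_C, zero_mul, add_zero,
    derivative_sub, derivative_C, sub_zero, derivative_X_pow, CharP.cast_eq_zero, C_0, zero_mul,
    map_zero, zero_mul]

lemma cartier_add (x y : B) : ht.cartier (x + y) = ht.cartier x + ht.cartier y := by
  obtain ⟨R, rfl⟩ := ht.surjective x
  obtain ⟨S, rfl⟩ := ht.surjective y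
  rw [← map_add, cartier_frobEval, cartier_frobEval, cartier_frobEval, map_add]

lemma cartier_pow_mul (b x : B) : ht.cartier (b ^ p * x) = b * ht.cartier x := by
  obtain ⟨R, rfl⟩ := ht.surjective x
  rw [← frobEval_C (t := t), ← map_mul, cartier_frobEval, cartier_frobEval, ← smul_eq_C_mul,
    map_smul, smul_eq_mul]

lemma cartier_zero : ht.cartier 0 = 0 := by
  have := ht.cartier_frobEval 0
  rwa [map_zero, map_zero] at this

lemma cartier_sum {ι : Type*} (s : Finset ι) (x : ι → B) :
    ht.cartier (∑ i ∈ s, x i) = ∑ i ∈ s, ht.cartier (x i) :=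
  map_sum (⟨⟨ht.cartier, ht.cartier_zero⟩, ht.cartier_add⟩ : B →+ B) x s

lemma deriv_add (x y : B) : ht.deriv (x + y) = ht.deriv x + ht.deriv y := by
  obtain ⟨R, rfl⟩ := ht.surjective x
  obtain ⟨S, rfl⟩ := ht.surjective y
  rw [← map_add, deriv_frobEval, deriv_frobEval, deriv_frobEval, map_add, map_add]

lemma deriv_mul (x y : B) : ht.deriv (x * y) = x * ht.deriv y + y * ht.deriv x := by
  obtain ⟨R, rfl⟩ := ht.surjective x
  obtain ⟨S, rfl⟩ := ht.surjective y
  rw [← map_mul, deriv_frobEval, deriv_frobEval, deriv_frobEval, derivative_mul, map_add, map_mul,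
    map_mul]
  ring

/-- The derivation `d/dt`. -/
noncomputable def derivation : Derivation ℤ B B :=
  Derivation.mk' (AddMonoidHom.toIntLinearMap (AddMonoidHom.mk' ht.deriv ht.deriv_add))
    fun x y => ht.deriv_mul x y

lemma derivation_apply (b : B) : ht.derivation b = ht.deriv b := rfl

lemma deriv_pow (x : B) (k : ℕ) : ht.deriv (x ^ k) = k * (x ^ (k - 1) * ht.deriv x) := by
  rw [← derivation_apply, Derivation.leibniz_pow, derivation_apply]
  simp

lemma deriv_pow_p (x : B) : ht.deriv (x ^ p) = 0 := by
  rw [deriv_pow, CharP.cast_eq_zero, zero_mul]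

lemma deriv_pow_p_mul (c x : B) : ht.deriv (c ^ p * x) = c ^ p * ht.deriv x := by
  rw [deriv_mul, deriv_pow_p, mul_zero, add_zero]

lemma deriv_self : ht.deriv t = 1 := by
  have := ht.deriv_frobEval X
  rwa [frobEval_X, derivative_X, map_one] at this

lemma cartier_deriv (x : B) : ht.cartier (ht.deriv x) = 0 := by
  obtain ⟨R, rfl⟩ := ht.surjective x
  rw [deriv_frobEval, cartier_frobEval]
  induction R using Polynomial.induction_on' with
  | add a b ha hb => rw [map_add, map_add, ha, hb, add_zero]
  | monomial k a =>
    rw [derivative_monomial, cartierPoly_monomial]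
    split_ifs with h
    · rcases Nat.eq_zero_or_pos k with rfl | hk
      · simp
      -- Only exponents k - 1 ≡ p - 1 modulo p are seen by the operator, and for these the factor k
      -- of the derivative vanishes.
      have : p ∣ k := by
        have h1 := Nat.mod_add_div (k - 1) p
        have h2 := hp.out.pos
        refine ⟨(k - 1) / p + 1, ?_⟩
        rw [h] at h1
        rw [mul_add]
        omega
      rw [(CharP.cast_eq_zero_iff B p k).2 this]
      simp
    · rfl

/-- The Cartier operator fixes logarithmic differentials: `κ(z ^ (p - 1) z') = z'`. -/
lemma cartier_pow_mul_deriv (z : B) : ht.cartier (z ^ (p - 1) * ht.deriv z) = ht.deriv z := by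
  obtain ⟨R, rfl⟩ := ht.surjective z
  have hp0 := hp.out.pos
  rw [deriv_frobEval, ← map_pow, ← map_mul, cartier_frobEval]
  have h1 : ∀ (S : B[X]) (n : ℕ), S.natDegree < n * p → cartierPoly p t S =
      ∑ m ∈ Finset.range n, S.coeff (m * p + (p - 1)) * t ^ m := by
    intro S n hS
    rw [cartierPoly, lsum_apply, sum_over_range' _ _ _ hS]
    · symm
      refine Finset.sum_of_injOn (fun m => m * p + (p - 1)) ?_ ?_ ?_ ?_
      · intro a _ b _ hab
        exact Nat.eq_of_mul_eq_mul_right hp0 (by simpa using hab)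
      · intro m hm
        simp only [Finset.coe_range, Set.mem_Iio] at hm ⊢
        have := Nat.mul_le_mul_right p (Nat.succ_le_of_lt hm)
        rw [Nat.succ_mul] at this
        omega
      · intro k hk hk'
        rw [if_neg]
        · rfl
        intro h
        apply hk'
        have h1 := Nat.mod_add_div k p
        refine ⟨k / p, ?_, ?_⟩
        · simp only [Finset.coe_range, Set.mem_Iio, Finset.mem_range] at hk ⊢
          exact Nat.div_lt_of_lt_mul (by rwa [mul_comm])
        · simp only
          rw [h] at h1
          rw [mul_comm]
          omega
      · intro m _
        rw [if_pos, LinearMap.mulRight_apply]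
        · congr 2
          rw [add_comm, Nat.add_mul_div_right _ _ hp0, Nat.div_eq_of_lt (by omega), zero_add]
        · rw [add_comm, Nat.add_mul_mod_self_right, Nat.mod_eq_of_lt (by omega)]
    · intro k; split_ifs <;> simp
  obtain ⟨n, hn1, hn2⟩ : ∃ n, (R ^ (p - 1) * derivative R).natDegree < n * p ∧
      (derivative R).natDegree < n := by
    refine ⟨max (R ^ (p - 1) * derivative R).natDegree (derivative R).natDegree + 1, ?_, ?_⟩
    · refine lt_of_lt_of_le (Nat.lt_succ_of_le (le_max_left _ _)) (Nat.le_mul_of_pos_right _ hp0)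
    · exact Nat.lt_succ_of_le (le_max_right _ _)
  rw [h1 _ n hn1, frobEval_eq_sum hn2]
  refine Finset.sum_congr rfl fun m _ => ?_
  rw [coeff_pow_mul_derivative, coeff_derivative, mul_pow]
  have : ((m : B) + 1) ^ p = m + 1 := by
    have h := map_natCast (frobenius B p) (m + 1)
    rw [frobenius_def] at h
    push_cast at h
    exact h
  rw [this]
  push_cast
  ring

end IsPBasis

end Cartier

/-! ### Conductors along a `p`-monogenic extension -/

namespace IsPBasis

variable {B : Type*} [CommRing B] [IsDomain B] [IsDiscreteValuationRing B]
  {p : ℕ} [hp : Fact p.Prime] [CharP B p] {t : B} (ht : IsPBasis p t)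

/-- (m + 1) z^m dz/dt is the derivative of z^(m+1), hence killed by the operator; m + 1 equals its
own p-th power in B, so it comes out of the operator, and it is nonzero because m + 1 < p. -/
lemma cartier_pow_mul_deriv_of_lt (z : B) {m : ℕ} (hm : m < p - 1) :
    ht.cartier (z ^ m * ht.deriv z) = 0 := by
  have h0 := ht.cartier_deriv (z ^ (m + 1))
  rw [ht.deriv_pow, Nat.add_sub_cancel] at h0
  have h1 : ((m + 1 : ℕ) : B) = ((m + 1 : ℕ) : B) ^ p := by
    have h := map_natCast (frobenius B p) (m + 1)
    rw [frobenius_def] at h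
    exact h.symm
  rw [h1, cartier_pow_mul] at h0
  refine (mul_eq_zero.1 h0).resolve_left ?_
  intro h
  rw [CharP.cast_eq_zero_iff B p] at h
  revert h
  exact Nat.not_dvd_of_pos_of_lt (Nat.succ_pos _) (by omega)

/-- The powers z^k and z^(p-1-j) are dual, up to the factor dz/dt, for the pairing (x, y) ↦ κ(x y
dz/dt). When k > j a factor z^p leaves κ and an exponent below p - 1 remains. -/
lemma cartier_pow_add (z : B) {k j : ℕ} (hk : k < p) (hj : j < p) :
    ht.cartier (z ^ k * ht.deriv z * z ^ (p - 1 - j)) = if k = j then ht.deriv z else 0 := by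
  rw [mul_right_comm, ← pow_add]
  split_ifs with h
  · rw [show k + (p - 1 - j) = p - 1 by omega, cartier_pow_mul_deriv]
  · rcases lt_or_gt_of_ne h with h | h
    · exact ht.cartier_pow_mul_deriv_of_lt z (by omega)
    · rw [show k + (p - 1 - j) = p + (k - j - 1) by omega, pow_add, mul_assoc, cartier_pow_mul,
        ht.cartier_pow_mul_deriv_of_lt z (by omega), mul_zero]

lemma cartier_sum_pow_mul (z : B) (w : ℕ → B) {j : ℕ} (hj : j < p) :
    ht.cartier ((∑ k ∈ Finset.range p, w k ^ p * z ^ k) * ht.deriv z * z ^ (p - 1 - j)) =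
      ht.deriv z * w j := by
  rw [Finset.sum_mul, Finset.sum_mul, cartier_sum,
    Finset.sum_congr rfl (g := fun k => if k = j then ht.deriv z * w j else 0)]
  · rw [Finset.sum_ite_eq' , if_pos (Finset.mem_range.2 hj)]
  · intro k hk
    rw [mul_assoc, mul_assoc, cartier_pow_mul, ← mul_assoc,
      ht.cartier_pow_add z (Finset.mem_range.1 hk) hj]
    split_ifs with h
    · rw [h, mul_comm]
    · rw [mul_zero]

lemma deriv_sum_pow_mul (z : B) (w : ℕ → B) :
    ht.deriv z ∣ ht.deriv (∑ k ∈ Finset.range p, w k ^ p * z ^ k) := by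
  have h := map_sum ht.derivation (fun k => w k ^ p * z ^ k) (Finset.range p)
  rw [derivation_apply] at h
  rw [h]
  refine Finset.dvd_sum fun k _ => ?_
  rw [derivation_apply, deriv_pow_p_mul, deriv_pow]
  exact Dvd.intro_left (w k ^ p * (k * z ^ (k - 1))) (by ring)

/-- `W` consists of the elements `∑ w j ^ p * z ^ j` with `w j ∈ W'`. -/
def _root_.IsPMonogenic (p : ℕ) (z : B) (W W' : Set B) : Prop :=
  ∀ x, x ∈ W ↔ ∃ w : ℕ → B, (∀ j, w j ∈ W') ∧ x = ∑ j ∈ Finset.range p, w j ^ p * z ^ j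

section

variable {z : B} {W W' : Set B} (hW : IsPMonogenic p z W W')
include hW

lemma deriv_dvd_deriv {x : B} (hx : x ∈ W) : ht.deriv z ∣ ht.deriv x := by
  obtain ⟨w, -, rfl⟩ := (hW x).1 hx
  exact ht.deriv_sum_pow_mul z w

variable {N : ℕ} (hN : ∀ y, t ^ N * y ∈ W)
include hN

/-- Otherwise d/dt would vanish on W, which contains t^n for some n ≥ N prime to p. -/
lemma deriv_ne_zero : ht.deriv z ≠ 0 := by
  intro h0
  obtain ⟨n, hn, hpn⟩ : ∃ n, N ≤ n ∧ ¬ p ∣ n := by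
    by_cases h : p ∣ N
    · refine ⟨N + 1, Nat.le_succ N, fun h' => ?_⟩
      exact hp.out.one_lt.ne' (Nat.dvd_one.1 ((Nat.dvd_add_right h).1 h'))
    · exact ⟨N, le_rfl, h⟩
  have h1 := ht.deriv_dvd_deriv hW (hN (t ^ (n - N)))
  rw [← pow_add, Nat.add_sub_cancel' hn, h0, zero_dvd_iff, deriv_pow, deriv_self, mul_one] at h1
  rcases mul_eq_zero.1 h1 with h | h
  · exact hpn ((CharP.cast_eq_zero_iff B p n).1 h)
  · exact pow_ne_zero _ ht.irreducible.ne_zero h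

/-- The duality of the powers of z gives this for x in W. Both sides are multiplied by c^p when x
is, and (t^N)^p x lies in W, so it holds on all of B. -/
lemma deriv_pow_mul_eq (x : B) : ht.deriv z ^ p * x =
    ∑ j ∈ Finset.range p, ht.cartier (x * ht.deriv z * z ^ (p - 1 - j)) ^ p * z ^ j := by
  have h1 : (t ^ N) ^ p * x ∈ W := by
    rw [← Nat.sub_add_cancel hp.out.one_le, pow_succ', mul_assoc]
    exact hN _
  obtain ⟨w, -, hw⟩ := (hW _).1 h1
  have h0 : (t ^ N) ^ p ≠ 0 := pow_ne_zero _ (pow_ne_zero _ ht.irreducible.ne_zero)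
  apply mul_left_cancel₀ h0
  rw [mul_left_comm, hw, Finset.mul_sum, Finset.mul_sum]
  refine Finset.sum_congr rfl fun j hj => ?_
  have h2 := ht.cartier_sum_pow_mul z w (Finset.mem_range.1 hj)
  rw [← hw, mul_assoc, mul_assoc, cartier_pow_mul, ← mul_assoc] at h2
  rw [← mul_assoc, ← mul_assoc, ← mul_pow, ← mul_pow, h2]

/-- The coefficient of z^(p-1-j) in x is the p-th power of κ(x z' z^j)/z', where z' = dz/dt.
Membership in W is thereby expressed by the additive operator κ, which behaves well on ideals of B.
-/
lemma mem_iff_cartier (x : B) :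
    x ∈ W ↔ ∀ j < p, ∃ w ∈ W', ht.cartier (x * ht.deriv z * z ^ j) = ht.deriv z * w := by
  have hd := ht.deriv_ne_zero hW hN
  constructor
  · intro hx j hj
    obtain ⟨w, hw, rfl⟩ := (hW x).1 hx
    refine ⟨w (p - 1 - j), hw _, ?_⟩
    rw [← ht.cartier_sum_pow_mul z w (by omega), show p - 1 - (p - 1 - j) = j by omega]
  · intro h
    have h' : ∀ j, ∃ w ∈ W', ht.cartier (x * ht.deriv z * z ^ (p - 1 - j)) = ht.deriv z * w :=
      fun j => h _ (by have := hp.out.pos; omega)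
    choose w hw hw' using h'
    refine (hW x).2 ⟨w, hw, ?_⟩
    apply mul_left_cancel₀ (pow_ne_zero p hd)
    rw [ht.deriv_pow_mul_eq hW hN, Finset.mul_sum]
    refine Finset.sum_congr rfl fun j _ => ?_
    rw [hw', mul_pow, mul_assoc]

end

lemma cartier_uniformizer_pow : ht.cartier (t ^ (p - 1)) = 1 := by
  have := ht.cartier_pow_mul_deriv t
  rwa [deriv_self, mul_one] at this

/-- Together with `exists_cartier_pow_mul_eq`, this computes κ(t^m B) = t^⌊m/p⌋ B. -/
lemma dvd_cartier_pow_mul (m : ℕ) (y : B) : t ^ (m / p) ∣ ht.cartier (t ^ m * y) := by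
  rw [← Nat.div_add_mod m p, pow_add, mul_comm p, pow_mul, mul_assoc, cartier_pow_mul,
    mul_comm _ p, Nat.mul_add_div hp.out.pos, Nat.div_eq_of_lt (Nat.mod_lt _ hp.out.pos), add_zero]
  exact dvd_mul_right _ _

lemma exists_cartier_pow_mul_eq (m : ℕ) (c : B) : ∃ y, ht.cartier (t ^ m * y) = t ^ (m / p) * c := by
  -- The power of t raises the exponent m to the next one congruent to p - 1 modulo p, where
  -- κ(t^(p-1)) = 1 applies.
  refine ⟨c ^ p * t ^ (p - 1 - m % p), ?_⟩
  have h := Nat.mod_lt m hp.out.pos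
  have : t ^ m * (c ^ p * t ^ (p - 1 - m % p)) = (t ^ (m / p) * c) ^ p * t ^ (p - 1) := by
    have h3 : t ^ m = (t ^ (m / p)) ^ p * t ^ (m % p) := by
      rw [← pow_mul, ← pow_add, Nat.div_add_mod']
    have h2 : t ^ (p - 1) = t ^ (m % p) * t ^ (p - 1 - m % p) := by
      rw [← pow_add, show m % p + (p - 1 - m % p) = p - 1 by omega]
    rw [h2, h3, mul_pow]
    ring
  rw [this, cartier_pow_mul, cartier_uniformizer_pow, mul_one]

/-- The recursion for the conductor exponents. -/
theorem conductor_step {z : B} {W W' : Set B} (hW : IsPMonogenic p z W W')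
    {N₀ : ℕ} (hN₀ : ∀ y, t ^ N₀ * y ∈ W) {c : ℕ} (hc : ∀ m, (∀ y, t ^ m * y ∈ W') ↔ c ≤ m)
    {e : ℕ} {v : Bˣ} (he : ht.deriv z = v * t ^ e) (N : ℕ) :
    (∀ y, t ^ N * y ∈ W) ↔ (p - 1) * e + p * c ≤ N := by
  have ht0 := ht.irreducible.ne_zero
  -- As y runs through B, the unit v and the factors z^j are absorbed, and the p conditions of
  -- `mem_iff_cartier` collapse to the one with j = 0.
  have h1 : (∀ y, t ^ N * y ∈ W) ↔
      ∀ y, ∃ w ∈ W', ht.cartier (t ^ (N + e) * y) = ht.deriv z * w := by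
    constructor
    · intro h y
      obtain ⟨w, hw, hw'⟩ := (ht.mem_iff_cartier hW hN₀ _).1 (h (↑v⁻¹ * y)) 0 hp.out.pos
      refine ⟨w, hw, ?_⟩
      rw [← hw', he, pow_zero, mul_one, pow_add]
      congr 1
      calc t ^ N * t ^ e * y = t ^ N * t ^ e * y * (↑v⁻¹ * v) := by simp
        _ = _ := by ring
    · intro h y
      refine (ht.mem_iff_cartier hW hN₀ _).2 fun j _ => ?_
      obtain ⟨w, hw, hw'⟩ := h (v * y * z ^ j)
      refine ⟨w, hw, ?_⟩
      rw [← hw']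
      conv_lhs => rw [he]
      congr 1
      ring
  -- The left side says that t^⌊(N+e)/p⌋ B is contained in t^e W'; the element 1 of B already forces
  -- e ≤ ⌊(N+e)/p⌋, so the subtraction on the right is not truncated.
  have h2 : (∀ y, ∃ w ∈ W', ht.cartier (t ^ (N + e) * y) = ht.deriv z * w) ↔
      e ≤ (N + e) / p ∧ ∀ y, t ^ ((N + e) / p - e) * y ∈ W' := by
    constructor
    · intro h
      have h3 : ∀ b, ∃ w ∈ W', t ^ ((N + e) / p) * b = v * t ^ e * w := by
        intro b
        obtain ⟨y, hy⟩ := ht.exists_cartier_pow_mul_eq (N + e) b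
        obtain ⟨w, hw, hw'⟩ := h y
        exact ⟨w, hw, by rw [← hy, hw', he]⟩
      have h4 : e ≤ (N + e) / p := by
        obtain ⟨w, -, hw⟩ := h3 1
        have h5 : t ^ e ∣ t ^ ((N + e) / p) := by
          rw [mul_one] at hw
          rw [hw]
          exact Dvd.intro_left (↑v * w) (by ring)
        exact (pow_dvd_pow_iff ht0 ht.irreducible.not_isUnit).1 h5
      refine ⟨h4, fun y => ?_⟩
      obtain ⟨w, hw, hw'⟩ := h3 (v * y)
      convert hw
      apply mul_left_cancel₀ (mul_ne_zero v.ne_zero (pow_ne_zero e ht0))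
      rw [← hw', ← Nat.sub_add_cancel h4, pow_add, Nat.sub_add_cancel h4]
      ring
    · rintro ⟨h4, h⟩ y
      obtain ⟨b, hb⟩ := ht.dvd_cartier_pow_mul (N + e) y
      refine ⟨_, h (↑v⁻¹ * b), ?_⟩
      rw [hb, he]
      calc t ^ ((N + e) / p) * b = t ^ ((N + e) / p - e + e) * b * (v * ↑v⁻¹) := by
            rw [Nat.sub_add_cancel h4]; simp
        _ = _ := by rw [pow_add]; ring
  rw [h1, h2, hc]
  have h5 : (e ≤ (N + e) / p ∧ c ≤ (N + e) / p - e) ↔ (c + e) ≤ (N + e) / p := by omega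
  rw [h5, Nat.le_div_iff_mul_le hp.out.pos]
  obtain ⟨q, hq⟩ : ∃ q, p = q + 1 := ⟨p - 1, (Nat.sub_add_cancel hp.out.one_le).symm⟩
  rw [hq, Nat.add_sub_cancel]
  constructor <;> intro h <;> nlinarith

/-! ### Differentials -/

section Differentials

open KaehlerDifferential

variable {A : Type*} [CommRing A] [Algebra A B] {z : B}

/-- `d/dt` modulo `dz/dt`, as a derivation over a ring on which `d/dt` is divisible by `dz/dt`. -/
noncomputable def derivationQuot (hA : ∀ a : A, ht.deriv z ∣ ht.deriv (algebraMap A B a)) :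
    Derivation A B (B ⧸ Ideal.span {ht.deriv z}) :=
  Derivation.mk'
    { toFun := fun b => Ideal.Quotient.mk _ (ht.deriv b)
      map_add' := fun x y => by rw [deriv_add, map_add]
      map_smul' := fun a x => by
        rw [Algebra.smul_def, deriv_mul, map_add, RingHom.id_apply,
          (Ideal.Quotient.eq_zero_iff_mem (a := x * _)).2, add_zero]
        · rw [map_mul, Algebra.smul_def]
          rfl
        · exact Ideal.mul_mem_left _ _ (Ideal.mem_span_singleton.2 (hA a)) }
    fun x y => by
      change Ideal.Quotient.mk _ (ht.deriv (x * y)) = _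
      rw [deriv_mul, map_add, map_mul, map_mul]
      rfl

lemma derivationQuot_apply (hA : ∀ a : A, ht.deriv z ∣ ht.deriv (algebraMap A B a)) (b : B) :
    ht.derivationQuot hA b = Ideal.Quotient.mk _ (ht.deriv b) := rfl

include ht in
lemma D_pow_p (x : B) : D A B (x ^ p) = 0 := by
  rw [Derivation.leibniz_pow, ← Nat.cast_smul_eq_nsmul B, CharP.cast_eq_zero, zero_smul]

/-- Differentials of p-th powers vanish in characteristic p, so the expansion in powers of t shows
that dt generates the module, over any base ring. -/
lemma D_eq (b : B) : D A B b = ht.deriv b • D A B t := by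
  obtain ⟨R, rfl⟩ := ht.surjective b
  rw [deriv_frobEval]
  induction R using Polynomial.induction_on' with
  | add f g hf hg => simp only [map_add, hf, hg, add_smul]
  | monomial k a =>
    rw [Polynomial.derivative_monomial, ← Polynomial.C_mul_X_pow_eq_monomial,
      ← Polynomial.C_mul_X_pow_eq_monomial, map_mul (frobEval p t), map_mul (frobEval p t),
      frobEval_C, frobEval_C, map_pow (frobEval p t), map_pow (frobEval p t), frobEval_X, Derivation.leibniz, ht.D_pow_p, smul_zero, add_zero,
      Derivation.leibniz_pow, mul_pow]
    have h := map_natCast (frobenius B p) k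
    rw [frobenius_def] at h
    rw [h, mul_assoc, mul_smul, mul_smul, Nat.cast_smul_eq_nsmul B k]

/-- The map `b ↦ b dt`. -/
noncomputable def kaehlerInv {a : A} (ha : algebraMap A B a = z) :
    (B ⧸ Ideal.span {ht.deriv z}) →ₗ[B] Ω[B⁄A] :=
  Submodule.liftQ _ (LinearMap.toSpanSingleton B Ω[B⁄A] (D A B t)) (by
    rw [Ideal.span, Submodule.span_le, Set.singleton_subset_iff, SetLike.mem_coe,
      LinearMap.mem_ker, LinearMap.toSpanSingleton_apply, ← ht.D_eq, ← ha,
      Derivation.map_algebraMap])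

lemma kaehlerInv_mk {a : A} (ha : algebraMap A B a = z) (b : B) :
    ht.kaehlerInv ha (Ideal.Quotient.mk _ b) = b • D A B t := rfl

/-- The differentials of `B` over a ring containing `z` on which `d/dt` is divisible by `dz/dt`. -/
noncomputable def kaehlerEquiv (hA : ∀ a : A, ht.deriv z ∣ ht.deriv (algebraMap A B a)) {a : A}
    (ha : algebraMap A B a = z) : Ω[B⁄A] ≃ₗ[B] B ⧸ Ideal.span {ht.deriv z} :=
  LinearEquiv.ofLinearMap (ht.derivationQuot hA).liftKaehlerDifferential (ht.kaehlerInv ha)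
    (by
      apply Submodule.linearMap_qext
      ext
      change (ht.derivationQuot hA).liftKaehlerDifferential
        (ht.kaehlerInv ha (Ideal.Quotient.mk _ 1)) = Ideal.Quotient.mk _ 1
      rw [kaehlerInv_mk, one_smul, Derivation.liftKaehlerDifferential_comp_D, derivationQuot_apply,
        deriv_self])
    (by
      apply Derivation.liftKaehlerDifferential_unique
      ext b
      change ht.kaehlerInv ha ((ht.derivationQuot hA).liftKaehlerDifferential (D A B b)) = D A B b
      rw [Derivation.liftKaehlerDifferential_comp_D, derivationQuot_apply, kaehlerInv_mk, ← D_eq])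

end Differentials

end IsPBasis

/-! ### The dimension of B/t^e over a field of representatives of the residues -/

section Length

variable {L B : Type*} [Field L] [CommRing B] [IsDomain B] [IsDiscreteValuationRing B] [Algebra L B]
  {t : B} (ht : Irreducible t) (hL : ∀ b : B, ∃ l : L, t ∣ b - algebraMap L B l)

include ht hL

/-- This is the t-adic expansion with digits in L: the residue gives the next digit, and two
expansions are separated at the first place where they differ, since nonzero elements of L are units
of B. -/
lemma bijective_quotient_pow (e : ℕ) : Function.Bijective
    (fun l : Fin e → L => Ideal.Quotient.mk (Ideal.span {t ^ e})
      (∑ j, algebraMap L B (l j) * t ^ (j : ℕ))) := by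
  have hunit : ∀ l : L, t ∣ algebraMap L B l → l = 0 := by
    intro l hl
    by_contra h0
    exact ht.not_isUnit (isUnit_of_dvd_unit hl ((IsUnit.mk0 l h0).map (algebraMap L B)))
  constructor
  · intro l l' h
    rw [Ideal.Quotient.eq, Ideal.mem_span_singleton, ← Finset.sum_sub_distrib] at h
    by_contra hne
    have hex : ∃ j : ℕ, ∃ hj : j < e, l ⟨j, hj⟩ ≠ l' ⟨j, hj⟩ := by
      by_contra! hall
      exact hne (funext fun j => hall j.1 j.2)
    classical
    obtain ⟨hj, hlj⟩ := Nat.find_spec hex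
    set j := Nat.find hex
    have h1 : t ^ (j + 1) ∣ ∑ i : Fin e, (algebraMap L B (l i) * t ^ (i : ℕ) -
        algebraMap L B (l' i) * t ^ (i : ℕ)) := (pow_dvd_pow t hj).trans h
    rw [← Finset.add_sum_erase _ _ (Finset.mem_univ (⟨j, hj⟩ : Fin e))] at h1
    have h2 := (dvd_add_left (Finset.dvd_sum fun i hi => ?_)).1 h1
    · simp only [← sub_mul, ← map_sub] at h2
      rw [pow_succ', mul_dvd_mul_iff_right (pow_ne_zero _ ht.ne_zero)] at h2
      exact hlj (sub_eq_zero.1 (hunit _ h2))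
    · rw [Finset.mem_erase] at hi
      have hij : (i : ℕ) ≠ j := fun h => hi.1 (Fin.ext h)
      rcases lt_or_gt_of_ne hij with h3 | h3
      · have := Nat.find_min hex h3
        push Not at this
        rw [this i.2, sub_self]
        exact dvd_zero _
      · rw [← sub_mul]
        exact Dvd.dvd.mul_left (pow_dvd_pow t h3) _
  · intro x
    obtain ⟨b, rfl⟩ := Ideal.Quotient.mk_surjective x
    suffices H : ∀ e, ∃ l : ℕ → L, t ^ e ∣ (∑ j ∈ Finset.range e, algebraMap L B (l j) * t ^ j) - b by
      obtain ⟨l, hl⟩ := H e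
      refine ⟨fun j => l j, ?_⟩
      rw [Ideal.Quotient.eq, Ideal.mem_span_singleton]
      rwa [Finset.sum_range] at hl
    intro e
    induction e with
    | zero => exact ⟨0, by simp⟩
    | succ e ih =>
      obtain ⟨l, d, hd⟩ := ih
      -- The error so far is t^e d; the new digit m must satisfy m ≡ -d modulo t.
      obtain ⟨m, hm⟩ := hL (-d)
      refine ⟨Function.update l e m, ?_⟩
      rw [Finset.sum_range_succ, Function.update_self, Finset.sum_congr rfl
        (g := fun j => algebraMap L B (l j) * t ^ j), add_sub_right_comm, hd, mul_comm (t ^ e),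
        ← add_mul, pow_succ', mul_dvd_mul_iff_right (pow_ne_zero _ ht.ne_zero)]
      · rw [← dvd_neg, neg_add, ← sub_eq_add_neg]
        exact hm
      · intro j hj
        rw [Function.update_of_ne (Finset.mem_range.1 hj).ne]

/-- The linear equivalence `L ^ e ≃ B / t ^ e`. -/
noncomputable def quotientPowEquiv (e : ℕ) : (Fin e → L) ≃ₗ[L] B ⧸ Ideal.span {t ^ e} :=
  LinearEquiv.ofBijective
    { toFun := fun l => Ideal.Quotient.mk (Ideal.span {t ^ e})
        (∑ j : Fin e, algebraMap L B (l j) * t ^ (j : ℕ))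
      map_add' := fun l l' => by
        simp only [Pi.add_apply, map_add, add_mul, Finset.sum_add_distrib]
      map_smul' := fun a l => by
        simp only [Pi.smul_apply, smul_eq_mul, map_mul, mul_assoc, ← Finset.mul_sum]
        rw [Algebra.smul_def]
        rfl }
    (bijective_quotient_pow ht hL e)

end Length

/-! ### Monogenicity -/

section Monogenic

variable {D : Type*} [CommRing D] [IsDomain D] (S : Subring D)
  (hdiv : ∀ x ∈ S, ∀ y ∈ S, y ≠ 0 → ∀ w, x = y * w → w ∈ S)

-- In a relation between 1, z, …, z^(n-1), x the coefficient a n of x is not zero, since otherwise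
-- `hstar`, used for all d, contradicts `hsep`. Then a n divides the combination of the powers of z,
-- hence by `hstar` each of the other coefficients, and the quotients stay in S.
include hdiv in
lemma exists_eq_sum_of_dependent (z : D) (n : ℕ)
    (hstar : ∀ a : ℕ → D, (∀ j, a j ∈ S) → ∀ d ∈ S, d ≠ 0 →
      d ∣ ∑ j ∈ Finset.range n, a j * z ^ j → ∀ j < n, d ∣ a j)
    (hsep : ∀ a : D, a ≠ 0 → ∃ d ∈ S, d ≠ 0 ∧ ¬ d ∣ a)
    (hdep : ∀ x : ℕ → D, ∃ a : ℕ → D, (∀ j, a j ∈ S) ∧ (∃ j < n + 1, a j ≠ 0) ∧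
      ∑ j ∈ Finset.range (n + 1), a j * x j = 0) (x : D) :
    ∃ a : ℕ → D, (∀ j, a j ∈ S) ∧ x = ∑ j ∈ Finset.range n, a j * z ^ j := by
  obtain ⟨a, haS, ⟨i, hi, hai⟩, ha⟩ := hdep fun j => if j < n then z ^ j else x
  rw [Finset.sum_range_succ, if_neg (lt_irrefl n), Finset.sum_congr rfl
    (g := fun j => a j * z ^ j) (fun j hj => by rw [if_pos (Finset.mem_range.1 hj)])] at ha
  have hn : a n ≠ 0 := by
    intro h0
    rw [h0, zero_mul, add_zero] at ha
    rcases Nat.lt_succ_iff_lt_or_eq.1 hi with hi | rfl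
    · obtain ⟨d, hd, hd0, hda⟩ := hsep _ hai
      exact hda (hstar a haS d hd hd0 (ha ▸ dvd_zero d) i hi)
    · exact hai h0
  have h1 := hstar a haS (a n) (haS n) hn
    ⟨-x, by rw [eq_neg_of_add_eq_zero_left ha, mul_neg]⟩
  have h2 : ∀ j, ∃ b ∈ S, j < n → a j = a n * b := by
    intro j
    by_cases hj : j < n
    · obtain ⟨b, hb⟩ := h1 j hj
      exact ⟨b, hdiv _ (haS j) _ (haS n) hn b hb, fun _ => hb⟩
    · exact ⟨0, S.zero_mem, fun h => absurd h hj⟩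
  choose b hbS hb using h2
  refine ⟨fun j => - b j, fun j => S.neg_mem (hbS j), ?_⟩
  apply mul_left_cancel₀ hn
  rw [eq_neg_of_add_eq_zero_right ha, ← Finset.sum_neg_distrib, Finset.mul_sum]
  refine Finset.sum_congr rfl fun j hj => ?_
  rw [hb j (Finset.mem_range.1 hj)]
  ring

variable [IsDiscreteValuationRing D] {p : ℕ} [hp : Fact p.Prime]

lemma exists_pow_not_dvd (hpow : ∀ x : D, x ^ p ∈ S) (a : D) (ha : a ≠ 0) :
    ∃ d ∈ S, d ≠ 0 ∧ ¬ d ∣ a := by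
  obtain ⟨t, ht⟩ := IsDiscreteValuationRing.exists_irreducible D
  obtain ⟨n, u, hu⟩ := IsDiscreteValuationRing.eq_unit_mul_pow_irreducible ha ht
  refine ⟨(t ^ (n + 1)) ^ p, hpow _, pow_ne_zero _ (pow_ne_zero _ ht.ne_zero), fun h => ?_⟩
  have h1 := (dvd_pow_self _ hp.out.ne_zero).trans h
  rw [hu, pow_succ', mul_dvd_mul_iff_right (pow_ne_zero _ ht.ne_zero)] at h1
  exact ht.not_isUnit (isUnit_of_dvd_unit h1 u.isUnit)

/-- The case where all the orders of the elements of `S` are multiples of `p`. -/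
lemma dvd_of_dvd_sum_of_order {t : D} (ht : Irreducible t)
    (hQ : ∀ a ∈ S, ∀ k, t ^ (p * k + 1) ∣ a → t ^ (p * k + p) ∣ a)
    (a : ℕ → D) (haS : ∀ j, a j ∈ S) (d : D) (hdS : d ∈ S) (hd : d ≠ 0)
    (h : d ∣ ∑ j ∈ Finset.range p, a j * t ^ j) : ∀ j < p, d ∣ a j := by
  obtain ⟨n, u, rfl⟩ := IsDiscreteValuationRing.eq_unit_mul_pow_irreducible hd ht
  have hn : n = p * (n / p) := by
    have h1 := Nat.div_add_mod n p
    by_contra hne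
    have h2 := hQ _ hdS (n / p) (Dvd.dvd.mul_left (pow_dvd_pow t (by omega)) _)
    have h3 := (pow_dvd_pow_iff ht.ne_zero ht.not_isUnit).1 ((Units.dvd_mul_left).1 h2)
    have := Nat.mod_lt n hp.out.pos
    omega
  intro j hj
  rw [Units.mul_left_dvd] at h ⊢
  rw [hn] at h ⊢
  exact pow_dvd_of_pow_dvd_sum ht.prime (fun j _ => hQ _ (haS j)) _ h j hj

/-- With a uniformizer t in S, independence modulo t bootstraps to independence modulo every power
of t: the coefficients can be divided by t inside S. -/
lemma dvd_of_dvd_sum_of_uniformizer (hdiv : ∀ x ∈ S, ∀ y ∈ S, y ≠ 0 → ∀ w, x = y * w → w ∈ S)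
    {t : D} (ht : Irreducible t) (htS : t ∈ S) {z : D} {n : ℕ}
    (h1 : ∀ a : ℕ → D, (∀ j, a j ∈ S) → t ∣ ∑ j ∈ Finset.range n, a j * z ^ j → ∀ j < n, t ∣ a j)
    (a : ℕ → D) (haS : ∀ j, a j ∈ S) (d : D) (hd : d ≠ 0)
    (h : d ∣ ∑ j ∈ Finset.range n, a j * z ^ j) : ∀ j < n, d ∣ a j := by
  obtain ⟨m, u, rfl⟩ := IsDiscreteValuationRing.eq_unit_mul_pow_irreducible hd ht
  simp only [Units.mul_left_dvd] at h ⊢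
  clear hd
  induction m generalizing a with
  | zero => simp
  | succ m ih =>
    have h2 := h1 a haS ((dvd_pow_self t (Nat.succ_ne_zero m)).trans h)
    have h3 : ∀ j, ∃ b ∈ S, j < n → a j = t * b := by
      intro j
      by_cases hj : j < n
      · obtain ⟨b, hb⟩ := h2 j hj
        exact ⟨b, hdiv _ (haS j) _ htS ht.ne_zero b hb, fun _ => hb⟩
      · exact ⟨0, S.zero_mem, fun h => absurd h hj⟩
    choose b hbS hb using h3
    rw [Finset.sum_congr rfl (g := fun j => t * (b j * z ^ j)) (fun j hj => by
      rw [hb j (Finset.mem_range.1 hj), mul_assoc]), ← Finset.mul_sum, pow_succ',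
      mul_dvd_mul_iff_left ht.ne_zero] at h
    intro j hj
    rw [hb j hj, pow_succ']
    exact mul_dvd_mul_left _ (ih b hbS h j hj)

/-- An element that is not in a subfield containing its `p`-th power has degree `p`. -/
lemma eq_zero_of_sum_eq_zero_of_not_mem {k : Type*} [Field k] [CharP k p] (k₁ : Subfield k) {z : k}
    (hz : z ∉ k₁) (hzp : z ^ p ∈ k₁) (a : ℕ → k) (ha : ∀ j, a j ∈ k₁)
    (h : ∑ j ∈ Finset.range p, a j * z ^ j = 0) : ∀ j < p, a j = 0 := by
  open Polynomial in
  have hirr : Irreducible (X ^ p - C (⟨z ^ p, hzp⟩ : k₁)) := by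
    refine X_pow_sub_C_irreducible_of_prime hp.out fun b hb => hz ?_
    have h1 : (b : k) ^ p = z ^ p := congrArg Subtype.val hb
    rw [← frobenius_inj k p h1]
    exact b.2
  have hmin : (X ^ p - C (⟨z ^ p, hzp⟩ : k₁)) = minpoly k₁ z :=
    minpoly.eq_of_irreducible_of_monic hirr (by
        rw [map_sub, map_pow, aeval_X, aeval_C]
        exact sub_self _)
      (monic_X_pow_sub_C _ hp.out.ne_zero)
  set f : k₁[X] := ∑ j ∈ Finset.range p, monomial j (⟨a j, ha j⟩ : k₁) with hf
  have hcoeff : ∀ j < p, f.coeff j = ⟨a j, ha j⟩ := by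
    intro j hj
    rw [hf, finsetSum_coeff]
    simp only [coeff_monomial]
    rw [Finset.sum_ite_eq', if_pos (Finset.mem_range.2 hj)]
  have hf0 : f = 0 := by
    by_contra hne
    have hroot : aeval z f = 0 := by
      rw [hf, map_sum, ← h]
      refine Finset.sum_congr rfl fun j _ => ?_
      rw [aeval_monomial]
      rfl
    have h1 := minpoly.degree_le_of_ne_zero k₁ z hne hroot
    rw [← hmin, degree_X_pow_sub_C hp.out.pos] at h1
    have h2 : f.degree < p := by
      rw [hf]
      refine (degree_sum_le _ _).trans_lt ((Finset.sup_lt_iff (WithBot.bot_lt_coe p)).2 ?_)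
      intro j hj
      exact (degree_monomial_le _ _).trans_lt (WithBot.coe_lt_coe.2 (Finset.mem_range.1 hj))
    exact absurd h1 (not_le.2 h2)
  intro j hj
  have := hcoeff j hj
  rw [hf0, coeff_zero] at this
  exact (congrArg Subtype.val this).symm

section

variable [CharP D p]
  (hdiv : ∀ x ∈ S, ∀ y ∈ S, y ≠ 0 → ∀ w, x = y * w → w ∈ S) (hpow : ∀ x : D, x ^ p ∈ S)
include hdiv hpow

/-- Independence over `S` modulo a uniformizer of an element whose residue is not a residue of an
element of `S`. -/
lemma dvd_of_dvd_sum_of_residue {t : D} (ht : Irreducible t) {z : D} (hz : ∀ a ∈ S, ¬ t ∣ z - a)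
    (a : ℕ → D) (haS : ∀ j, a j ∈ S) (h : t ∣ ∑ j ∈ Finset.range p, a j * z ^ j) :
    ∀ j < p, t ∣ a j := by
  let k := IsLocalRing.ResidueField D
  have : CharP k p := by
    rw [CharP.charP_iff_prime_eq_zero hp.out, ← map_natCast (IsLocalRing.residue D),
      CharP.cast_eq_zero, map_zero]
  have hres : ∀ x, IsLocalRing.residue D x = 0 ↔ t ∣ x := by
    intro x
    rw [IsLocalRing.residue_eq_zero_iff, ht.maximalIdeal_eq, Ideal.mem_span_singleton]
  -- The residues of S form a subfield, because S contains the inverses of those of its elements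
  -- that are units of D.
  let k₁ : Subfield k :=
    { S.map (IsLocalRing.residue D) with
      inv_mem' := by
        rintro _ ⟨x, hx, rfl⟩
        by_cases hxt : t ∣ x
        · rw [(hres x).2 hxt, inv_zero]
          exact (S.map (IsLocalRing.residue D)).zero_mem
        · have hu : IsUnit x := by
            by_contra hu
            exact hxt ((hres x).1 ((IsLocalRing.residue_eq_zero_iff x).2 hu))
          obtain ⟨u, rfl⟩ := hu
          refine ⟨↑u⁻¹, hdiv 1 S.one_mem u hx u.ne_zero _ (by simp), ?_⟩
          refine eq_inv_of_mul_eq_one_left ?_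
          rw [← map_mul]
          simp }
  intro j hj
  rw [← hres]
  refine eq_zero_of_sum_eq_zero_of_not_mem (p := p) k₁ (z := IsLocalRing.residue D z) ?_
    ⟨z ^ p, hpow z, map_pow _ _ _⟩ (fun j => IsLocalRing.residue D (a j)) (fun j => ⟨a j, haS j, rfl⟩)
    ?_ j hj
  · rintro ⟨x, hx, hxz⟩
    refine hz x hx ((hres _).1 ?_)
    rw [map_sub, hxz, sub_self]
  · rw [← (hres _).2 h, map_sum]
    simp only [map_mul, map_pow]

/-- If `S` has an element whose order is not a multiple of `p`, then it contains a uniformizer. -/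
lemma exists_irreducible_mem {t : D} (ht : Irreducible t)
    (h : ¬ ∀ a ∈ S, ∀ k, t ^ (p * k + 1) ∣ a → t ^ (p * k + p) ∣ a) : ∃ s ∈ S, Irreducible s := by
  push Not at h
  obtain ⟨a, haS, k, h1, h2⟩ := h
  have ha : a ≠ 0 := by rintro rfl; exact h2 (dvd_zero _)
  obtain ⟨m, u, rfl⟩ := IsDiscreteValuationRing.eq_unit_mul_pow_irreducible ha ht
  rw [Units.dvd_mul_left, pow_dvd_pow_iff ht.ne_zero ht.not_isUnit] at h1 h2
  have hcop : Nat.Coprime m p := by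
    refine ((Nat.Prime.coprime_iff_not_dvd hp.out).2 fun hd => ?_).symm
    obtain ⟨c, rfl⟩ := hd
    have h3 : k < c := Nat.lt_of_mul_lt_mul_left (a := p) (by omega)
    have := Nat.mul_le_mul_left p h3
    rw [Nat.succ_eq_add_one, mul_add] at this
    omega
  -- With mn ≡ 1 modulo p, the n-th power of an element of order m has order 1 modulo p; dividing it
  -- by a p-th power, which lies in S, gives a uniformizer.
  obtain ⟨n, -, hn⟩ := Nat.exists_mul_mod_eq_one_of_coprime hcop hp.out.one_lt
  have h3 := Nat.div_add_mod (m * n) p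
  rw [hn] at h3
  refine ⟨t * (u ^ n : Dˣ), ?_, ?_⟩
  · refine hdiv _ (S.pow_mem haS n) _ (hpow (t ^ (m * n / p)))
      (pow_ne_zero _ (pow_ne_zero _ ht.ne_zero)) _ ?_
    rw [mul_pow, ← pow_mul, ← h3, pow_add, ← pow_mul, Units.val_pow_eq_pow_val]
    rw [Nat.add_div_of_dvd_right (Dvd.intro _ rfl), Nat.mul_div_cancel_left _ hp.out.pos,
      Nat.div_eq_of_lt hp.out.one_lt]
    ring
  · exact (irreducible_mul_units _).2 ht

/-- An extension of degree at most p containing all p-th powers has three types. If all orders of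
elements of S are multiples of p (ramified), a uniformizer generates. Otherwise S contains a
uniformizer s; if some residue does not come from S (inseparable residue extension), any lift of it
generates. In the remaining immediate case S is s-adically dense in D, which is what `hne` excludes.
-/
theorem exists_monogenic_generator
    (hdep : ∀ x : ℕ → D, ∃ a : ℕ → D, (∀ j, a j ∈ S) ∧ (∃ j < p + 1, a j ≠ 0) ∧
      ∑ j ∈ Finset.range (p + 1), a j * x j = 0)
    (hne : ∀ s ∈ S, Irreducible s → ∃ m x, ∀ a ∈ S, ¬ s ^ m ∣ x - a) :
    ∃ z, ∀ x, ∃ a : ℕ → D, (∀ j, a j ∈ S) ∧ x = ∑ j ∈ Finset.range p, a j * z ^ j := by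
  obtain ⟨t, ht⟩ := IsDiscreteValuationRing.exists_irreducible D
  by_cases hQ : ∀ a ∈ S, ∀ k, t ^ (p * k + 1) ∣ a → t ^ (p * k + p) ∣ a
  · exact ⟨t, exists_eq_sum_of_dependent S hdiv t p (dvd_of_dvd_sum_of_order S ht hQ)
      (exists_pow_not_dvd S hpow) hdep⟩
  · obtain ⟨s, hsS, hs⟩ := exists_irreducible_mem S hdiv hpow ht hQ
    by_cases hz : ∃ z, ∀ a ∈ S, ¬ s ∣ z - a
    · obtain ⟨z, hz⟩ := hz
      refine ⟨z, exists_eq_sum_of_dependent S hdiv z p (fun a haS d _ hd h =>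
        dvd_of_dvd_sum_of_uniformizer S hdiv hs hsS
          (dvd_of_dvd_sum_of_residue S hdiv hpow hs hz) a haS d hd h)
        (exists_pow_not_dvd S hpow) hdep⟩
    · exfalso
      push Not at hz
      obtain ⟨m, x, hx⟩ := hne s hsS hs
      suffices H : ∀ m, ∃ a ∈ S, s ^ m ∣ x - a by
        obtain ⟨a, ha, ha'⟩ := H m
        exact hx a ha ha'
      intro m
      induction m with
      | zero => exact ⟨0, S.zero_mem, by simp⟩
      | succ m ih =>
        obtain ⟨a, ha, b, hb⟩ := ih
        obtain ⟨c, hc, hc'⟩ := hz b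
        refine ⟨a + s ^ m * c, S.add_mem ha (S.mul_mem (S.pow_mem hsS m) hc), ?_⟩
        rw [← sub_sub, hb, ← mul_sub, pow_succ]
        exact mul_dvd_mul_left _ hc'

end

/-- A discrete valuation ring of which any `p + 1` elements are linearly dependent over the `p`-th
powers is generated by a uniformizer over the `p`-th powers. -/
theorem isPBasis_of_dependent [CharP D p] {t : D} (ht : Irreducible t)
    (hdep : ∀ x : ℕ → D, ∃ a : ℕ → D, (∃ j < p + 1, a j ≠ 0) ∧
      ∑ j ∈ Finset.range (p + 1), a j ^ p * x j = 0) : IsPBasis p t := by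
  refine ⟨ht, fun x => ?_⟩
  let S := (frobenius D p).range
  have hpow : ∀ x : D, x ^ p ∈ S := fun x => ⟨x, rfl⟩
  have hdiv : ∀ x ∈ S, ∀ y ∈ S, y ≠ 0 → ∀ w, x = y * w → w ∈ S := by
    rintro _ ⟨x, rfl⟩ _ ⟨y, rfl⟩ hy w hw
    rw [frobenius_def, frobenius_def] at hw
    rw [frobenius_def] at hy
    have hy0 : y ≠ 0 := by rintro rfl; exact hy (zero_pow hp.out.ne_zero)
    obtain ⟨v, rfl⟩ : y ∣ x := by
      rcases eq_or_ne x 0 with rfl | hx0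
      · exact dvd_zero _
      obtain ⟨m, u, rfl⟩ := IsDiscreteValuationRing.eq_unit_mul_pow_irreducible hy0 ht
      obtain ⟨n, u', rfl⟩ := IsDiscreteValuationRing.eq_unit_mul_pow_irreducible hx0 ht
      have h1 := Dvd.intro _ hw.symm
      rw [mul_pow, mul_pow, ← Units.val_pow_eq_pow_val, ← Units.val_pow_eq_pow_val,
        Units.mul_left_dvd, Units.dvd_mul_left, ← pow_mul, ← pow_mul,
        pow_dvd_pow_iff ht.ne_zero ht.not_isUnit] at h1
      rw [Units.mul_left_dvd, Units.dvd_mul_left]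
      exact pow_dvd_pow _ (Nat.le_of_mul_le_mul_right h1 hp.out.pos)
    rw [mul_pow] at hw
    exact ⟨v, mul_left_cancel₀ hy hw⟩
  have hQ : ∀ a ∈ S, ∀ k, t ^ (p * k + 1) ∣ a → t ^ (p * k + p) ∣ a := by
    rintro _ ⟨x, rfl⟩ k h
    exact pow_dvd_pow_prime ht.prime x k h
  obtain ⟨a, haS, ha⟩ := exists_eq_sum_of_dependent S hdiv t p (dvd_of_dvd_sum_of_order S ht hQ)
    (exists_pow_not_dvd S hpow) (fun x => by
      obtain ⟨a, ⟨j, hj, hj0⟩, ha⟩ := hdep x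
      exact ⟨fun j => a j ^ p, fun j => hpow _, ⟨j, hj, pow_ne_zero _ hj0⟩, ha⟩) x
  choose b hb using haS
  refine ⟨∑ j ∈ Finset.range p, Polynomial.monomial j (b j), ?_⟩
  rw [map_sum, ha]
  refine Finset.sum_congr rfl fun j _ => ?_
  rw [← Polynomial.C_mul_X_pow_eq_monomial, map_mul, map_pow, frobEval_C, frobEval_X, ← hb j,
    frobenius_def]

end Monogenic

/-! ### Subrings of a discrete valuation ring -/

section SubDVR

variable {D : Type*} [CommRing D] [IsDomain D]

/-- A domain in which every nonzero element is a unit times a power of a nonzero nonunit `t` is a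
discrete valuation ring. -/
lemma irreducible_of_unit_mul_pow {t : D} (ht0 : t ≠ 0) (ht : ¬ IsUnit t)
    (h : ∀ x : D, x ≠ 0 → ∃ n : ℕ, ∃ u : Dˣ, x = u * t ^ n) : Irreducible t := by
  refine ⟨ht, fun a b hab => ?_⟩
  have ha : a ≠ 0 := by rintro rfl; exact ht0 (by rw [hab, zero_mul])
  have hb : b ≠ 0 := by rintro rfl; exact ht0 (by rw [hab, mul_zero])
  obtain ⟨m, u, rfl⟩ := h a ha
  obtain ⟨n, v, rfl⟩ := h b hb
  rcases Nat.eq_zero_or_pos m with rfl | hm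
  · left; simp
  rcases Nat.eq_zero_or_pos n with rfl | hn
  · right; simp
  exfalso
  apply ht
  obtain ⟨m, rfl⟩ := Nat.exists_eq_succ_of_ne_zero hm.ne'
  obtain ⟨n, rfl⟩ := Nat.exists_eq_succ_of_ne_zero hn.ne'
  have h1 : t * (u * v * t ^ m * t ^ n) * t = t * 1 := by
    rw [mul_one]; conv_rhs => rw [hab]
    rw [pow_succ, pow_succ]; ring
  rw [mul_assoc] at h1
  exact IsUnit.of_mul_eq_one _ ((mul_comm _ _).trans (mul_left_cancel₀ ht0 h1))

lemma isDiscreteValuationRing_of_unit_mul_pow {t : D} (ht : Irreducible t)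
    (h : ∀ x : D, x ≠ 0 → ∃ n : ℕ, ∃ u : Dˣ, x = u * t ^ n) : IsDiscreteValuationRing D := by
  apply IsDiscreteValuationRing.ofHasUnitMulPowIrreducibleFactorization
  refine ⟨t, ht, fun {x} hx => ?_⟩
  obtain ⟨n, u, hu⟩ := h x hx
  exact ⟨n, u, by rw [hu, mul_comm]⟩

lemma isUnit_subring {S : Subring D}
    (hdiv : ∀ x ∈ S, ∀ y ∈ S, y ≠ 0 → ∀ w, x = y * w → w ∈ S) {x : S} (hx : IsUnit (x : D)) :
    IsUnit x := by
  obtain ⟨u, hu⟩ := hx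
  have h1 : (↑u⁻¹ : D) ∈ S :=
    hdiv 1 S.one_mem x x.2 (hu ▸ u.ne_zero) _ (by rw [← hu, Units.mul_inv])
  exact IsUnit.of_mul_eq_one ⟨_, h1⟩ (Subtype.ext (by
    change (x : D) * ↑u⁻¹ = 1
    rw [← hu, Units.mul_inv]))

/-- A subring of a discrete valuation ring that is closed under division and contains the `q`-th
powers is a discrete valuation ring. -/
lemma isDiscreteValuationRing_subring [IsDiscreteValuationRing D] (S : Subring D)
    (hdiv : ∀ x ∈ S, ∀ y ∈ S, y ≠ 0 → ∀ w, x = y * w → w ∈ S) {q : ℕ} (hq : q ≠ 0)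
    (hpow : ∀ x : D, x ^ q ∈ S) : IsDiscreteValuationRing S := by
  classical
  obtain ⟨t, ht⟩ := IsDiscreteValuationRing.exists_irreducible D
  -- An element of S of least positive order serves as uniformizer of S; dividing by it repeatedly
  -- ends at order 0 by minimality.
  have hex : ∃ n : ℕ, 0 < n ∧ ∃ u : Dˣ, ↑u * t ^ n ∈ S :=
    ⟨q, Nat.pos_of_ne_zero hq, 1, by simpa using hpow t⟩
  obtain ⟨hn0, u, hu⟩ := Nat.find_spec hex
  have hmin := fun m (h : m < Nat.find hex) => Nat.find_min hex h
  set n := Nat.find hex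
  let s : S := ⟨_, hu⟩
  have hs0 : s ≠ 0 := by
    intro h
    have h1 : (u : D) * t ^ n = 0 := congrArg Subtype.val h
    exact mul_ne_zero u.ne_zero (pow_ne_zero n ht.ne_zero) h1
  have hsu : ¬ IsUnit s := by
    intro h
    have h1 : IsUnit ((u : D) * t ^ n) := h.map S.subtype
    rw [Units.isUnit_units_mul, isUnit_pow_iff hn0.ne'] at h1
    exact ht.not_isUnit h1
  have key : ∀ m : ℕ, ∀ x : S, ∀ v : Dˣ, (x : D) = v * t ^ m → ∃ k : ℕ, ∃ w : Sˣ, x = w * s ^ k := by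
    intro m
    induction m using Nat.strong_induction_on with
    | _ m ih =>
      intro x v hx
      rcases Nat.eq_zero_or_pos m with rfl | hm
      · obtain ⟨w, hw⟩ := isUnit_subring hdiv (x := x) (by rw [hx]; simp)
        exact ⟨0, w, by simp [hw]⟩
      · have hnm : n ≤ m := by
          by_contra hlt
          exact hmin m (not_le.1 hlt) ⟨hm, v, hx ▸ x.2⟩
        have h1 : (x : D) = s * (↑(u⁻¹ * v) * t ^ (m - n)) := by
          rw [hx]
          conv_lhs => rw [← Nat.sub_add_cancel hnm, pow_add]
          change _ = (u * t ^ n) * _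
          rw [Units.val_mul]
          calc _ = (v : D) * (t ^ (m - n) * t ^ n) * (u * ↑u⁻¹) := by rw [Units.mul_inv, mul_one]
            _ = _ := by ring
        have h2 := hdiv x x.2 s s.2 (fun h => hs0 (Subtype.ext h)) _ h1
        obtain ⟨k, w, hw⟩ := ih (m - n) (by omega) ⟨_, h2⟩ (u⁻¹ * v) rfl
        refine ⟨k + 1, w, ?_⟩
        rw [pow_succ, ← mul_assoc, ← hw, mul_comm]
        exact Subtype.ext h1
  have h : ∀ x : S, x ≠ 0 → ∃ n : ℕ, ∃ u : Sˣ, x = u * s ^ n := by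
    intro x hx
    obtain ⟨m, v, hv⟩ := IsDiscreteValuationRing.eq_unit_mul_pow_irreducible
      (x := (x : D)) (fun h => hx (Subtype.ext h)) ht
    exact key m x v hv
  exact isDiscreteValuationRing_of_unit_mul_pow (irreducible_of_unit_mul_pow hs0 hsu h) h

end SubDVR

/-! ### Subalgebras of the tower -/

section TowerAlgebra

variable (K A : Type*) [Field K] [CommRing A] [IsDomain A] [Algebra K A]

/-- The subalgebra generated by the `q`-th powers. -/
abbrev powAdjoin (q : ℕ) : Subalgebra K A := Algebra.adjoin K (Set.range fun a : A => a ^ q)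

/-- The elements that are fractions of elements of the subalgebra generated by the `q`-th powers. -/
def frobSub (q : ℕ) : Subalgebra K A where
  carrier := {x | ∃ y ∈ powAdjoin K A q, y ≠ 0 ∧ x * y ∈ powAdjoin K A q}
  mul_mem' := by
    rintro a b ⟨y, hy, hy0, hay⟩ ⟨z, hz, hz0, hbz⟩
    exact ⟨y * z, mul_mem hy hz, mul_ne_zero hy0 hz0, by
      rw [mul_mul_mul_comm]; exact mul_mem hay hbz⟩
  add_mem' := by
    rintro a b ⟨y, hy, hy0, hay⟩ ⟨z, hz, hz0, hbz⟩
    refine ⟨y * z, mul_mem hy hz, mul_ne_zero hy0 hz0, ?_⟩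
    rw [show (a + b) * (y * z) = a * y * z + b * z * y by ring]
    exact add_mem (mul_mem hay hz) (mul_mem hbz hy)
  algebraMap_mem' k := ⟨1, one_mem _, one_ne_zero, mul_mem (algebraMap_mem _ k) (one_mem _)⟩

variable {K A}

lemma powAdjoin_le_frobSub (q : ℕ) : powAdjoin K A q ≤ frobSub K A q :=
  fun x hx => ⟨1, one_mem _, one_ne_zero, by rwa [mul_one]⟩

lemma pow_mem_frobSub (q : ℕ) (a : A) : a ^ q ∈ frobSub K A q :=
  powAdjoin_le_frobSub q (Algebra.subset_adjoin ⟨a, rfl⟩)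

lemma frobSub_div (q : ℕ) : ∀ x ∈ frobSub K A q, ∀ y ∈ frobSub K A q, y ≠ 0 → ∀ w, x = y * w →
    w ∈ frobSub K A q := by
  rintro x ⟨a, ha, ha0, hxa⟩ y ⟨b, hb, hb0, hyb⟩ hy0 w rfl
  refine ⟨y * b * a, mul_mem hyb ha, mul_ne_zero (mul_ne_zero hy0 hb0) ha0, ?_⟩
  rw [show w * (y * b * a) = y * w * a * b by ring]
  exact mul_mem hxa hb

lemma frobSub_one : frobSub K A 1 = ⊤ := by
  rw [eq_top_iff]
  intro x _
  simpa using pow_mem_frobSub (K := K) 1 x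

lemma frobSub_mul_le (q r : ℕ) : frobSub K A (q * r) ≤ frobSub K A q := by
  have h : powAdjoin K A (q * r) ≤ powAdjoin K A q := by
    refine Algebra.adjoin_le ?_
    rintro _ ⟨a, rfl⟩
    exact Algebra.subset_adjoin ⟨a ^ r, by simp only [← pow_mul, mul_comm]⟩
  rintro x ⟨y, hy, hy0, hxy⟩
  exact ⟨y, h hy, hy0, h hxy⟩

variable (p : ℕ) [hp : Fact p.Prime] [CharP A p]

lemma pow_mem_frobSub_mul {q r : ℕ} (hr : ∃ s, r = p ^ s) {x : A} (hx : x ∈ frobSub K A q) :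
    x ^ r ∈ frobSub K A (q * r) := by
  obtain ⟨s, rfl⟩ := hr
  have h : ∀ y ∈ powAdjoin K A q, y ^ p ^ s ∈ powAdjoin K A (q * p ^ s) := by
    intro y hy
    induction hy using Algebra.adjoin_induction with
    | mem x hx =>
      obtain ⟨a, rfl⟩ := hx
      exact Algebra.subset_adjoin ⟨a, pow_mul a q _⟩
    | algebraMap r => rw [← map_pow]; exact algebraMap_mem _ _
    | add x y _ _ hx hy => rw [add_pow_char_pow]; exact add_mem hx hy
    | mul x y _ _ hx hy => rw [mul_pow]; exact mul_mem hx hy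
  obtain ⟨y, hy, hy0, hxy⟩ := hx
  exact ⟨y ^ p ^ s, h y hy, pow_ne_zero _ hy0, by rw [← mul_pow]; exact h _ hxy⟩

variable (L M : Type*) [Field L] [Algebra K L] [Field M] [Algebra (L ⊗[K] A) M] [CharP M p]

/-- The map `L ⊗ S → M`. -/
noncomputable def geomMap (S : Subalgebra K A) : L ⊗[K] S →+* M :=
  (algebraMap (L ⊗[K] A) M).comp
    (Algebra.TensorProduct.map (AlgHom.id K L) S.val : L ⊗[K] S →ₐ[K] L ⊗[K] A).toRingHom

lemma geomMap_tmul (S : Subalgebra K A) (l : L) (a : S) :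
    geomMap L M S (l ⊗ₜ a) = algebraMap (L ⊗[K] A) M (l ⊗ₜ (a : A)) := rfl

/-- The image of `L ⊗ S` in `M`. -/
noncomputable def geomSub (S : Subalgebra K A) : Subring M := (geomMap L M S).range

variable {L M}

lemma tmul_mem_geomSub {S : Subalgebra K A} (l : L) {a : A} (ha : a ∈ S) :
    algebraMap (L ⊗[K] A) M (l ⊗ₜ a) ∈ geomSub L M S := ⟨l ⊗ₜ ⟨a, ha⟩, rfl⟩

lemma geomSub_le_iff {S : Subalgebra K A} {R : Subring M} :
    geomSub L M S ≤ R ↔ ∀ l : L, ∀ a ∈ S, algebraMap (L ⊗[K] A) M (l ⊗ₜ a) ∈ R := by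
  constructor
  · intro h l a ha
    exact h (tmul_mem_geomSub l ha)
  · rintro h _ ⟨u, rfl⟩
    induction u with
    | zero => rw [map_zero]; exact R.zero_mem
    | add x y hx hy => rw [map_add]; exact R.add_mem hx hy
    | tmul l a => exact h l a a.2

lemma geomSub_mono {S T : Subalgebra K A} (h : S ≤ T) : geomSub L M S ≤ geomSub L M T :=
  geomSub_le_iff.2 fun l _ ha => tmul_mem_geomSub l (h ha)

lemma algebraMap_mem_geomSub_top (u : L ⊗[K] A) : algebraMap (L ⊗[K] A) M u ∈ geomSub L M (⊤ : Subalgebra K A) := by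
  induction u with
  | zero => rw [map_zero]; exact Subring.zero_mem _
  | add x y hx hy => rw [map_add]; exact Subring.add_mem _ hx hy
  | tmul l a => exact tmul_mem_geomSub l trivial

variable (K A L M)

/-- The `p ^ i`-th roots in `M` of the elements of `L ⊗ frobSub K A (p ^ i)`. -/
noncomputable def rootSub (i : ℕ) : Subring M :=
  (geomSub L M (frobSub K A (p ^ i))).comap (iterateFrobenius M p i)

variable {K A L M p}

lemma mem_rootSub {i : ℕ} {x : M} :
    x ∈ rootSub K A p L M i ↔ x ^ p ^ i ∈ geomSub L M (frobSub K A (p ^ i)) := Iff.rfl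

lemma rootSub_zero : rootSub K A p L M 0 = geomSub L M (⊤ : Subalgebra K A) := by
  ext x
  rw [mem_rootSub, pow_zero, pow_one, frobSub_one]

lemma pow_mem_geomSub_mul {q r : ℕ} (hr : ∃ s, r = p ^ s) {x : M}
    (hx : x ∈ geomSub L M (frobSub K A q)) : x ^ r ∈ geomSub L M (frobSub K A (q * r)) := by
  obtain ⟨s, rfl⟩ := hr
  suffices geomSub L M (frobSub K A q) ≤
      (geomSub L M (frobSub K A (q * p ^ s))).comap (iterateFrobenius M p s) from this hx
  refine geomSub_le_iff.2 fun l a ha => ?_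
  rw [Subring.mem_comap, iterateFrobenius_def, ← map_pow, Algebra.TensorProduct.tmul_pow]
  exact tmul_mem_geomSub _ (pow_mem_frobSub_mul p ⟨s, rfl⟩ ha)

lemma rootSub_le_succ (i : ℕ) : rootSub K A p L M i ≤ rootSub K A p L M (i + 1) := by
  intro x hx
  rw [mem_rootSub] at hx ⊢
  rw [pow_succ, pow_mul]
  exact pow_mem_geomSub_mul ⟨1, (pow_one p).symm⟩ hx

lemma rootSub_mono {i j : ℕ} (h : i ≤ j) : rootSub K A p L M i ≤ rootSub K A p L M j :=
  monotone_nat_of_le_succ (f := fun i => rootSub K A p L M i) rootSub_le_succ h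

/-- With `rootSub_le_succ`, each level lies between the next one and its ring of p-th powers. -/
lemma pow_mem_rootSub {i : ℕ} {x : M} (hx : x ∈ rootSub K A p L M (i + 1)) :
    x ^ p ∈ rootSub K A p L M i := by
  rw [mem_rootSub] at hx ⊢
  rw [← pow_mul, ← pow_succ']
  refine geomSub_mono ?_ hx
  rw [pow_succ]
  exact frobSub_mul_le _ _

section Roots

variable [CharP L p] [PerfectRing L p]

lemma exists_pow_eq (i : ℕ) (l : L) : ∃ r : L, r ^ p ^ i = l :=
  ⟨(iterateFrobeniusEquiv L p i).symm l, (iterateFrobeniusEquiv L p i).apply_symm_apply l⟩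

lemma exists_pow_eq_of_mem_powAdjoin {i : ℕ} {x : A} (hx : x ∈ powAdjoin K A (p ^ i)) :
    ∃ m : M, m ^ p ^ i = algebraMap (L ⊗[K] A) M (1 ⊗ₜ x) := by
  induction hx using Algebra.adjoin_induction with
  | mem x hx =>
    obtain ⟨a, rfl⟩ := hx
    exact ⟨algebraMap (L ⊗[K] A) M (1 ⊗ₜ a), by
      rw [← map_pow, Algebra.TensorProduct.tmul_pow, one_pow]⟩
  | algebraMap r =>
    obtain ⟨s, hs⟩ := exists_pow_eq (p := p) i (algebraMap K L r)
    refine ⟨algebraMap (L ⊗[K] A) M (s ⊗ₜ 1), ?_⟩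
    rw [← map_pow, Algebra.TensorProduct.tmul_pow, one_pow, hs, Algebra.algebraMap_eq_smul_one r,
      Algebra.algebraMap_eq_smul_one r, TensorProduct.smul_tmul]
  | add x y _ _ hx hy =>
    obtain ⟨m, hm⟩ := hx
    obtain ⟨n, hn⟩ := hy
    exact ⟨m + n, by rw [add_pow_char_pow, hm, hn, TensorProduct.tmul_add, map_add]⟩
  | mul x y _ _ hx hy =>
    obtain ⟨m, hm⟩ := hx
    obtain ⟨n, hn⟩ := hy
    exact ⟨m * n, by rw [mul_pow, hm, hn, ← map_mul, Algebra.TensorProduct.tmul_mul_tmul, one_mul]⟩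

variable [IsFractionRing (L ⊗[K] A) M]

lemma algebraMap_one_tmul_ne_zero {x : A} (hx : x ≠ 0) :
    algebraMap (L ⊗[K] A) M (1 ⊗ₜ x) ≠ 0 := by
  intro h
  have h1 : (1 : L) ⊗ₜ[K] x = 1 ⊗ₜ 0 := by
    rw [TensorProduct.tmul_zero]
    exact (IsFractionRing.injective (L ⊗[K] A) M) (by rw [h, map_zero])
  exact hx (Algebra.TensorProduct.includeRight_injective (A := L) (algebraMap K L).injective h1)

lemma exists_pow_eq_of_mem_frobSub {i : ℕ} {x : A} (hx : x ∈ frobSub K A (p ^ i)) :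
    ∃ m : M, m ^ p ^ i = algebraMap (L ⊗[K] A) M (1 ⊗ₜ x) := by
  obtain ⟨y, hy, hy0, hxy⟩ := hx
  obtain ⟨m, hm⟩ := exists_pow_eq_of_mem_powAdjoin (M := M) (L := L) hy
  obtain ⟨n, hn⟩ := exists_pow_eq_of_mem_powAdjoin (M := M) (L := L) hxy
  refine ⟨n / m, ?_⟩
  rw [div_pow, hm, hn, div_eq_iff (algebraMap_one_tmul_ne_zero hy0), ← map_mul,
    Algebra.TensorProduct.tmul_mul_tmul, one_mul]

/-- Constants have roots because L is perfect, p^i-th powers have them by construction, and M is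
closed under division. So the p^i-th power map identifies `rootSub` at level i with the image of L ⊗
`frobSub`. -/
lemma exists_pow_eq_of_mem_geomSub {i : ℕ} {x : M} (hx : x ∈ geomSub L M (frobSub K A (p ^ i))) :
    ∃ m ∈ rootSub K A p L M i, m ^ p ^ i = x := by
  suffices geomSub L M (frobSub K A (p ^ i)) ≤ (iterateFrobenius M p i).range by
    obtain ⟨m, hm⟩ := this hx
    rw [iterateFrobenius_def] at hm
    exact ⟨m, by rwa [mem_rootSub, hm], hm⟩
  refine geomSub_le_iff.2 fun l a ha => ?_
  obtain ⟨m, hm⟩ := exists_pow_eq_of_mem_frobSub (M := M) (L := L) ha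
  obtain ⟨s, hs⟩ := exists_pow_eq (p := p) i l
  refine ⟨algebraMap (L ⊗[K] A) M (s ⊗ₜ 1) * m, ?_⟩
  rw [iterateFrobenius_def, mul_pow, hm, ← map_pow, ← map_mul, Algebra.TensorProduct.tmul_pow,
    Algebra.TensorProduct.tmul_mul_tmul, hs, one_pow, mul_one, one_mul]

end Roots

end TowerAlgebra

/-! ### Coordinates on `L ⊗ S` -/

section Coord

variable {K : Type*} [Field K] {L : Type*} [Field L] [Algebra K L]

open Classical in
/-- The isomorphism of `L ⊗ S` with a direct sum of copies of `S` given by a basis of `L`. -/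
noncomputable def tensorFinsuppEquiv {S : Type*} [AddCommGroup S] [Module K S] :
    L ⊗[K] S ≃ₗ[K] Module.Basis.ofVectorSpaceIndex K L →₀ S :=
  TensorProduct.equivFinsuppOfBasisLeft (Module.Basis.ofVectorSpace K L)

/-- The coordinates on `L ⊗ S` with respect to a basis of `L` over `K`. -/
noncomputable def tensorCoord {S : Type*} [AddCommGroup S] [Module K S]
    (k : Module.Basis.ofVectorSpaceIndex K L) : L ⊗[K] S →ₗ[K] S :=
  Finsupp.lapply k ∘ₗ tensorFinsuppEquiv.toLinearMap

lemma tensorCoord_tmul {S : Type*} [AddCommGroup S] [Module K S]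
    (k : Module.Basis.ofVectorSpaceIndex K L) (l : L) (s : S) :
    tensorCoord k (l ⊗ₜ[K] s) = (Module.Basis.ofVectorSpace K L).repr l k • s := by
  classical
  exact TensorProduct.equivFinsuppOfBasisLeft_apply_tmul_apply _ _ _ _

lemma eq_zero_of_tensorCoord {S : Type*} [AddCommGroup S] [Module K S] {u : L ⊗[K] S}
    (h : ∀ k, tensorCoord k u = 0) : u = 0 := by
  apply tensorFinsuppEquiv.injective
  rw [map_zero]
  exact Finsupp.ext h

variable {S : Type*} [CommRing S] [Algebra K S]

lemma tensorCoord_mul (k : Module.Basis.ofVectorSpaceIndex K L) (u : L ⊗[K] S) (s : S) :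
    tensorCoord k (u * 1 ⊗ₜ s) = tensorCoord k u * s := by
  induction u with
  | zero => simp
  | add x y hx hy => rw [add_mul, map_add, map_add, add_mul, hx, hy]
  | tmul l a =>
    rw [Algebra.TensorProduct.tmul_mul_tmul, mul_one, tensorCoord_tmul, tensorCoord_tmul,
      smul_mul_assoc]

lemma tensorCoord_map (T : Subalgebra K S) (k : Module.Basis.ofVectorSpaceIndex K L) (u : L ⊗[K] T) :
    tensorCoord k (Algebra.TensorProduct.map (AlgHom.id K L) T.val u) = tensorCoord k u := by
  induction u with
  | zero => simp
  | add x y hx hy => simp [hx, hy]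
  | tmul l a =>
    rw [Algebra.TensorProduct.map_tmul, tensorCoord_tmul, tensorCoord_tmul]
    rfl

lemma tensorMap_injective (T : Subalgebra K S) : Function.Injective
    (Algebra.TensorProduct.map (AlgHom.id K L) T.val) := by
  rw [injective_iff_map_eq_zero]
  intro u hu
  refine eq_zero_of_tensorCoord fun k => Subtype.ext ?_
  rw [← tensorCoord_map, hu, map_zero]
  rfl

lemma exists_tensorCoord_one_ne_zero :
    ∃ k : Module.Basis.ofVectorSpaceIndex K L, (Module.Basis.ofVectorSpace K L).repr 1 k ≠ 0 := by
  by_contra! h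
  exact one_ne_zero ((Module.Basis.ofVectorSpace K L).repr.injective
    ((Finsupp.ext h).trans (map_zero _).symm))

/-- Along a basis vector on which 1 has a nonzero coordinate, the equation u (1 ⊗ s) = 1 becomes: s
divides a nonzero constant. -/
lemma isUnit_of_isUnit_one_tmul {s : S} (h : IsUnit ((1 : L) ⊗ₜ[K] s)) : IsUnit s := by
  obtain ⟨k, hk⟩ := exists_tensorCoord_one_ne_zero (K := K) (L := L)
  obtain ⟨u, hu⟩ := h.exists_left_inv
  have h1 := congrArg (tensorCoord k) hu
  rw [tensorCoord_mul, Algebra.TensorProduct.one_def, tensorCoord_tmul,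
    ← Algebra.algebraMap_eq_smul_one] at h1
  exact isUnit_of_dvd_unit (Dvd.intro_left _ h1) ((IsUnit.mk0 _ hk).map _)

section DVR

variable [IsDomain S] [IsDiscreteValuationRing S] {s : S} (hs : Irreducible s)
  (hres : ∀ a : S, ∃ k : K, s ∣ a - algebraMap K S k)
include hres

lemma exists_dvd_sub_tmul (u : L ⊗[K] S) : ∃ l : L, 1 ⊗ₜ s ∣ u - l ⊗ₜ[K] 1 := by
  induction u with
  | zero => exact ⟨0, by simp⟩
  | add x y hx hy =>
    obtain ⟨l, hl⟩ := hx
    obtain ⟨m, hm⟩ := hy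
    exact ⟨l + m, by rw [TensorProduct.add_tmul, add_sub_add_comm]; exact dvd_add hl hm⟩
  | tmul l a =>
    obtain ⟨k, b, hb⟩ := hres a
    refine ⟨k • l, l ⊗ₜ b, ?_⟩
    rw [Algebra.TensorProduct.tmul_mul_tmul, one_mul, ← hb, TensorProduct.tmul_sub,
      TensorProduct.smul_tmul, Algebra.algebraMap_eq_smul_one]

include hs

variable [Algebra.IsAlgebraic K L]

/-- S ⊗ L is integral over the local ring S, so its maximal ideals all lie over that of S. Hence s
is in the Jacobson radical and does not affect invertibility. -/
lemma isUnit_tmul_add {l : L} (hl : l ≠ 0) (u : L ⊗[K] S) : IsUnit (l ⊗ₜ[K] 1 + 1 ⊗ₜ s * u) := by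
  have hint : Algebra.IsIntegral S (S ⊗[K] L) := inferInstance
  have hjac : (s ⊗ₜ[K] (1 : L)) ∈ Ideal.jacobson (⊥ : Ideal (S ⊗[K] L)) := by
    rw [Ideal.jacobson, Ideal.mem_sInf]
    rintro I ⟨-, hI⟩
    have h1 : (I.comap (algebraMap S (S ⊗[K] L))).IsMaximal :=
      Ideal.isMaximal_comap_of_isIntegral_of_isMaximal I
    have h2 := IsLocalRing.eq_maximalIdeal h1
    have h3 : s ∈ I.comap (algebraMap S (S ⊗[K] L)) := by
      rw [h2, IsLocalRing.mem_maximalIdeal]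
      exact hs.not_isUnit
    exact h3
  let e := Algebra.TensorProduct.comm K S L
  have h1 := Ideal.mem_jacobson_bot.1 hjac (e.symm (u * l⁻¹ ⊗ₜ 1))
  have h2 : e (s ⊗ₜ[K] (1 : L) * e.symm (u * l⁻¹ ⊗ₜ 1) + 1) = 1 ⊗ₜ s * (u * l⁻¹ ⊗ₜ 1) + 1 := by
    rw [map_add, map_mul, AlgEquiv.apply_symm_apply, map_one]
    rfl
  have h3 : IsUnit (1 ⊗ₜ[K] s * (u * l⁻¹ ⊗ₜ[K] (1 : S)) + 1) := h2 ▸ h1.map e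
  have h4 : IsUnit (l ⊗ₜ[K] (1 : S)) :=
    (IsUnit.mk0 l hl).map (Algebra.TensorProduct.includeLeft : L →ₐ[K] L ⊗[K] S)
  convert h3.mul h4 using 1
  rw [add_mul, one_mul, mul_assoc, mul_assoc, Algebra.TensorProduct.tmul_mul_tmul,
    inv_mul_cancel₀ hl, one_mul, ← Algebra.TensorProduct.one_def, mul_one, add_comm]

/-- The residue of u in L decides: if it is nonzero, u is a unit; if it is zero, 1 ⊗ s can be
divided out. Each division lowers by one the order of a fixed nonzero coordinate of u, so the
process stops. -/
lemma exists_unit_mul_pow_tensor (u : L ⊗[K] S) (hu : u ≠ 0) :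
    ∃ n : ℕ, ∃ w : (L ⊗[K] S)ˣ, u = (w : L ⊗[K] S) * (1 ⊗ₜ[K] s) ^ n := by
  obtain ⟨k, hk⟩ : ∃ k, tensorCoord k u ≠ 0 := by
    by_contra! h
    exact hu (eq_zero_of_tensorCoord h)
  obtain ⟨m, v, hv⟩ := IsDiscreteValuationRing.eq_unit_mul_pow_irreducible hk hs
  clear hk hu
  induction m generalizing u with
  | zero =>
    obtain ⟨l, y, hy⟩ := exists_dvd_sub_tmul (L := L) hres u
    have hl : l ≠ 0 := by
      rintro rfl
      rw [TensorProduct.zero_tmul, sub_zero, mul_comm] at hy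
      rw [hy, tensorCoord_mul, pow_zero, mul_one] at hv
      exact hs.not_isUnit (isUnit_of_dvd_unit (Dvd.intro_left _ hv) v.isUnit)
    obtain ⟨w, hw⟩ := isUnit_tmul_add hs hres hl y
    exact ⟨0, w, by rw [pow_zero, mul_one, hw, ← hy]; ring⟩
  | succ m ih =>
    obtain ⟨l, y, hy⟩ := exists_dvd_sub_tmul (L := L) hres u
    by_cases hl : l = 0
    · rw [hl, TensorProduct.zero_tmul, sub_zero] at hy
      have h1 : tensorCoord k y = v * s ^ m := by
        rw [hy, mul_comm, tensorCoord_mul, pow_succ, ← mul_assoc] at hv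
        exact mul_right_cancel₀ hs.ne_zero hv
      obtain ⟨n, w, hw⟩ := ih y h1
      exact ⟨n + 1, w, by rw [pow_succ, ← mul_assoc, ← hw, hy, mul_comm]⟩
    · obtain ⟨w, hw⟩ := isUnit_tmul_add hs hres hl y
      exact ⟨0, w, by rw [pow_zero, mul_one, hw, ← hy]; ring⟩

end DVR

end Coord

/-! ### Descent of linear dependence from M to the levels of the tower -/

section TowerDVR

variable {K A L M : Type*} [Field K] [CommRing A] [IsDomain A] [Algebra K A] {p : ℕ}
  [hp : Fact p.Prime] [CharP A p] [Field L] [Algebra K L] [Field M] [Algebra (L ⊗[K] A) M]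
  [CharP M p] [IsFractionRing (L ⊗[K] A) M]

lemma geomMap_injective (S : Subalgebra K A) : Function.Injective (geomMap L M S) :=
  (IsFractionRing.injective (L ⊗[K] A) M).comp (tensorMap_injective S)

/-- A dependence relation over `M ^ p` can be chosen with integral coefficients. -/
lemma exists_integral_dependence
    (hdep : ∀ x : ℕ → M, ∃ a : ℕ → M, (∃ j < p + 1, a j ≠ 0) ∧
      ∑ j ∈ Finset.range (p + 1), a j ^ p * x j = 0) (x : ℕ → M) :
    ∃ c : ℕ → L ⊗[K] A, (∃ j < p + 1, c j ≠ 0) ∧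
      ∑ j ∈ Finset.range (p + 1), algebraMap (L ⊗[K] A) M (c j) ^ p * x j = 0 := by
  obtain ⟨a, ⟨i, hi, hai⟩, ha⟩ := hdep x
  obtain ⟨b, hb⟩ := IsLocalization.exist_integer_multiples (nonZeroDivisors (L ⊗[K] A))
    (Finset.range (p + 1)) a
  have hb0 : algebraMap (L ⊗[K] A) M b ≠ 0 := IsFractionRing.to_map_ne_zero_of_mem_nonZeroDivisors b.2
  have h1 : ∀ j, ∃ c, j < p + 1 → algebraMap (L ⊗[K] A) M c = algebraMap (L ⊗[K] A) M b * a j := by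
    intro j
    by_cases hj : j < p + 1
    · obtain ⟨c, hc⟩ := hb j (Finset.mem_range.2 hj)
      exact ⟨c, fun _ => by rw [hc, Algebra.smul_def]⟩
    · exact ⟨0, fun h => absurd h hj⟩
  choose c hc using h1
  refine ⟨c, ⟨i, hi, fun h => ?_⟩, ?_⟩
  · have := hc i hi
    rw [h, map_zero] at this
    exact mul_ne_zero hb0 hai this.symm
  · have h2 := congrArg (fun y => algebraMap (L ⊗[K] A) M b ^ p * y) ha
    simp only [mul_zero, Finset.mul_sum] at h2
    rw [← h2]
    refine Finset.sum_congr rfl fun j hj => ?_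
    rw [hc j (Finset.mem_range.1 hj), mul_pow, mul_assoc]

variable [CharP L p] [PerfectRing L p]

-- A relation over M^p between the p^i-th roots of the x j, raised to the power p^i, has
-- coefficients in L ⊗ `frobSub` at level i + 1. A nonzero coordinate with respect to a basis of L
-- over K descends it to A.
include L in
lemma exists_dependence_frobSub
    (hdep : ∀ x : ℕ → M, ∃ a : ℕ → M, (∃ j < p + 1, a j ≠ 0) ∧
      ∑ j ∈ Finset.range (p + 1), a j ^ p * x j = 0) (i : ℕ) (x : ℕ → A)
    (hx : ∀ j, x j ∈ frobSub K A (p ^ i)) :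
    ∃ a : ℕ → A, (∀ j, a j ∈ frobSub K A (p ^ (i + 1))) ∧ (∃ j < p + 1, a j ≠ 0) ∧
      ∑ j ∈ Finset.range (p + 1), a j * x j = 0 := by
  choose m hm using fun j => exists_pow_eq_of_mem_frobSub (M := M) (L := L) (hx j)
  obtain ⟨c, ⟨j₀, hj₀, hc₀⟩, hc⟩ := exists_integral_dependence (K := K) (A := A) (L := L) hdep m
  have h1 : ∀ j, ∃ e, geomMap L M (frobSub K A (p ^ (i + 1))) e =
      algebraMap (L ⊗[K] A) M (c j) ^ p ^ (i + 1) := by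
    intro j
    have h2 := algebraMap_mem_geomSub_top (M := M) (c j)
    rw [← frobSub_one] at h2
    have h3 := pow_mem_geomSub_mul (p := p) ⟨i + 1, rfl⟩ h2
    rwa [one_mul] at h3
  choose e he using h1
  have h2 : e j₀ ≠ 0 := by
    intro h
    have h3 := he j₀
    rw [h, map_zero] at h3
    refine hc₀ (IsFractionRing.injective (L ⊗[K] A) M ?_)
    rw [map_zero]
    exact (pow_eq_zero_iff (pow_ne_zero _ hp.out.ne_zero)).1 h3.symm
  obtain ⟨k, hk⟩ : ∃ k, tensorCoord k (e j₀) ≠ 0 := by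
    by_contra! h
    exact h2 (eq_zero_of_tensorCoord h)
  refine ⟨fun j => (tensorCoord k (e j) : frobSub K A (p ^ (i + 1))), fun j => Subtype.prop _, ⟨j₀, hj₀, fun h => hk (Subtype.ext h)⟩,
    ?_⟩
  have h4 : ∑ j ∈ Finset.range (p + 1),
      Algebra.TensorProduct.map (AlgHom.id K L) (frobSub K A (p ^ (i + 1))).val (e j) *
        1 ⊗ₜ x j = 0 := by
    apply IsFractionRing.injective (L ⊗[K] A) M
    rw [map_sum, map_zero, ← zero_pow (pow_ne_zero i hp.out.ne_zero), ← hc, ← iterateFrobenius_def,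
      map_sum]
    refine Finset.sum_congr rfl fun j _ => ?_
    rw [iterateFrobenius_def, mul_pow, hm, ← pow_mul, ← pow_succ', ← he, map_mul]
    rfl
  have h5 := congrArg (tensorCoord k) h4
  rw [map_sum, map_zero] at h5
  rw [← h5]
  refine Finset.sum_congr rfl fun j _ => ?_
  rw [tensorCoord_mul, tensorCoord_map]

end TowerDVR

section

lemma IsPBasis.mem_closure {B : Type*} [CommRing B] [IsDomain B] [IsDiscreteValuationRing B]
    {p : ℕ} [hp : Fact p.Prime] [CharP B p] {t : B} (ht : IsPBasis p t) (m : ℕ) (x : B) :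
    x ∈ AddSubmonoid.closure {y : B | ∃ c : B, ∃ j < p ^ m, y = c ^ p ^ m * t ^ j} := by
  induction m generalizing x with
  | zero => exact AddSubmonoid.subset_closure ⟨x, 0, by simp, by simp⟩
  | succ m ih =>
    obtain ⟨c, rfl⟩ := exists_eq_sum_of_surjective ht.surjective x
    refine AddSubmonoid.sum_mem _ fun j hj => ?_
    rw [Finset.mem_range] at hj
    have h := ih (c j)
    generalize c j = b at h
    induction h using AddSubmonoid.closure_induction with
    | mem y hy =>
      obtain ⟨d, k, hk, rfl⟩ := hy
      refine AddSubmonoid.subset_closure ⟨d, k * p + j, ?_, ?_⟩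
      · have := Nat.mul_le_mul_right p (Nat.succ_le_of_lt hk)
        rw [Nat.succ_mul] at this
        rw [pow_succ]
        omega
      · rw [mul_pow, ← pow_mul, ← pow_mul, pow_succ, pow_add, mul_assoc]
    | zero =>
      rw [zero_pow hp.out.ne_zero, zero_mul]
      exact AddSubmonoid.zero_mem _
    | add y z _ _ hy hz =>
      rw [add_pow_char, add_mul]
      exact AddSubmonoid.add_mem _ hy hz

end

/-! ### The top of the tower: a discrete valuation ring with a conductor in L ⊗ A -/

section TowerTop

variable {K A L M : Type*} [Field K] [CommRing A] [IsDomain A] [Algebra K A] {p : ℕ}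
  [hp : Fact p.Prime] [CharP A p] [Field L] [Algebra K L] [Field M] [Algebra (L ⊗[K] A) M]
  [CharP M p] [IsFractionRing (L ⊗[K] A) M] [CharP L p] [PerfectRing L p]

instance subringCharP (R : Subring M) : CharP R p :=
  (R.subtype.charP_iff Subtype.val_injective p).2 inferInstance

/-- The p^n-th power of an inverse of b inverts 1 ⊗ s^(p^(n-i)) already in L ⊗ A, and invertibility
descends from there to A. -/
lemma isUnit_of_isUnit_rootSub {n i : ℕ} (hin : i ≤ n) {s : A} {b : rootSub K A p L M n}
    (hb : (b : M) ^ p ^ i = algebraMap (L ⊗[K] A) M (1 ⊗ₜ s)) (hu : IsUnit b) : IsUnit s := by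
  obtain ⟨y, hy⟩ := hu.exists_left_inv
  obtain ⟨u, hu⟩ := mem_rootSub.1 y.2
  have h1 : algebraMap (L ⊗[K] A) M (Algebra.TensorProduct.map (AlgHom.id K L)
      (frobSub K A (p ^ n)).val u * 1 ⊗ₜ (s ^ p ^ (n - i))) = algebraMap (L ⊗[K] A) M 1 := by
    have h2 : ((1 : L) ⊗ₜ[K] (s ^ p ^ (n - i))) = (1 ⊗ₜ s) ^ p ^ (n - i) := by
      rw [Algebra.TensorProduct.tmul_pow, one_pow]
    rw [map_mul, map_one, h2, map_pow, ← hb, ← pow_mul, ← pow_add, Nat.add_sub_cancel' hin]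
    change geomMap L M (frobSub K A (p ^ n)) u * _ = 1
    rw [hu, ← mul_pow]
    have h3 : (y : M) * b = 1 := congrArg Subtype.val hy
    rw [h3, one_pow]
  have h2 := IsFractionRing.injective (L ⊗[K] A) M h1
  have h3 : IsUnit ((1 : L) ⊗ₜ[K] (s ^ p ^ (n - i))) :=
    IsUnit.of_mul_eq_one _ ((mul_comm _ _).trans h2)
  exact (isUnit_pow_iff (pow_ne_zero _ hp.out.ne_zero)).1 (isUnit_of_isUnit_one_tmul h3)

variable [IsDiscreteValuationRing A]

instance isDiscreteValuationRing_frobSub (i : ℕ) :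
    IsDiscreteValuationRing (frobSub K A (p ^ i)) :=
  isDiscreteValuationRing_subring (frobSub K A (p ^ i)).toSubring (frobSub_div _)
    (pow_ne_zero i hp.out.ne_zero) (pow_mem_frobSub _)

variable [Algebra.IsAlgebraic K L]

/-- At a level where the residue field is `K`, the ring of roots is a discrete valuation ring with
residue field `L`. -/
lemma exists_uniformizer_rootSub (n : ℕ)
    (hres : ∀ a ∈ frobSub K A (p ^ n), ∃ k : K, ¬ IsUnit (a - algebraMap K A k)) :
    ∃ t : rootSub K A p L M n, Irreducible t ∧ IsDiscreteValuationRing (rootSub K A p L M n) ∧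
      ∀ b : rootSub K A p L M n, ∃ l : L, ∃ c : rootSub K A p L M n,
        (b : M) = algebraMap (L ⊗[K] A) M (l ⊗ₜ 1) + t * c := by
  have hq0 : p ^ n ≠ 0 := pow_ne_zero n hp.out.ne_zero
  obtain ⟨s, hs⟩ := IsDiscreteValuationRing.exists_irreducible (frobSub K A (p ^ n))
  have hres' : ∀ a : frobSub K A (p ^ n), ∃ k : K, s ∣ a - algebraMap K _ k := by
    intro a
    obtain ⟨k, hk⟩ := hres a a.2
    refine ⟨k, ?_⟩
    rw [← Ideal.mem_span_singleton, ← hs.maximalIdeal_eq, IsLocalRing.mem_maximalIdeal]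
    intro h
    exact hk (h.map (frobSub K A (p ^ n)).val)
  have hinj := geomMap_injective (L := L) (M := M) (frobSub K A (p ^ n))
  -- The uniformizer is the p^n-th root of 1 ⊗ s, where s is a uniformizer at level n of the tower
  -- in A.
  obtain ⟨t', ht'W, ht'⟩ := exists_pow_eq_of_mem_geomSub (p := p) (i := n)
    (tmul_mem_geomSub (M := M) (1 : L) s.2)
  let t : rootSub K A p L M n := ⟨t', ht'W⟩
  have htq : (t : M) ^ p ^ n = geomMap L M (frobSub K A (p ^ n)) (1 ⊗ₜ s) := ht'
  have ht0 : t ≠ 0 := by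
    intro h
    rw [h] at htq
    have h1 : geomMap L M (frobSub K A (p ^ n)) (1 ⊗ₜ s) = geomMap L M (frobSub K A (p ^ n)) 0 := by
      rw [← htq, map_zero]
      exact zero_pow hq0
    have h2 := hinj h1
    rw [← TensorProduct.tmul_zero _ (1 : L)] at h2
    exact hs.ne_zero (Algebra.TensorProduct.includeRight_injective (A := L)
      (algebraMap K L).injective h2)
  have ht0' : (t : M) ≠ 0 := fun h => ht0 (Subtype.ext h)
  have htu : ¬ IsUnit t := by
    intro h
    have h1 := isUnit_of_isUnit_rootSub (L := L) (M := M) le_rfl htq h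
    exact hs.not_isUnit (isUnit_subring (S := (frobSub K A (p ^ n)).toSubring) (frobSub_div _) h1)
  have hmul : ∀ x : rootSub K A p L M n, x ≠ 0 →
      ∃ m : ℕ, ∃ u : (rootSub K A p L M n)ˣ, x = u * t ^ m := by
    intro x hx
    obtain ⟨u, hu⟩ := mem_rootSub.1 x.2
    have hu0 : u ≠ 0 := by
      rintro rfl
      rw [map_zero] at hu
      exact hx (Subtype.ext ((pow_eq_zero_iff hq0).1 hu.symm))
    obtain ⟨m, w, rfl⟩ := exists_unit_mul_pow_tensor hs hres' u hu0
    rw [map_mul, map_pow, ← htq] at hu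
    have h1 : ((x : M) / (t : M) ^ m) ^ p ^ n = geomMap L M (frobSub K A (p ^ n)) (w : L ⊗[K] _) := by
      rw [div_pow, ← hu, pow_right_comm, mul_div_cancel_right₀]
      exact pow_ne_zero _ (pow_ne_zero _ ht0')
    have h2 : (x : M) / (t : M) ^ m ∈ rootSub K A p L M n := mem_rootSub.2 ⟨_, h1.symm⟩
    have h3 : ((x : M) / (t : M) ^ m)⁻¹ ∈ rootSub K A p L M n := by
      refine mem_rootSub.2 ⟨(↑w⁻¹ : L ⊗[K] _), ?_⟩
      rw [inv_pow, h1]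
      refine eq_inv_of_mul_eq_one_left ?_
      rw [← map_mul, Units.inv_mul, map_one]
    have hx0 : (x : M) ≠ 0 := fun h => hx (Subtype.ext h)
    have h4 : (x : M) / (t : M) ^ m ≠ 0 := div_ne_zero hx0 (pow_ne_zero _ ht0')
    refine ⟨m, ⟨⟨_, h2⟩, ⟨_, h3⟩, Subtype.ext (mul_inv_cancel₀ h4),
      Subtype.ext (inv_mul_cancel₀ h4)⟩, Subtype.ext ?_⟩
    change (x : M) = (x : M) / (t : M) ^ m * (t : M) ^ m
    rw [div_mul_cancel₀ _ (pow_ne_zero _ ht0')]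
  have hirr := irreducible_of_unit_mul_pow ht0 htu hmul
  refine ⟨t, hirr, isDiscreteValuationRing_of_unit_mul_pow hirr hmul, fun b => ?_⟩
  obtain ⟨u, hu⟩ := mem_rootSub.1 b.2
  obtain ⟨l, v, hv⟩ := exists_dvd_sub_tmul hres' u
  obtain ⟨r, hr⟩ := exists_pow_eq (p := p) n l
  have h1 : (((b : M) - algebraMap (L ⊗[K] A) M (r ⊗ₜ 1)) / t) ^ p ^ n = geomMap L M (frobSub K A (p ^ n)) v := by
    rw [div_pow, sub_pow_char_pow, ← map_pow, Algebra.TensorProduct.tmul_pow, one_pow, hr, ← hu,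
      div_eq_iff (pow_ne_zero _ ht0'), htq, ← map_mul, mul_comm v, ← hv, map_sub]
    rfl
  refine ⟨r, ⟨_, mem_rootSub.2 ⟨_, h1.symm⟩⟩, ?_⟩
  change (b : M) = _ + (t : M) * (_ / (t : M))
  rw [mul_div_cancel₀ _ ht0']
  ring

section

variable {n : ℕ} [IsDiscreteValuationRing (rootSub K A p L M n)] {t : rootSub K A p L M n}

omit [IsDiscreteValuationRing A] [Algebra.IsAlgebraic K L] in
lemma isPBasis_rootSub
    (hdep : ∀ x : ℕ → M, ∃ a : ℕ → M, (∃ j < p + 1, a j ≠ 0) ∧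
      ∑ j ∈ Finset.range (p + 1), a j ^ p * x j = 0) (ht : Irreducible t) : IsPBasis p t := by
  refine isPBasis_of_dependent ht fun x => ?_
  obtain ⟨c, ⟨i, hi, hci⟩, hc⟩ :=
    exists_integral_dependence (K := K) (A := A) (L := L) hdep fun j => (x j : M)
  have hmem : ∀ u, algebraMap (L ⊗[K] A) M u ∈ rootSub K A p L M n := fun u =>
    rootSub_mono (Nat.zero_le n) (by rw [rootSub_zero]; exact algebraMap_mem_geomSub_top u)
  refine ⟨fun j => ⟨_, hmem (c j)⟩, ⟨i, hi, fun h => hci ?_⟩, Subtype.ext ?_⟩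
  · apply IsFractionRing.injective (L ⊗[K] A) M
    rw [map_zero]
    exact congrArg Subtype.val h
  · rw [AddSubmonoidClass.coe_finsetSum]
    exact hc

-- The top ring is spanned by the t^j with j < p^n over its p^n-th powers, and these powers lie in L
-- ⊗ A. If t = a/b, then b^(p^n) clears the denominators of all these t^j at once.
omit [IsDiscreteValuationRing A] [Algebra.IsAlgebraic K L] in
lemma exists_conductor_rootSub (ht : IsPBasis p t) :
    ∃ N : ℕ, ∀ y : rootSub K A p L M n, ((t ^ N * y : rootSub K A p L M n) : M) ∈
      rootSub K A p L M 0 := by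
  obtain ⟨a, b, hb, hab⟩ := IsFractionRing.div_surjective (A := L ⊗[K] A) (t : M)
  have hmem : ∀ u, algebraMap (L ⊗[K] A) M u ∈ rootSub K A p L M 0 := fun u => by
    rw [rootSub_zero]; exact algebraMap_mem_geomSub_top u
  have hb0 : algebraMap (L ⊗[K] A) M b ≠ 0 := IsFractionRing.to_map_ne_zero_of_mem_nonZeroDivisors hb
  have key : ∀ x : rootSub K A p L M n,
      algebraMap (L ⊗[K] A) M b ^ p ^ n * x ∈ rootSub K A p L M 0 := by
    intro x
    induction ht.mem_closure n x using AddSubmonoid.closure_induction with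
    | mem y hy =>
      obtain ⟨c, j, hj, rfl⟩ := hy
      have h1 : algebraMap (L ⊗[K] A) M b ^ p ^ n * ((c ^ p ^ n * t ^ j : rootSub K A p L M n) : M) =
          (c : M) ^ p ^ n * algebraMap (L ⊗[K] A) M (a ^ j * b ^ (p ^ n - j)) := by
        obtain ⟨r, hr⟩ := Nat.exists_eq_add_of_le hj.le
        change _ * ((c : M) ^ p ^ n * (t : M) ^ j) = _
        rw [← hab, hr, Nat.add_sub_cancel_left, map_mul, map_pow, map_pow, div_pow, pow_add]
        field_simp
      rw [h1]
      refine Subring.mul_mem _ ?_ (hmem _)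
      rw [rootSub_zero]
      exact geomSub_mono le_top (mem_rootSub.1 c.2)
    | zero => simp
    | add y z _ _ hy hz =>
      rw [Subring.coe_add, mul_add]
      exact Subring.add_mem _ hy hz
  let β : rootSub K A p L M n := ⟨_, rootSub_mono (Nat.zero_le n) (Subring.pow_mem _ (hmem b) (p ^ n))⟩
  have hβ : β ≠ 0 := fun h => pow_ne_zero _ hb0 (congrArg Subtype.val h)
  obtain ⟨N, u, hu⟩ := IsDiscreteValuationRing.eq_unit_mul_pow_irreducible hβ ht.irreducible
  refine ⟨N, fun y => ?_⟩
  have h1 : t ^ N * y = β * (↑u⁻¹ * y) := by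
    rw [hu]
    calc t ^ N * y = (u * ↑u⁻¹) * (t ^ N * y) := by rw [Units.mul_inv, one_mul]
      _ = _ := by ring
  rw [h1]
  exact key _

end

end TowerTop

/-! ### Each level of the tower is generated by one element over the next -/

section TowerStep

variable {K A L M : Type*} [Field K] [CommRing A] [IsDomain A] [Algebra K A] {p : ℕ}
  [hp : Fact p.Prime] [CharP A p] [Field L] [Algebra K L] [Field M] [Algebra (L ⊗[K] A) M]
  [CharP M p] [IsFractionRing (L ⊗[K] A) M] [CharP L p] [PerfectRing L p]

instance subalgebraCharP (S : Subalgebra K A) : CharP S p :=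
  ((S.val : S →+* A).charP_iff Subtype.val_injective p).2 inferInstance

section

variable {n : ℕ} [IsDiscreteValuationRing (rootSub K A p L M n)] {t : rootSub K A p L M n}
  (ht : IsPBasis p t) {i : ℕ} (hi : i < n)
include ht hi

/-- A level of the tower cannot be dense in the previous one. -/
lemma not_dense_frobSub {s : A} (hs : s ∈ frobSub K A (p ^ (i + 1))) (hsu : ¬ IsUnit s) :
    ∃ m : ℕ, ∃ x ∈ frobSub K A (p ^ i), ∀ a ∈ frobSub K A (p ^ (i + 1)),
      ∀ c ∈ frobSub K A (p ^ i), x ≠ a + s ^ m * c := by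
  by_contra! H
  obtain ⟨N₀, hN₀⟩ := exists_conductor_rootSub ht
  -- Past the conductor, t^N lies in every level, and its order N is chosen prime to p.
  obtain ⟨N, hN, hpN⟩ : ∃ N, N₀ ≤ N ∧ ¬ p ∣ N := by
    by_cases h : p ∣ N₀
    · refine ⟨N₀ + 1, Nat.le_succ N₀, fun h' => ?_⟩
      exact hp.out.one_lt.ne' (Nat.dvd_one.1 ((Nat.dvd_add_right h).1 h'))
    · exact ⟨N₀, le_rfl, h⟩
  have hx : ((t ^ N : rootSub K A p L M n) : M) ∈ rootSub K A p L M i := by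
    have := hN₀ (t ^ (N - N₀))
    rw [← pow_add, Nat.add_sub_cancel' hN] at this
    exact rootSub_mono (Nat.zero_le i) this
  have key : ∀ y ∈ geomSub L M (frobSub K A (p ^ i)), ∃ a ∈ geomSub L M (frobSub K A (p ^ (i + 1))),
      ∃ c ∈ geomSub L M (frobSub K A (p ^ i)),
        y = a + algebraMap (L ⊗[K] A) M (1 ⊗ₜ s) ^ (N + 1) * c := by
    rintro _ ⟨u, rfl⟩
    induction u with
    | zero => exact ⟨0, Subring.zero_mem _, 0, Subring.zero_mem _, by simp⟩
    | add x y hx hy =>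
      obtain ⟨a, ha, c, hc, h⟩ := hx
      obtain ⟨a', ha', c', hc', h'⟩ := hy
      exact ⟨a + a', Subring.add_mem _ ha ha', c + c', Subring.add_mem _ hc hc', by
        rw [map_add, h, h']; ring⟩
    | tmul l x =>
      obtain ⟨a, ha, c, hc, h⟩ := H (N + 1) x x.2
      refine ⟨_, tmul_mem_geomSub l ha, _, tmul_mem_geomSub l hc, ?_⟩
      rw [geomMap_tmul, h, ← map_pow, Algebra.TensorProduct.tmul_pow, ← map_mul,
        Algebra.TensorProduct.tmul_mul_tmul, ← map_add, one_pow, one_mul, TensorProduct.tmul_add]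
  obtain ⟨a, ha, c, hc, hac⟩ := key _ (mem_rootSub.1 hx)
  obtain ⟨a', ha', rfl⟩ := exists_pow_eq_of_mem_geomSub ha
  obtain ⟨c', hc', rfl⟩ := exists_pow_eq_of_mem_geomSub hc
  obtain ⟨s', hs', hss⟩ := exists_pow_eq_of_mem_geomSub (tmul_mem_geomSub (M := M) (1 : L) hs)
  let a₁ : rootSub K A p L M n := ⟨a', rootSub_mono hi ha'⟩
  let c₁ : rootSub K A p L M n := ⟨c', rootSub_mono hi.le hc'⟩
  let s₁ : rootSub K A p L M n := ⟨s', rootSub_mono hi hs'⟩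
  -- Density would approximate t^N by a p-th power modulo t^(N+1), so N would be the order of a p-th
  -- power.
  have h1 : t ^ N = a₁ ^ p + (s₁ ^ p) ^ (N + 1) * c₁ := by
    apply Subtype.ext
    apply (iterateFrobenius M p i).injective
    change iterateFrobenius M p i ((t ^ N : rootSub K A p L M n) : M) =
      iterateFrobenius M p i (a' ^ p + (s' ^ p) ^ (N + 1) * c')
    rw [map_add, map_mul, map_pow, map_pow, map_pow, iterateFrobenius_def, hac,
      iterateFrobenius_def, iterateFrobenius_def, iterateFrobenius_def, ← hss]
    ring
  have h2 : t ∣ s₁ := by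
    rw [← Ideal.mem_span_singleton, ← ht.irreducible.maximalIdeal_eq, IsLocalRing.mem_maximalIdeal]
    intro h
    exact hsu (isUnit_of_isUnit_rootSub hi (b := s₁) hss h)
  have h3 : t ^ (N + 1) ∣ (s₁ ^ p) ^ (N + 1) * c₁ :=
    Dvd.dvd.mul_right (pow_dvd_pow_of_dvd (h2.trans (dvd_pow_self _ hp.out.ne_zero)) _) _
  have ht0 := ht.irreducible.ne_zero
  have htu := ht.irreducible.not_isUnit
  have h4 : a₁ ≠ 0 := by
    intro h
    rw [h, zero_pow hp.out.ne_zero, zero_add] at h1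
    rw [← h1, pow_dvd_pow_iff ht0 htu] at h3
    omega
  obtain ⟨k, u, hk⟩ := IsDiscreteValuationRing.eq_unit_mul_pow_irreducible h4 ht.irreducible
  have h5 : ∀ m ≤ N + 1, t ^ m ∣ t ^ N ↔ t ^ m ∣ t ^ (k * p) := by
    intro m hm
    rw [h1, dvd_add_left ((pow_dvd_pow t hm).trans h3), hk, mul_pow, ← Units.val_pow_eq_pow_val,
      Units.dvd_mul_left, pow_mul]
  have h6 := h5 N (Nat.le_succ N)
  have h7 := h5 (N + 1) le_rfl
  simp only [pow_dvd_pow_iff ht0 htu] at h6 h7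
  exact hpN ⟨k, by rw [mul_comm]; omega⟩

variable [IsDiscreteValuationRing A]

lemma exists_generator_frobSub
    (hdep : ∀ x : ℕ → M, ∃ a : ℕ → M, (∃ j < p + 1, a j ≠ 0) ∧
      ∑ j ∈ Finset.range (p + 1), a j ^ p * x j = 0) :
    ∃ z ∈ frobSub K A (p ^ i), ∀ x ∈ frobSub K A (p ^ i), ∃ a : ℕ → A,
      (∀ j, a j ∈ frobSub K A (p ^ (i + 1))) ∧ x = ∑ j ∈ Finset.range p, a j * z ^ j := by
  let S : Subring (frobSub K A (p ^ i)) :=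
    (frobSub K A (p ^ (i + 1))).toSubring.comap (frobSub K A (p ^ i)).val.toRingHom
  have hle : frobSub K A (p ^ (i + 1)) ≤ frobSub K A (p ^ i) := by
    rw [pow_succ]; exact frobSub_mul_le _ _
  have h1 : ∀ x ∈ S, ∀ y ∈ S, y ≠ 0 → ∀ w, x = y * w → w ∈ S := by
    intro x hx y hy hy0 w hw
    exact frobSub_div _ (x : A) hx y hy (fun h => hy0 (Subtype.ext h)) w (congrArg Subtype.val hw)
  have h2 : ∀ x : frobSub K A (p ^ i), x ^ p ∈ S := by
    intro x
    change (x : A) ^ p ∈ frobSub K A (p ^ (i + 1))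
    rw [pow_succ]
    exact pow_mem_frobSub_mul p ⟨1, (pow_one p).symm⟩ x.2
  have h3 : ∀ x : ℕ → frobSub K A (p ^ i), ∃ a : ℕ → frobSub K A (p ^ i), (∀ j, a j ∈ S) ∧
      (∃ j < p + 1, a j ≠ 0) ∧ ∑ j ∈ Finset.range (p + 1), a j * x j = 0 := by
    intro x
    obtain ⟨a, haS, ⟨j, hj, hj0⟩, ha⟩ := exists_dependence_frobSub (L := L) hdep i (fun j => (x j : A))
      (fun j => (x j).2)
    refine ⟨fun j => ⟨a j, hle (haS j)⟩, haS, ⟨j, hj, fun h => hj0 (congrArg Subtype.val h)⟩,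
      Subtype.ext ?_⟩
    rw [AddSubmonoidClass.coe_finsetSum]
    exact ha
  have h4 : ∀ s ∈ S, Irreducible s → ∃ m x, ∀ a ∈ S, ¬ s ^ m ∣ x - a := by
    intro s hs hirr
    obtain ⟨m, x, hx, h⟩ := not_dense_frobSub ht hi (s := (s : A)) hs (fun h =>
      hirr.not_isUnit (isUnit_subring (S := (frobSub K A (p ^ i)).toSubring) (frobSub_div _) h))
    refine ⟨m, ⟨x, hx⟩, fun a ha => ?_⟩
    rintro ⟨c, hc⟩
    refine h a ha c c.2 ?_
    have h1 := congrArg Subtype.val hc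
    change x - a = (s : A) ^ m * c at h1
    rw [← h1]
    ring
  obtain ⟨z, hz⟩ := exists_monogenic_generator (p := p) S h1 h2 h3 h4
  refine ⟨z, z.2, fun x hx => ?_⟩
  obtain ⟨a, haS, ha⟩ := hz ⟨x, hx⟩
  refine ⟨fun j => a j, haS, ?_⟩
  have := congrArg Subtype.val ha
  rw [AddSubmonoidClass.coe_finsetSum] at this
  exact this

/-- Expand over L ⊗ `frobSub` in powers of 1 ⊗ ζ and take p^i-th roots: the coefficients, which
belong to level i + 1, become p-th powers of their p^(i+1)-th roots. -/
lemma exists_isPMonogenic_rootSub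
    (hdep : ∀ x : ℕ → M, ∃ a : ℕ → M, (∃ j < p + 1, a j ≠ 0) ∧
      ∑ j ∈ Finset.range (p + 1), a j ^ p * x j = 0) :
    ∃ z : rootSub K A p L M n, (z : M) ∈ rootSub K A p L M i ∧
      IsPMonogenic p z {b : rootSub K A p L M n | (b : M) ∈ rootSub K A p L M i}
      {b : rootSub K A p L M n | (b : M) ∈ rootSub K A p L M (i + 1)} := by
  obtain ⟨ζ, hζ, hgen⟩ := exists_generator_frobSub ht hi hdep
  obtain ⟨z, hz, hzζ⟩ := exists_pow_eq_of_mem_geomSub (tmul_mem_geomSub (M := M) (1 : L) hζ)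
  refine ⟨⟨z, rootSub_mono hi.le hz⟩, hz, fun x => ⟨fun hx => ?_, ?_⟩⟩
  · have key : ∀ y ∈ geomSub L M (frobSub K A (p ^ i)), ∃ e : ℕ → M,
        (∀ j, e j ∈ geomSub L M (frobSub K A (p ^ (i + 1)))) ∧
        y = ∑ j ∈ Finset.range p, e j * (z ^ p ^ i) ^ j := by
      rintro _ ⟨u, rfl⟩
      induction u with
      | zero => exact ⟨0, fun j => Subring.zero_mem _, by simp⟩
      | add x y hx hy =>
        obtain ⟨e, he, h⟩ := hx
        obtain ⟨e', he', h'⟩ := hy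
        exact ⟨e + e', fun j => Subring.add_mem _ (he j) (he' j), by
          rw [map_add, h, h', ← Finset.sum_add_distrib]
          exact Finset.sum_congr rfl fun j _ => (add_mul _ _ _).symm⟩
      | tmul l x =>
        obtain ⟨a, ha, h⟩ := hgen x x.2
        refine ⟨fun j => algebraMap (L ⊗[K] A) M (l ⊗ₜ a j), fun j => tmul_mem_geomSub l (ha j), ?_⟩
        rw [geomMap_tmul, h, TensorProduct.tmul_sum, map_sum]
        refine Finset.sum_congr rfl fun j _ => ?_
        rw [hzζ, ← map_pow, Algebra.TensorProduct.tmul_pow, one_pow, ← map_mul,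
          Algebra.TensorProduct.tmul_mul_tmul, mul_one]
    obtain ⟨e, he, h⟩ := key _ (mem_rootSub.1 hx)
    choose w hw hwe using fun j => exists_pow_eq_of_mem_geomSub (he j)
    refine ⟨fun j => ⟨w j, rootSub_mono hi (hw j)⟩, hw, Subtype.ext ?_⟩
    apply (iterateFrobenius M p i).injective
    rw [AddSubmonoidClass.coe_finsetSum, iterateFrobenius_def, h, map_sum]
    refine Finset.sum_congr rfl fun j _ => ?_
    change _ = iterateFrobenius M p i (w j ^ p * z ^ j)
    rw [iterateFrobenius_def, ← hwe, mul_pow]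
    ring
  · rintro ⟨w, hw, rfl⟩
    change ((∑ j ∈ Finset.range p, w j ^ p * _ : rootSub K A p L M n) : M) ∈ rootSub K A p L M i
    rw [AddSubmonoidClass.coe_finsetSum]
    exact Subring.sum_mem _ fun j _ =>
      Subring.mul_mem _ (pow_mem_rootSub (hw j)) (Subring.pow_mem _ hz j)

end

end TowerStep

/-- The conductor exponents in a tower of `p`-monogenic extensions. -/
theorem IsPBasis.conductor_tower {B : Type*} [CommRing B] [IsDomain B] [IsDiscreteValuationRing B]
    {p : ℕ} [hp : Fact p.Prime] [CharP B p] {t : B} (ht : IsPBasis p t) {n : ℕ} {W : ℕ → Set B}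
    {z : ℕ → B} (hW : ∀ i < n, IsPMonogenic p (z i) (W i) (W (i + 1)))
    (hmono : ∀ i < n, W 0 ⊆ W i) (htop : W n = Set.univ) {N : ℕ} (hN : ∀ y, t ^ N * y ∈ W 0)
    {e : ℕ → ℕ} {v : ℕ → Bˣ} (he : ∀ i < n, ht.deriv (z i) = v i * t ^ e i) (m : ℕ) :
    (∀ y, t ^ m * y ∈ W 0) ↔ ∑ i ∈ Finset.range n, (p - 1) * e i * p ^ i ≤ m := by
  -- Induction downwards from W n, whose conductor exponent is 0; k counts the levels from the top.
  suffices H : ∀ k ≤ n, ∀ m, (∀ y, t ^ m * y ∈ W (n - k)) ↔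
      ∑ i ∈ Finset.range k, (p - 1) * e (n - k + i) * p ^ i ≤ m by
    have := H n le_rfl m
    simpa using this
  intro k
  induction k with
  | zero => simp [htop]
  | succ k ih =>
    intro hk m
    have h1 : n - k = n - (k + 1) + 1 := by omega
    have h2 := ih (by omega)
    rw [h1] at h2
    rw [ht.conductor_step (hW _ (by omega)) (fun y => hmono _ (by omega) (hN y)) h2
      (he _ (by omega)) m, Finset.sum_range_succ', Finset.mul_sum, add_comm]
    simp only [pow_zero, mul_one, add_zero]
    rw [Finset.sum_congr rfl (g := fun i => (p - 1) * e (n - (k + 1) + (i + 1)) * p ^ (i + 1))]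
    intro i _
    rw [add_assoc, add_comm 1 i]
    ring

/-! ### Transport of structure -/

section Transport

open Polynomial

variable {B B' : Type*} [CommRing B] [IsDomain B] [IsDiscreteValuationRing B] [CommRing B']
  [IsDomain B'] [IsDiscreteValuationRing B'] {p : ℕ} [hp : Fact p.Prime] [CharP B p] [CharP B' p]
  (e : B ≃+* B') {t : B}

lemma frobEval_map (R : B[X]) :
    frobEval p (e t) (R.map e.toRingHom) = e (frobEval p t R) := by
  induction R using Polynomial.induction_on' with
  | add f g hf hg => rw [Polynomial.map_add, map_add, map_add, map_add, hf, hg]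
  | monomial k a =>
    rw [Polynomial.map_monomial, ← C_mul_X_pow_eq_monomial, ← C_mul_X_pow_eq_monomial, map_mul,
      map_mul, map_pow, map_pow, frobEval_C, frobEval_C, frobEval_X, frobEval_X, map_mul, map_pow,
      map_pow]
    rfl

lemma IsPBasis.map (ht : IsPBasis p t) : IsPBasis p (e t) := by
  refine ⟨(MulEquiv.irreducible_iff e).2 ht.irreducible, fun b => ?_⟩
  obtain ⟨R, hR⟩ := ht.surjective (e.symm b)
  exact ⟨R.map e.toRingHom, by rw [frobEval_map, hR, RingEquiv.apply_symm_apply]⟩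

lemma IsPBasis.deriv_map (ht : IsPBasis p t) (b : B) :
    (ht.map e).deriv (e b) = e (ht.deriv b) := by
  obtain ⟨R, rfl⟩ := ht.surjective b
  rw [← frobEval_map, IsPBasis.deriv_frobEval, IsPBasis.deriv_frobEval, derivative_map, frobEval_map]

end Transport

/-! ### The semigroup of values, computed in a model of the normalization -/

section Invariants

variable {L A : Type u} [Field L] [CommRing A] [IsDomain A] [Algebra L A]
  {B M : Type*} [CommRing B] [IsDomain B] [IsDiscreteValuationRing B] [Algebra A B]
  [Algebra L B] [IsScalarTower L A B]

section

variable [Field M] [Algebra A M] [Algebra B M] [IsScalarTower A B M]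

variable (A B M) in
/-- A model of the normalization. -/
noncomputable def normalizedEquiv [IsFractionRing A M] [IsIntegralClosure B A M] :
    B ≃ₐ[A] Normalized A :=
  (IsIntegralClosure.equiv A B M (integralClosure A M)).trans
    (FractionRing.algEquiv A M).symm.mapIntegralClosure

end

variable (e : B ≃ₐ[A] Normalized A) {t : B} (ht : Irreducible t)
include e ht

lemma mem_valueSemigroup_iff (l : ℕ) : l ∈ valueSemigroup A ↔
    ∃ x : A, ∃ v : Bˣ, algebraMap A B x = v * t ^ l := by
  have hdom : IsDomain (Normalized A) := inferInstance
  have hdvr : IsDiscreteValuationRing (Normalized A) :=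
    IsDiscreteValuationRing.RingEquivClass.isDiscreteValuationRing e
  have het : Irreducible (e t) := (MulEquiv.irreducible_iff e).2 ht
  constructor
  · rintro ⟨_, _, x, hx⟩
    have hx0 : algebraMap A (Normalized A) x ≠ 0 := by
      intro h
      rw [h, IsDiscreteValuationRing.addVal_zero] at hx
      exact ENat.natCast_ne_top l hx.symm
    obtain ⟨n, v, hv⟩ := IsDiscreteValuationRing.eq_unit_mul_pow_irreducible hx0 het
    rw [IsDiscreteValuationRing.addVal_def _ v het n hv, Nat.cast_inj] at hx
    subst hx
    refine ⟨x, Units.map (e.symm : Normalized A →* B) v, e.injective ?_⟩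
    rw [AlgEquiv.commutes, hv, map_mul, map_pow]
    congr 1
    exact (e.apply_symm_apply _).symm
  · rintro ⟨x, v, hv⟩
    refine ⟨hdom, hdvr, x, ?_⟩
    refine IsDiscreteValuationRing.addVal_def _ (Units.map (e : B →* Normalized A) v) het l ?_
    rw [← e.commutes, hv, map_mul, map_pow]
    rfl

section

variable (hL : ∀ b : B, ∃ l : L, t ∣ b - algebraMap L B l)
include hL

/-- The semigroup conductor is the exponent of the conductor ideal. -/
lemma setConductor_valueSemigroup {c : ℕ}
    (hc : ∀ m, (∀ y, t ^ m * y ∈ (algebraMap A B).range) ↔ c ≤ m) :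
    (∀ l, c ≤ l → l ∈ valueSemigroup A) ∧ setConductor (valueSemigroup A) = c := by
  have hmem := mem_valueSemigroup_iff e ht
  have h1 : ∀ l, c ≤ l → l ∈ valueSemigroup A := by
    intro l hl
    obtain ⟨x, hx⟩ := (hc l).2 hl 1
    exact (hmem l).2 ⟨x, 1, by rw [hx, mul_one, Units.val_one, one_mul]⟩
  refine ⟨h1, ?_⟩
  have hle : ∀ c' ∈ {c | 0 < c ∧ c ∈ valueSemigroup A ∧ c - 1 ∉ valueSemigroup A}, c' ≤ c := by
    rintro c' ⟨h0, -, h2⟩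
    by_contra hlt
    exact h2 (h1 _ (by omega))
  -- For c = 0 there are no gaps, and the supremum of the empty set is 0 by convention.
  rcases Nat.eq_zero_or_pos c with hc0 | hc0
  · subst hc0
    have hempty : {c | 0 < c ∧ c ∈ valueSemigroup A ∧ c - 1 ∉ valueSemigroup A} = ∅ := by
      refine Set.eq_empty_of_forall_notMem fun c' hc' => ?_
      have := hle c' hc'
      exact absurd hc'.1 (by omega)
    rw [setConductor, hempty]
    exact csSup_empty
  · refine IsGreatest.csSup_eq ⟨⟨hc0, h1 c le_rfl, fun h2 => ?_⟩, hle⟩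
    obtain ⟨x, v, hv⟩ := (hmem _).1 h2
    have h3 : c ≤ c - 1 := (hc _).1 fun y => by
      -- If x has order c - 1, a constant multiple of x matches the leading term of t^(c-1) y and
      -- the rest is in t^c B, hence in A. So t^(c-1) B would lie in A, against the minimality of c.
      obtain ⟨l, d, hd⟩ := hL (↑v⁻¹ * y)
      obtain ⟨w, hw⟩ := (hc c).2 le_rfl (v * d)
      refine ⟨x * algebraMap L A l + w, ?_⟩
      rw [map_add, map_mul, ← IsScalarTower.algebraMap_apply, hw, eq_sub_of_add_eq
        (sub_eq_iff_eq_add'.1 hd).symm, hv]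
      obtain ⟨c, rfl⟩ := Nat.exists_eq_succ_of_ne_zero hc0.ne'
      simp only [Nat.succ_eq_add_one, Nat.add_sub_cancel, pow_succ]
      calc _ = (v * ↑v⁻¹) * t ^ c * y := by ring
        _ = _ := by rw [Units.mul_inv, one_mul]
    omega

end

end Invariants

/-! ### The dimension of the cokernel of α -/

section Coker

variable {L A : Type u} [Field L] [CommRing A] [IsDomain A] [Algebra L A]
  {B : Type*} [CommRing B] [IsDomain B] [IsDiscreteValuationRing B] [Algebra A B]
  [Algebra L B] [IsScalarTower L A B]

/-- The cokernel of `N ⊗ Ω_{A/L} → Ω_{N/L}` is the module of differentials of `N` over `A`. -/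
noncomputable def mapBaseChangeCokerEquiv (L A N : Type*) [CommRing L] [CommRing A] [CommRing N]
    [Algebra L A] [Algebra L N] [Algebra A N] [IsScalarTower L A N] :
    (Ω[N⁄L] ⧸ LinearMap.range (KaehlerDifferential.mapBaseChange L A N)) ≃ₗ[N] Ω[N⁄A] :=
  (KaehlerDifferential.exact_mapBaseChange_map L A N).linearEquivOfSurjective
    (KaehlerDifferential.map_surjective L A N)

/-- The cokernel is the module of differentials of the normalization over A, isomorphic to B/(dz/dt)
= B/t^k, which has k digits in L. The p-basis is carried along e because `AlphaCoker` refers to the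
normalization itself. -/
lemma finrank_alphaCoker (e : B ≃ₐ[A] Normalized A) {p : ℕ} [hp : Fact p.Prime] [CharP B p] {t : B}
    (ht : IsPBasis p t) (hL : ∀ b : B, ∃ l : L, t ∣ b - algebraMap L B l) {z : B}
    (hA : ∀ a : A, ht.deriv z ∣ ht.deriv (algebraMap A B a)) {a : A} (ha : algebraMap A B a = z)
    {k : ℕ} {v : Bˣ} (hk : ht.deriv z = v * t ^ k) :
    Module.Finite L (AlphaCoker L A) ∧ Module.finrank L (AlphaCoker L A) = k := by
  have hdvr : IsDiscreteValuationRing (Normalized A) :=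
    IsDiscreteValuationRing.RingEquivClass.isDiscreteValuationRing e
  have hchar : CharP (Normalized A) p :=
    ((e : B →+* Normalized A).charP_iff e.injective p).1 inferInstance
  have ht' := ht.map (e : B ≃+* Normalized A)
  have hd : ∀ b, ht'.deriv (e b) = e (ht.deriv b) := ht.deriv_map (e : B ≃+* Normalized A)
  have e1 := ht'.kaehlerEquiv (A := A) (z := e z) (fun a => by
    rw [← e.commutes, hd, hd]
    exact map_dvd e (hA a)) (a := a) (by rw [← e.commutes, ha])
  have hspan : Ideal.span {ht'.deriv (e z)} = Ideal.span {e t ^ k} := by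
    rw [hd, hk, map_mul, map_pow]
    exact Ideal.span_singleton_mul_left_unit ((v.isUnit).map e) _
  have hL' : ∀ b : Normalized A, ∃ l : L, e t ∣ b - algebraMap L (Normalized A) l := by
    intro b
    obtain ⟨l, hl⟩ := hL (e.symm b)
    refine ⟨l, ?_⟩
    have := map_dvd e hl
    rwa [map_sub, e.apply_symm_apply, IsScalarTower.algebraMap_apply L A B, e.commutes,
      ← IsScalarTower.algebraMap_apply] at this
  have e2 := quotientPowEquiv (L := L) ht'.irreducible hL' k
  rw [hspan] at e1
  have e3 : AlphaCoker L A ≃ₗ[L] (Fin k → L) :=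
    (((mapBaseChangeCokerEquiv L A (Normalized A)).trans e1).restrictScalars L).trans e2.symm
  exact ⟨Module.Finite.equiv e3.symm, by rw [e3.finrank_eq, Module.finrank_fin_fun]⟩

end Coker

/-- A discrete valuation subring of a field is the normalization of a subring over which it is
integral and that has the same fractions. -/
lemma nonempty_normalizedEquiv {M A : Type*} [Field M] [CommRing A] [IsDomain A] (W : Subring M)
    [IsDiscreteValuationRing W] [Algebra A W] (hinj : Function.Injective (algebraMap A W))
    (hfrac : ∀ m : M, ∃ x y : A, m = (algebraMap A W x : M) / (algebraMap A W y : M))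
    (hint : ∀ b : W, ∃ q : ℕ, 0 < q ∧ b ^ q ∈ (algebraMap A W).range) :
    Nonempty (W ≃ₐ[A] Normalized A) := by
  let : Algebra A M := (W.subtype.comp (algebraMap A W)).toAlgebra
  have : IsScalarTower A W M := IsScalarTower.of_algebraMap_eq' rfl
  have : FaithfulSMul A M := (faithfulSMul_iff_algebraMap_injective A M).2
    (Subtype.val_injective.comp hinj)
  have : IsFractionRing A M := IsFractionRing.of_field A M fun m => by
    obtain ⟨x, y, h⟩ := hfrac m
    exact ⟨x, y, h⟩
  have : IsFractionRing W M := IsFractionRing.of_field W M fun m => by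
    obtain ⟨x, y, h⟩ := hfrac m
    exact ⟨algebraMap A W x, algebraMap A W y, h⟩
  have : IsIntegralClosure W A M :=
    { algebraMap_injective := Subtype.val_injective
      isIntegral_iff := by
        intro x
        constructor
        · intro hx
          obtain ⟨y, hy⟩ := IsIntegrallyClosed.isIntegral_iff.1 (hx.tower_top (A := W))
          exact ⟨y, hy⟩
        · rintro ⟨b, rfl⟩
          obtain ⟨q, hq, a, ha⟩ := hint b
          have h1 : IsIntegral A b := IsIntegral.of_pow hq (ha ▸ isIntegral_algebraMap)
          exact h1.map (IsScalarTower.toAlgHom A W M) }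
  exact ⟨normalizedEquiv A W M⟩

/-! ### Each level as a subring of the top ring, and the formula for discrete valuation rings -/

section LevelHom

variable {K A L M : Type*} [Field K] [CommRing A] [IsDomain A] [Algebra K A] {p : ℕ}
  [hp : Fact p.Prime] [CharP A p] [Field L] [Algebra K L] [Field M] [Algebra (L ⊗[K] A) M]
  [CharP M p] [IsFractionRing (L ⊗[K] A) M] [CharP L p] [PerfectRing L p]

/-- The embedding of `L ⊗ R`, where `R` is the `i`-th subalgebra of the tower, by `p ^ i`-th roots. -/
lemma exists_levelHom {n i : ℕ} (hi : i ≤ n) {R : Type*} [CommRing R] [Algebra K R]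
    (e : R ≃ₐ[K] frobSub K A (p ^ i)) : ∃ g : L ⊗[K] R →+* rootSub K A p L M n,
      Function.Injective g ∧ (∀ b, b ∈ g.range ↔ (b : M) ∈ rootSub K A p L M i) ∧
      ∀ l : L, (g (l ⊗ₜ 1) : M) ^ p ^ i = algebraMap (L ⊗[K] A) M (l ⊗ₜ 1) := by
  let E : L ⊗[K] R ≃ₐ[L] L ⊗[K] frobSub K A (p ^ i) :=
    Algebra.TensorProduct.congr AlgEquiv.refl e
  let f : rootSub K A p L M n →+* M := (iterateFrobenius M p i).comp (rootSub K A p L M n).subtype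
  have hf : Function.Injective f :=
    (iterateFrobenius M p i).injective.comp Subtype.val_injective
  have hrange : ∀ u, geomMap L M (frobSub K A (p ^ i)) u ∈ f.range := fun u => by
    obtain ⟨m, hm, hm'⟩ := exists_pow_eq_of_mem_geomSub (p := p) (i := i)
      (x := geomMap L M (frobSub K A (p ^ i)) u) ⟨u, rfl⟩
    exact ⟨⟨m, rootSub_mono hi hm⟩, hm'⟩
  let Ef : rootSub K A p L M n ≃+* f.range :=
    RingEquiv.ofBijective f.rangeRestrict
      ⟨fun a b hab => hf (congrArg Subtype.val hab), f.rangeRestrict_surjective⟩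
  let g : L ⊗[K] R →+* rootSub K A p L M n :=
    (Ef.symm : f.range →+* _).comp
      (((geomMap L M (frobSub K A (p ^ i))).codRestrict f.range hrange).comp (E : L ⊗[K] R →+* _))
  have hg : ∀ u, (g u : M) ^ p ^ i = geomMap L M (frobSub K A (p ^ i)) (E u) := by
    intro u
    change f (g u) = _
    have h1 : Ef (g u) = ⟨geomMap L M (frobSub K A (p ^ i)) (E u), hrange _⟩ :=
      Ef.apply_symm_apply _
    exact congrArg Subtype.val h1
  refine ⟨g, fun u v huv => ?_, fun b => ⟨?_, fun hb => ?_⟩, fun l => ?_⟩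
  · apply E.injective
    apply geomMap_injective (L := L) (M := M)
    rw [← hg, ← hg, huv]
  · rintro ⟨u, rfl⟩
    exact mem_rootSub.2 ⟨E u, (hg u).symm⟩
  · obtain ⟨u, hu⟩ := mem_rootSub.1 hb
    refine ⟨E.symm u, hf ?_⟩
    change (g (E.symm u) : M) ^ p ^ i = (b : M) ^ p ^ i
    rw [hg, E.apply_symm_apply, hu]
  · rw [hg]
    have : E (l ⊗ₜ 1) = l ⊗ₜ 1 := by
      rw [Algebra.TensorProduct.congr_apply, Algebra.TensorProduct.map_tmul]
      simp
    rw [this, geomMap_tmul]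
    rfl

end LevelHom

/-- The conductor formula, for the tower of a discrete valuation ring over a field. -/
theorem conductor_formula {K A L : Type u} [Field K] [CommRing A] [IsDomain A] [Algebra K A]
    (p : ℕ) [hp : Fact p.Prime] [CharP K p] [IsDiscreteValuationRing A] [Field L] [Algebra K L]
    [Algebra.IsAlgebraic K L] [CharP L p] [PerfectRing L p] [IsDomain (L ⊗[K] A)]
    (hdep : ∀ x : ℕ → FractionRing (L ⊗[K] A), ∃ a : ℕ → FractionRing (L ⊗[K] A),
      (∃ j < p + 1, a j ≠ 0) ∧ ∑ j ∈ Finset.range (p + 1), a j ^ p * x j = 0) (n : ℕ)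
    (hres : ∀ a ∈ frobSub K A (p ^ n), ∃ k : K, ¬ IsUnit (a - algebraMap K A k))
    {R : ℕ → Type u} [∀ i, CommRing (R i)] [∀ i, Algebra K (R i)]
    (e : ∀ i, R i ≃ₐ[K] frobSub K A (p ^ i)) :
    (∃ c : ℕ, ∀ l, c ≤ l → l ∈ valueSemigroup (L ⊗[K] A)) ∧
    (∀ i < n, Module.Finite L (AlphaCoker L (L ⊗[K] R i))) ∧
    setConductor (valueSemigroup (L ⊗[K] A)) = ∑ i ∈ Finset.range n,
      (p - 1) * Module.finrank L (AlphaCoker L (L ⊗[K] R i)) * p ^ i := by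
  let M := FractionRing (L ⊗[K] A)
  have : CharP A p := charP_of_injective_algebraMap (algebraMap K A).injective p
  have : CharP M p := charP_of_injective_ringHom
    (f := (algebraMap (L ⊗[K] A) M).comp (algebraMap L (L ⊗[K] A))) (RingHom.injective _) p
  obtain ⟨t, ht, hdvr, hL⟩ := exists_uniformizer_rootSub (L := L) (M := M) n hres
  have hb : IsPBasis p t := isPBasis_rootSub hdep ht
  obtain ⟨N, hN⟩ := exists_conductor_rootSub hb
  have hz : ∀ i, ∃ z : rootSub K A p L M n, i < n → (z : M) ∈ rootSub K A p L M i ∧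
      IsPMonogenic p z {b : rootSub K A p L M n | (b : M) ∈ rootSub K A p L M i}
      {b : rootSub K A p L M n | (b : M) ∈ rootSub K A p L M (i + 1)} := by
    intro i
    by_cases hi : i < n
    · obtain ⟨z, h⟩ := exists_isPMonogenic_rootSub hb hi hdep
      exact ⟨z, fun _ => h⟩
    · exact ⟨0, fun h => absurd h hi⟩
  choose z hz using hz
  have hk : ∀ i, ∃ k : ℕ, ∃ v : (rootSub K A p L M n)ˣ, i < n → hb.deriv (z i) = v * t ^ k := by
    intro i
    by_cases hi : i < n
    · obtain ⟨k, v, h⟩ := IsDiscreteValuationRing.eq_unit_mul_pow_irreducible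
        (hb.deriv_ne_zero (hz i hi).2 (N := N) (fun y => rootSub_mono (Nat.zero_le i) (hN y))) ht
      exact ⟨k, v, fun _ => h⟩
    · exact ⟨0, 1, fun h => absurd h hi⟩
  choose k v hk using hk
  have hfrac : ∀ m : M, ∃ x ∈ rootSub K A p L M 0, ∃ y ∈ rootSub K A p L M 0, m = x / y := by
    intro m
    obtain ⟨x, y, -, h⟩ := IsFractionRing.div_surjective (A := L ⊗[K] A) m
    have hmem : ∀ u, algebraMap (L ⊗[K] A) M u ∈ rootSub K A p L M 0 := fun u => by
      rw [rootSub_zero]; exact algebraMap_mem_geomSub_top u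
    exact ⟨_, hmem x, _, hmem y, h.symm⟩
  have hint : ∀ b : rootSub K A p L M n, ((b ^ p ^ n : rootSub K A p L M n) : M) ∈
      rootSub K A p L M 0 := by
    intro b
    rw [rootSub_zero]
    exact geomSub_mono le_top (mem_rootSub.1 b.2)
  -- All levels have the top ring as normalization: they share their fractions with L ⊗ A, and
  -- p^n-th powers from the top already lie at level 0.
  have level : ∀ i ≤ n, ∀ (R : Type u) [CommRing R] [Algebra K R]
      (e : R ≃ₐ[K] frobSub K A (p ^ i)), ∃ (_ : IsDomain (L ⊗[K] R))
      (_ : Algebra (L ⊗[K] R) (rootSub K A p L M n)) (_ : Algebra L (rootSub K A p L M n))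
      (_ : IsScalarTower L (L ⊗[K] R) (rootSub K A p L M n)),
      (∀ b, b ∈ (algebraMap (L ⊗[K] R) (rootSub K A p L M n)).range ↔
        (b : M) ∈ rootSub K A p L M i) ∧
      (∀ b : rootSub K A p L M n, ∃ l : L, t ∣ b - algebraMap L (rootSub K A p L M n) l) ∧
      Nonempty (rootSub K A p L M n ≃ₐ[L ⊗[K] R] Normalized (L ⊗[K] R)) := by
    intro i hi R _ _ e
    obtain ⟨g, hinj, hrange, hgL⟩ := exists_levelHom (L := L) (M := M) hi e
    have hdom : IsDomain (L ⊗[K] R) := hinj.isDomain g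
    let alg : Algebra (L ⊗[K] R) (rootSub K A p L M n) := g.toAlgebra
    let algL : Algebra L (rootSub K A p L M n) := (g.comp (algebraMap L (L ⊗[K] R))).toAlgebra
    refine ⟨hdom, alg, algL, IsScalarTower.of_algebraMap_eq' rfl, hrange, fun b => ?_,
      nonempty_normalizedEquiv _ hinj (fun m => ?_) (fun b => ⟨p ^ n, pow_pos hp.out.pos n,
        (hrange _).2 (rootSub_mono (Nat.zero_le i) (hint b))⟩)⟩
    · obtain ⟨l, c, hc⟩ := hL b
      -- At level i a constant acts through its p^i-th root, so l^(p^i) acts as l. This twist by an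
      -- automorphism of L keeps L a field of representatives of the residues.
      refine ⟨l ^ p ^ i, c, Subtype.ext ?_⟩
      have h1 : ((algebraMap L (rootSub K A p L M n) (l ^ p ^ i) : rootSub K A p L M n) : M) =
          algebraMap (L ⊗[K] A) M (l ⊗ₜ 1) := by
        apply (iterateFrobenius M p i).injective
        rw [iterateFrobenius_def, iterateFrobenius_def]
        refine (hgL _).trans ?_
        rw [← map_pow, Algebra.TensorProduct.tmul_pow, one_pow]
        rfl
      change (b : M) - _ = t * c
      rw [h1, hc]
      ring
    · obtain ⟨x, hx, y, hy, h⟩ := hfrac m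
      have h0 : ∀ w ∈ rootSub K A p L M 0, ∃ u, ((algebraMap (L ⊗[K] R) (rootSub K A p L M n) u :
          rootSub K A p L M n) : M) = w := by
        intro w hw
        obtain ⟨u, hu⟩ := (hrange ⟨w, rootSub_mono (Nat.zero_le n) hw⟩).2
          (rootSub_mono (Nat.zero_le i) hw)
        exact ⟨u, congrArg Subtype.val hu⟩
      obtain ⟨u, rfl⟩ := h0 x hx
      obtain ⟨w, rfl⟩ := h0 y hy
      exact ⟨u, w, h⟩
  have hdiff : ∀ i < n, Module.Finite L (AlphaCoker L (L ⊗[K] R i)) ∧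
      Module.finrank L (AlphaCoker L (L ⊗[K] R i)) = k i := by
    intro i hi
    obtain ⟨_, _, _, _, hrange, hLi, ⟨E⟩⟩ := level i hi.le (R i) (e i)
    obtain ⟨a, ha⟩ := (hrange (z i)).2 (hz i hi).1
    exact finrank_alphaCoker E hb hLi (fun a => hb.deriv_dvd_deriv (hz i hi).2
      ((hrange _).1 ⟨a, rfl⟩)) ha (hk i hi)
  have hcond := hb.conductor_tower (n := n)
    (W := fun i => {b : rootSub K A p L M n | (b : M) ∈ rootSub K A p L M i})
    (fun i hi => (hz i hi).2) (fun i _ b hb => rootSub_mono (Nat.zero_le i) hb)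
    (Set.eq_univ_of_forall fun b => b.2) hN hk
  let e0 : A ≃ₐ[K] frobSub K A (p ^ 0) :=
    Subalgebra.topEquiv.symm.trans (Subalgebra.equivOfEq _ _ (by rw [pow_zero, frobSub_one]))
  obtain ⟨_, _, _, _, hrange, hL0, ⟨E⟩⟩ := level 0 (Nat.zero_le n) A e0
  obtain ⟨h1, h2⟩ := setConductor_valueSemigroup E ht hL0
    (c := ∑ i ∈ Finset.range n, (p - 1) * k i * p ^ i) (fun m => by
      rw [← hcond m]
      exact forall_congr' fun y => hrange _)
  refine ⟨⟨_, h1⟩, fun i hi => (hdiff i hi).1, h2.trans ?_⟩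
  refine Finset.sum_congr rfl fun i hi => ?_
  rw [(hdiff i (Finset.mem_range.1 hi)).2]

/-! ### Dimension one and the degree of a function field over its p-th powers -/

/-- A domain with an integral extension domain of dimension at most one has dimension at most
one. -/
lemma krullDimLE_one_of_injective_isIntegral {R S : Type*} [CommRing R] [IsDomain R] [CommRing S]
    [IsDomain S] [Ring.KrullDimLE 1 S] (g : R →+* S) (hg : Function.Injective g)
    (hint : g.IsIntegral) : Ring.KrullDimLE 1 R := by
  let _ : Algebra R S := g.toAlgebra
  have : Algebra.IsIntegral R S := ⟨hint⟩
  rw [Ring.krullDimLE_one_iff_of_noZeroDivisors]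
  intro I hI0 hI
  obtain ⟨Q, -, hQ, h⟩ := Ideal.exists_ideal_over_prime_of_isIntegral (S := S) I ⊥ (by
    rw [← RingHom.ker_eq_comap_bot, (RingHom.injective_iff_ker_eq_bot (algebraMap R S)).1 hg]
    exact bot_le)
  have hQ0 : Q ≠ ⊥ := by
    rintro rfl
    refine hI0 (h.symm.trans ?_)
    exact Ideal.comap_bot_of_injective (algebraMap R S) hg
  have := hQ.isMaximal_of_ne_bot hQ0
  rw [← h]
  exact Ideal.isMaximal_comap_of_isIntegral_of_isMaximal Q

/-- A finitely generated domain of dimension at most one over a field is integral over the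
subalgebra generated by one element. -/
lemma exists_isIntegral_adjoin_singleton (K R : Type*) [Field K] [CommRing R] [IsDomain R]
    [Algebra K R] [Algebra.FiniteType K R] [Ring.KrullDimLE 1 R] :
    ∃ x : R, Algebra.IsIntegral (Algebra.adjoin K {x}) R := by
  obtain ⟨s, g, hinj, hint⟩ := exists_integral_inj_algHom_of_fg K R
  have h1 := krullDimLE_one_of_injective_isIntegral (g : MvPolynomial (Fin s) K →+* R) hinj hint
  rw [Ring.krullDimLE_iff, MvPolynomial.ringKrullDim_of_isNoetherianRing,
    ringKrullDim_eq_zero_of_field, zero_add] at h1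
  have hs : s ≤ 1 := by simpa using h1
  have h2 : ∃ x : R, g.range ≤ Algebra.adjoin K {x} := by
    have h3 : ∀ x : R, (∀ i : Fin s, g (MvPolynomial.X i) = x) →
        g.range ≤ Algebra.adjoin K {x} := by
      rintro x hx _ ⟨q, rfl⟩
      induction q using MvPolynomial.induction_on with
      | C a => exact (g.commutes a) ▸ Subalgebra.algebraMap_mem _ a
      | add q r hq hr => simpa using add_mem hq hr
      | mul_X q i hq =>
        simp only [AlgHom.toRingHom_eq_coe, RingHom.coe_coe, map_mul] at hq ⊢
        exact mul_mem hq (hx i ▸ Algebra.subset_adjoin rfl)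
    interval_cases s
    · exact ⟨0, h3 0 fun i => i.elim0⟩
    · exact ⟨g (MvPolynomial.X 0), h3 _ fun i => by rw [Subsingleton.elim i 0]⟩
  obtain ⟨x, hx⟩ := h2
  refine ⟨x, ⟨fun r => ?_⟩⟩
  obtain ⟨q, hq, hr⟩ := hint r
  let h : MvPolynomial (Fin s) K →+* Algebra.adjoin K {x} :=
    (Subalgebra.inclusion hx : g.range →+* _).comp (g.rangeRestrict : _ →+* g.range)
  exact ⟨q.map h, hq.map h, by rw [Polynomial.eval₂_map]; exact hr⟩

/-- A field that is separable over a simple extension `L(x)` of a perfect field is generated by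
`x` over its `p`-th powers. -/
lemma finrank_fieldRange_frobenius_le {L M : Type*} [Field L] [Field M] [Algebra L M] (p : ℕ)
    [hp : Fact p.Prime] [CharP L p] [CharP M p] [PerfectRing L p] (x : M)
    [Algebra.IsSeparable (IntermediateField.adjoin L {x}) M] :
    Module.Finite (frobenius M p).fieldRange M ∧
      Module.finrank (frobenius M p).fieldRange M ≤ p := by
  let F := (frobenius M p).fieldRange
  let E := IntermediateField.adjoin F {x}
  have hpow : ∀ y : M, y ^ p ∈ F := fun y => ⟨y, rfl⟩
  -- L is perfect, so it lies in M^p, and L(x) in E = M^p(x). Then M is separable over E, and purely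
  -- inseparable because E contains M^p; hence E = M.
  have hle : ∀ y ∈ IntermediateField.adjoin L {x}, y ∈ E := by
    intro y hy
    induction hy using IntermediateField.adjoin_induction with
    | mem y hy => exact IntermediateField.subset_adjoin _ _ hy
    | algebraMap l =>
      obtain ⟨k, rfl⟩ := surjective_frobenius L p l
      rw [frobenius_def, map_pow]
      exact IntermediateField.algebraMap_mem E ⟨_, hpow (algebraMap L M k)⟩
    | add _ _ _ _ h h' => exact add_mem h h'
    | inv _ _ h => exact inv_mem h
    | mul _ _ _ _ h h' => exact mul_mem h h'
  let _ : Algebra (IntermediateField.adjoin L {x}) E :=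
    RingHom.toAlgebra
      { toFun := fun y => ⟨y, hle y y.2⟩
        map_one' := rfl
        map_mul' := fun _ _ => rfl
        map_zero' := rfl
        map_add' := fun _ _ => rfl }
  have : IsScalarTower (IntermediateField.adjoin L {x}) E M := IsScalarTower.of_algebraMap_eq' rfl
  have : Algebra.IsSeparable E M := Algebra.isSeparable_tower_top_of_isSeparable
    (IntermediateField.adjoin L {x}) E M
  have : IsPurelyInseparable E M := by
    have : ExpChar E p := ExpChar.prime hp.out
    rw [isPurelyInseparable_iff_pow_mem E p]
    exact fun y => ⟨1, ⟨⟨y ^ p, IntermediateField.algebraMap_mem E ⟨_, hpow y⟩⟩, by simp⟩⟩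
  have htop : E = ⊤ := by
    refine eq_top_iff.2 fun y _ => ?_
    obtain ⟨z, rfl⟩ := IsPurelyInseparable.surjective_algebraMap_of_isSeparable E M y
    exact z.2
  have hx : (Polynomial.X ^ p - Polynomial.C (⟨x ^ p, hpow x⟩ : F)).Monic :=
    Polynomial.monic_X_pow_sub_C _ hp.out.ne_zero
  have hx0 : Polynomial.aeval x (Polynomial.X ^ p - Polynomial.C (⟨x ^ p, hpow x⟩ : F)) = 0 := by
    simp [Algebra.algebraMap_eq_smul_one, Subfield.smul_def]
  have hxi : IsIntegral F x := ⟨_, hx, hx0⟩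
  have hfin : Module.Finite F M := by
    have h1 := IntermediateField.adjoin.finiteDimensional hxi
    change FiniteDimensional F E at h1
    rw [htop] at h1
    exact Module.Finite.equiv (IntermediateField.topEquiv (F := F) (E := M)).toLinearEquiv
  refine ⟨hfin, ?_⟩
  change Module.finrank F M ≤ p
  have h2 : Module.finrank F E = (minpoly F x).natDegree := IntermediateField.adjoin.finrank hxi
  rw [htop, IntermediateField.finrank_top'] at h2
  rw [h2, ← Polynomial.natDegree_X_pow_sub_C (n := p) (r := (⟨x ^ p, hpow x⟩ : F))]
  exact Polynomial.natDegree_le_natDegree (minpoly.min F x hx hx0)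

/-- Over a perfect field, a field generated by a finitely generated algebra of dimension at most
one has degree at most `p` over its `p`-th powers. -/
theorem exists_frobenius_dependence {K L R M : Type*} [Field K] [Field L] [CommRing R] [IsDomain R] [Field M]
    [Algebra K L] [Algebra K R] [Algebra L M] [Algebra.FiniteType K R] [Ring.KrullDimLE 1 R] (p : ℕ) [hp : Fact p.Prime]
    [CharP L p] [CharP M p] [PerfectField L] (φ : R →+* M)
    (hφ : ∀ k, φ (algebraMap K R k) = algebraMap L M (algebraMap K L k))
    (hgen : ∀ F : IntermediateField L M, (∀ r, φ r ∈ F) → F = ⊤)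
    (x : ℕ → M) : ∃ a : ℕ → M, (∃ j < p + 1, a j ≠ 0) ∧
      ∑ j ∈ Finset.range (p + 1), a j ^ p * x j = 0 := by
  classical
  let _ : Algebra K M := ((algebraMap L M).comp (algebraMap K L)).toAlgebra
  have : IsScalarTower K L M := IsScalarTower.of_algebraMap_eq' rfl
  let φ' : R →ₐ[K] M := { φ with commutes' := hφ }
  obtain ⟨S, hS⟩ := Algebra.FiniteType.out (R := K) (A := R)
  obtain ⟨z, hz⟩ := exists_isIntegral_adjoin_singleton K R
  have hess : Algebra.EssFiniteType L M := by
    rw [← IntermediateField.fg_top_iff]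
    refine ⟨S.image φ, hgen _ fun r => ?_⟩
    have h1 : Algebra.adjoin K (S : Set R) ≤ ((IntermediateField.adjoin L
        ((S.image φ : Finset M) : Set M)).restrictScalars K).toSubalgebra.comap φ' :=
      Algebra.adjoin_le fun r hr => IntermediateField.subset_adjoin _ _ (by
        simpa using ⟨r, hr, rfl⟩)
    exact h1 (hS ▸ Algebra.mem_top)
  have halg : Algebra.IsAlgebraic (Algebra.adjoin L {φ z}) M := by
    rw [← IntermediateField.isAlgebraic_adjoin_iff_top]
    have h1 : (algebraicClosure (IntermediateField.adjoin L {φ z}) M).restrictScalars L = ⊤ := by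
      refine hgen _ fun r => ?_
      rw [IntermediateField.mem_restrictScalars, mem_algebraicClosure_iff']
      obtain ⟨q, hq, hr⟩ := hz.isIntegral r
      have h2 : Algebra.adjoin K {z} ≤ ((IntermediateField.adjoin L {φ z}).restrictScalars
          K).toSubalgebra.comap φ' := Algebra.adjoin_le fun r hr => by
        rw [Set.mem_singleton_iff.1 hr]
        exact IntermediateField.subset_adjoin _ _ rfl
      let h : Algebra.adjoin K {z} →+* IntermediateField.adjoin L {φ z} :=
        (φ.comp (Algebra.adjoin K {z}).subtype).codRestrict _ fun r => h2 r.2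
      refine ⟨q.map h, hq.map h, ?_⟩
      rw [Polynomial.eval₂_map]
      have h3 := congrArg φ hr
      rwa [Polynomial.hom_eval₂, map_zero] at h3
    refine ⟨fun m => ?_⟩
    have h2 : m ∈ (algebraicClosure (IntermediateField.adjoin L {φ z}) M).restrictScalars L :=
      h1 ▸ IntermediateField.mem_top
    exact mem_algebraicClosure_iff.1 h2
  have htr : Algebra.trdeg L M ≤ 1 := by
    refine (Algebra.IsAlgebraic.trdeg_le_cardinalMk L {φ z}).trans ?_
    simp
  obtain ⟨s, hs, hsep⟩ := exists_isTranscendenceBasis_and_isSeparable_of_perfectField L M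
  have hcard : s.card ≤ 1 := by
    have := hs.cardinalMk_eq_trdeg
    rw [← this] at htr
    simpa using htr
  obtain ⟨y, hy⟩ : ∃ y : M, Algebra.IsSeparable (IntermediateField.adjoin L {y}) M := by
    -- If the separating transcendence basis is empty, M is separable over L, and y = 0 serves.
    rcases Nat.le_one_iff_eq_zero_or_eq_one.1 hcard with h0 | h1
    · rw [Finset.card_eq_zero] at h0
      rw [h0, Finset.coe_empty, IntermediateField.adjoin_empty,
        ← IntermediateField.adjoin_zero] at hsep
      exact ⟨0, hsep⟩
    · obtain ⟨y, rfl⟩ := Finset.card_eq_one.1 h1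
      rw [Finset.coe_singleton] at hsep
      exact ⟨y, hsep⟩
  obtain ⟨hfin, hrank⟩ := finrank_fieldRange_frobenius_le (L := L) p y
  obtain ⟨c, hc, j, hj⟩ := Fintype.not_linearIndependent_iff.1 fun h : LinearIndependent
      (frobenius M p).fieldRange (fun j : Fin (p + 1) => x j) => by
    have := h.fintype_card_le_finrank
    rw [Fintype.card_fin] at this
    omega
  choose a ha using fun j => (c j).2
  refine ⟨fun j => if h : j < p + 1 then a ⟨j, h⟩ else 0, ⟨j, j.2, ?_⟩, ?_⟩
  · dsimp only
    rw [dif_pos j.2]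
    intro h0
    refine hj (Subtype.ext ?_)
    rw [← ha j]
    change frobenius M p (a ⟨j, j.2⟩) = 0
    rw [h0, map_zero]
  · refine (Finset.sum_range _).trans (Eq.trans (Finset.sum_congr rfl fun j _ => ?_) hc)
    dsimp only
    rw [dif_pos j.2, Subfield.smul_def, ← ha j]
    rfl

/-! ### Normalized twists as rings of fractions of q-th powers -/

/-- A normal local overring `D`, with the same fractions, of a local ring `N` between `A` and its
`q`-th powers is the ring of the elements of `A` that are fractions of `q`-th powers. -/
theorem nonempty_algEquiv_frobSub {K A N D : Type*} (FD : Type*) [Field K] [CommRing A] [IsDomain A]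
    [IsIntegrallyClosed A] [Algebra K A] [CommRing N] [IsDomain N] [Algebra K N]
    [CommRing D] [IsDomain D] [IsIntegrallyClosed D] [Algebra K D] [Field FD] [Algebra D FD]
    [IsFractionRing D FD] {q : ℕ} (hq : 0 < q)
    (j : N →+* A) (hjK : ∀ k, j (algebraMap K N k) = algebraMap K A k)
    (π : A →+* N) (hjπ : ∀ a, j (π a) = a ^ q) (hπj : ∀ m, π (j m) = m ^ q)
    (ν : N →+* D) (hνK : ∀ k, ν (algebraMap K N k) = algebraMap K D k)
    (hν : Function.Injective ν) [IsLocalHom ν]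
    (hfrac : ∀ d : D, ∃ x y : N, y ≠ 0 ∧ d * ν y = ν x)
    (hint : ∀ d : D, ∃ s t : D, ν.IsIntegralElem s ∧ ν.IsIntegralElem t ∧ IsUnit t ∧ d * t = s)
    (hgen : ∀ m : N, ∃ x ∈ powAdjoin K A q, ∃ y ∈ powAdjoin K A q, y ≠ 0 ∧ j m * y = x) :
    Nonempty (D ≃ₐ[K] frobSub K A q) := by
  have hj : Function.Injective j := by
    rw [injective_iff_map_eq_zero]
    intro m hm
    have h := hπj m
    rw [hm, map_zero] at h
    exact eq_zero_of_pow_eq_zero h.symm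
  let FA := FractionRing A
  let _ : Algebra N D := ν.toAlgebra
  let _ : Algebra N FD := ((algebraMap D FD).comp ν).toAlgebra
  have : IsScalarTower N D FD := IsScalarTower.of_algebraMap_eq' rfl
  have : FaithfulSMul N FD := (faithfulSMul_iff_algebraMap_injective N FD).2
    ((IsFractionRing.injective D FD).comp hν)
  have hND : ∀ m, algebraMap N FD m = algebraMap D FD (ν m) := fun m => rfl
  have : IsFractionRing N FD := IsFractionRing.of_field N FD fun z => by
    obtain ⟨a, b, hb, rfl⟩ := IsFractionRing.div_surjective (A := D) z
    obtain ⟨x, y, hy, h⟩ := hfrac a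
    obtain ⟨x', y', hy', h'⟩ := hfrac b
    have hb0 : algebraMap D FD b ≠ 0 := by simpa using nonZeroDivisors.ne_zero hb
    have hy0 : algebraMap D FD (ν y) ≠ 0 := by
      simpa using (map_ne_zero_iff ν hν).2 hy
    have hy0' : algebraMap D FD (ν y') ≠ 0 := by
      simpa using (map_ne_zero_iff ν hν).2 hy'
    refine ⟨x * y', y * x', ?_⟩
    rw [map_mul, map_mul, hND, hND, hND, hND, ← h, ← h', map_mul, map_mul]
    field_simp
  let jF : N →+* FA := (algebraMap A FA).comp j
  have hjF : Function.Injective jF := (IsFractionRing.injective A FA).comp hj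
  let θ : FD →+* FA := IsFractionRing.lift hjF
  have hθ : ∀ m, θ (algebraMap N FD m) = algebraMap A FA (j m) := fun m =>
    IsFractionRing.lift_algebraMap hjF m
  have hA := IsFractionRing.injective A FA
  have h1 : ∀ s : D, ν.IsIntegralElem s → ∃ a, algebraMap A FA a = θ (algebraMap D FD s) := by
    rintro s ⟨r, hr, hs⟩
    apply IsIntegrallyClosed.isIntegral_iff.1
    refine ⟨r.map j, hr.map j, ?_⟩
    have h := congrArg (θ.comp (algebraMap D FD)) hs
    rw [Polynomial.hom_eval₂, map_zero] at h
    rw [Polynomial.eval₂_map, ← h]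
    congr 1
    exact (RingHom.ext hθ).symm
  -- Integral elements of D land in A since A is integrally closed. A denominator t that is a unit
  -- of D stays a unit: if b is its image in A, then ν(π b) = t^q, so π b is a unit because ν is
  -- local, and b^q = j(π b).
  have h2 : ∀ d : D, ∃ a, algebraMap A FA a = θ (algebraMap D FD d) := by
    intro d
    obtain ⟨s, t, hs, ht, htu, h⟩ := hint d
    obtain ⟨a, ha⟩ := h1 s hs
    obtain ⟨b, hb⟩ := h1 t ht
    have h3 : ν (π b) = t ^ q := by
      apply IsFractionRing.injective D FD
      apply θ.injective
      rw [← hND, hθ, hjπ, map_pow, map_pow, hb, map_pow]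
    have h4 : IsUnit (π b) := isUnit_of_map_unit ν _ (h3 ▸ htu.pow q)
    have h5 : IsUnit b := by
      have := h4.map j
      rw [hjπ] at this
      exact (isUnit_pow_iff hq.ne').1 this
    obtain ⟨c, hc⟩ := h5.exists_right_inv
    refine ⟨a * c, ?_⟩
    have h6 : algebraMap A FA b * algebraMap A FA c = 1 := by rw [← map_mul, hc, map_one]
    rw [map_mul, ha, ← h, map_mul, map_mul, ← hb, mul_assoc, h6, mul_one]
  choose φ hφ using h2
  let Φ : D →ₐ[K] A :=
    { toFun := φ
      map_one' := hA (by rw [hφ]; simp)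
      map_mul' := fun x y => hA (by rw [hφ]; simp [hφ])
      map_zero' := hA (by rw [hφ]; simp)
      map_add' := fun x y => hA (by rw [hφ]; simp [hφ])
      commutes' := fun k => hA (by rw [hφ, ← hνK, ← hND, hθ, hjK]) }
  have hΦ : ∀ d, algebraMap A FA (Φ d) = θ (algebraMap D FD d) := hφ
  have hΦν : ∀ m, Φ (ν m) = j m := fun m => hA (by rw [hΦ, ← hND, hθ])
  have hΦinj : Function.Injective Φ := fun x y h =>
    IsFractionRing.injective D FD (θ.injective (by rw [← hΦ, ← hΦ, h]))
  have hmem : ∀ d, Φ d ∈ frobSub K A q := by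
    intro d
    obtain ⟨x, y, hy, h⟩ := hfrac d
    obtain ⟨x1, hx1, y1, hy1, hy10, h1⟩ := hgen y
    obtain ⟨x2, hx2, y2, hy2, hy20, h2⟩ := hgen x
    refine ⟨x1 * y2, mul_mem hx1 hy2, ?_, ?_⟩
    · rw [← h1]
      exact mul_ne_zero (mul_ne_zero ((map_ne_zero_iff j hj).2 hy) hy10) hy20
    · have h3 := congrArg Φ h
      rw [map_mul, hΦν, hΦν] at h3
      have h4 : Φ d * (x1 * y2) = x2 * y1 := by
        rw [← h1, ← h2, ← h3]
        ring
      rw [h4]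
      exact mul_mem hx2 hy1
  have hpow : ∀ y ∈ powAdjoin K A q, ∃ m, j m = y := by
    intro y hy
    let jA : N →ₐ[K] A := { j with commutes' := hjK }
    have : powAdjoin K A q ≤ jA.range := Algebra.adjoin_le (by
      rintro _ ⟨a, rfl⟩
      exact ⟨π a, hjπ a⟩)
    exact this hy
  refine ⟨AlgEquiv.ofBijective (Φ.codRestrict _ hmem) ⟨fun x y h => hΦinj (congrArg Subtype.val h),
    ?_⟩⟩
  rintro ⟨a, y, hy, hy0, hxy⟩
  obtain ⟨m, rfl⟩ := hpow y hy
  obtain ⟨m', hm'⟩ := hpow _ hxy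
  let e : FD := algebraMap N FD m' / algebraMap N FD m
  have he : θ e = algebraMap A FA a := by
    rw [map_div₀, hθ, hθ, hm', map_mul, mul_div_cancel_right₀]
    rw [map_ne_zero_iff _ hA]
    exact hy0
  -- Surjectivity: the q-th power of a fraction e with image a is π a, so e is integral over N and
  -- belongs to the integrally closed ring D.
  have h7 : IsIntegral N (e ^ q) := by
    have : e ^ q = algebraMap N FD (π a) := θ.injective (by rw [map_pow, he, hθ, hjπ, map_pow])
    rw [this]
    exact isIntegral_algebraMap
  obtain ⟨d, hd⟩ := IsIntegrallyClosed.isIntegral_iff.1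
    ((IsIntegral.of_pow hq h7).tower_top (A := D))
  exact ⟨d, Subtype.ext (hA ((hΦ d).trans (by rw [hd, he])))⟩

/-! ### Base change of sections and of local rings -/

lemma isIntegral_of_geometricallyIntegral {K : Type u} [Field K] {X : Scheme.{u}}
    (f : X ⟶ Spec (CommRingCat.of K)) [GeometricallyIntegral f] : IsIntegral X := by
  have : Subsingleton (Spec (CommRingCat.of K)) := inferInstanceAs (Subsingleton (PrimeSpectrum K))
  exact GeometricallyIntegral.isIntegral_of_subsingleton f

section BaseChange

variable {K L : Type u} [Field K] [Field L] {X : Scheme.{u}} (f : X ⟶ Spec (CommRingCat.of K))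

/-- The sections of a base change over the preimage of an affine open subset. -/
lemma isPushout_sections (φ : K →+* L) {U : X.Opens} (hU : IsAffineOpen U) :
    IsPushout (toSections f U) (CommRingCat.ofHom φ)
      ((pullback.fst f (Spec.map (CommRingCat.ofHom φ))).app U)
      (toSections (pullback.snd f (Spec.map (CommRingCat.ofHom φ)))
        (pullback.fst f (Spec.map (CommRingCat.ofHom φ)) ⁻¹ᵁ U)) := by
  have h := (isIso_pushoutSection_iff (IsPullback.of_hasPullback f
    (Spec.map (CommRingCat.ofHom φ))) (US := ⊤) (UT := ⊤) (UX := U) le_top le_top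
      (UY := pullback.fst f (Spec.map (CommRingCat.ofHom φ)) ⁻¹ᵁ U) (by simp)).1
    (isIso_pushoutSection_of_isAffineOpen _ _ _ _ (isAffineOpen_top _) (isAffineOpen_top _) hU)
  refine h.of_iso (Scheme.ΓSpecIso _) (Iso.refl _) (Scheme.ΓSpecIso _) (Iso.refl _) ?_ ?_ ?_ ?_
  · simp [toSections, Scheme.Hom.appLE]
  · refine Eq.trans ?_ (Scheme.ΓSpecIso_naturality (CommRingCat.ofHom φ))
    exact congrArg (· ≫ (Scheme.ΓSpecIso (CommRingCat.of L)).hom)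
      (Scheme.Hom.appLE_eq_app (Spec.map (CommRingCat.ofHom φ)) (U := ⊤))
  · simp [Scheme.Hom.appLE]
  · simp [toSections, Scheme.Hom.appLE]

/-- The sections over an affine open subset of a geometrically integral scheme. -/
lemma isDomain_tensor_sections [Algebra K L] [GeometricallyIntegral f] {U : X.Opens}
    (hU : IsAffineOpen U) [Nonempty U] :
    let _ := (toSections f U).hom.toAlgebra
    IsDomain (L ⊗[K] Γ(X, U)) := by
  intro _
  let g := Spec.map (CommRingCat.ofHom (algebraMap K L))
  have : IsIntegral (pullback f g) :=
    GeometricallyIntegral.geometrically_isIntegral _ _ _ (.of_hasPullback _ _)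
  have := isIntegral_of_geometricallyIntegral f
  let e := ((CommRingCat.isPushout_tensorProduct K L Γ(X, U)).isoIsPushout _ _
    (isPushout_sections f (algebraMap K L) hU).flip).commRingCatIsoToRingEquiv
  have h1 : Nonempty (pullback.fst f g ⁻¹ᵁ U) := by
    by_contra h
    have h2 : pullback.fst f g ⁻¹ᵁ U = ⊥ := by
      ext y
      exact ⟨fun hy => (h ⟨y, hy⟩).elim, fun hy => hy.elim⟩
    have h3 : Subsingleton Γ(pullback f g, pullback.fst f g ⁻¹ᵁ U) := by
      rw [h2]
      infer_instance
    exact not_subsingleton _ e.toEquiv.subsingleton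
  exact e.toMulEquiv.isDomain _

end BaseChange

/-- The elements of the local ring at a point of an affine open subset. -/
lemma IsAffineOpen.exists_germ_mul {X : Scheme.{u}} {U : X.Opens} (hU : IsAffineOpen U) {x : X}
    (hx : x ∈ U) (m : X.presheaf.stalk x) : ∃ s t : Γ(X, U), IsUnit (X.presheaf.germ U x hx t) ∧
      m * X.presheaf.germ U x hx t = X.presheaf.germ U x hx s := by
  let _ := TopCat.Presheaf.algebra_section_stalk X.presheaf (⟨x, hx⟩ : U)
  have : IsLocalization.AtPrime (X.presheaf.stalk x) (hU.primeIdealOf ⟨x, hx⟩).asIdeal :=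
    hU.isLocalization_stalk ⟨x, hx⟩
  obtain ⟨⟨s, t⟩, h⟩ := IsLocalization.surj (hU.primeIdealOf ⟨x, hx⟩).asIdeal.primeCompl m
  exact ⟨s, t, IsLocalization.map_units (X.presheaf.stalk x) t, h⟩

/-- An algebra whose elements are fractions of the elements of a subalgebra with unit denominators
remains a domain after a flat base change if the subalgebra does. -/
lemma isDomain_tensor_of_fractions {K L G A : Type*} [Field K] [Field L] [CommRing G] [CommRing A]
    [Algebra K L] [Algebra K G] [Algebra K A] (φ : G →ₐ[K] A) (hφ : Function.Injective φ)
    (hA : ∀ m : A, ∃ s t : G, IsUnit (φ t) ∧ m * φ t = φ s) [IsDomain (L ⊗[K] G)] :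
    IsDomain (L ⊗[K] A) := by
  let Φ : L ⊗[K] G →ₐ[L] L ⊗[K] A := Algebra.TensorProduct.map (AlgHom.id L L) φ
  have hΦ : Function.Injective Φ :=
    Module.Flat.lTensor_preserves_injective_linearMap (M := L) φ.toLinearMap hφ
  have hden : ∀ z : L ⊗[K] A, ∃ t : G, IsUnit (φ t) ∧ ∃ w, z * (1 ⊗ₜ φ t) = Φ w := by
    intro z
    induction z with
    | zero => exact ⟨1, by simp, 0, by simp⟩
    | tmul l m =>
      obtain ⟨s, t, ht, h⟩ := hA m
      exact ⟨t, ht, l ⊗ₜ s, by simp [Φ, h]⟩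
    | add x y hx hy =>
      obtain ⟨t, ht, w, h⟩ := hx
      obtain ⟨t', ht', w', h'⟩ := hy
      refine ⟨t * t', by simpa using ht.mul ht', w * (1 ⊗ₜ t') + w' * (1 ⊗ₜ t), ?_⟩
      have h1 : (1 : L) ⊗ₜ[K] φ (t * t') = (1 ⊗ₜ φ t) * (1 ⊗ₜ φ t') := by simp
      have h2 : ∀ t, Φ (1 ⊗ₜ t) = 1 ⊗ₜ φ t := fun t => by simp [Φ]
      rw [h1, map_add, map_mul, map_mul, ← h, ← h', h2, h2]
      ring
  have hunit : ∀ t, IsUnit (φ t) → IsUnit ((1 : L) ⊗ₜ[K] φ t) := fun t ht =>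
    ht.map (Algebra.TensorProduct.includeRight : A →ₐ[K] L ⊗[K] A)
  have : Nontrivial (L ⊗[K] A) := hΦ.nontrivial
  have : NoZeroDivisors (L ⊗[K] A) := by
    refine ⟨fun {x y} hxy => ?_⟩
    obtain ⟨t, ht, w, h⟩ := hden x
    obtain ⟨t', ht', w', h'⟩ := hden y
    have h1 : w * w' = 0 := hΦ (by
      rw [map_mul, ← h, ← h', map_zero, mul_mul_mul_comm, hxy, zero_mul])
    refine (mul_eq_zero.1 h1).imp (fun h0 => ?_) fun h0 => ?_
    · rw [h0, map_zero] at h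
      exact (hunit t ht).mul_left_eq_zero.1 h
    · rw [h0, map_zero] at h'
      exact (hunit t' ht').mul_left_eq_zero.1 h'
  exact NoZeroDivisors.to_isDomain _

/-- The map from `K` to the sections, followed by the map to the local ring. -/
lemma toSections_germ {K : Type u} [Field K] {X : Scheme.{u}} (f : X ⟶ Spec (CommRingCat.of K))
    {U : X.Opens} {x : X} (hx : x ∈ U) :
    toSections f U ≫ X.presheaf.germ U x hx = toStalk f x := by
  simp [toSections, toStalk]

lemma isDomain_tensor_stalk {K L : Type u} [Field K] [Field L] {X : Scheme.{u}}
    (f : X ⟶ Spec (CommRingCat.of K)) [Algebra K L] [GeometricallyIntegral f] (x : X) :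
    IsDomain (L ⊗[K] LocalRing f x) := by
  have := isIntegral_of_geometricallyIntegral f
  obtain ⟨U, hU, hx, -⟩ := exists_isAffineOpen_mem_and_subset (x := x) (U := ⊤) trivial
  have : Nonempty U := ⟨⟨x, hx⟩⟩
  let _ := (toSections f U).hom.toAlgebra
  have : IsDomain (L ⊗[K] Γ(X, U)) := isDomain_tensor_sections f hU
  let φ : Γ(X, U) →ₐ[K] LocalRing f x :=
    { (X.presheaf.germ U x hx).hom with
      commutes' := fun k => congrArg (fun g => g.hom k) (toSections_germ f hx) }
  exact isDomain_tensor_of_fractions φ (germ_injective_of_isIntegral X x hx)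
    (IsAffineOpen.exists_germ_mul hU hx)

/-! ### Absolute and relative Frobenius on schemes and local rings -/

section Frobenius

variable {K : Type u} [Field K] (p : ℕ) [Fact p.Prime] [CharP K p] {X Y : Scheme.{u}}
  (f : X ⟶ Spec (CommRingCat.of K)) (g : Y ⟶ Spec (CommRingCat.of K))

/-- Every morphism commutes with the absolute Frobenius morphisms. -/
lemma absFrobenius_naturality (n : ℕ) (h : Y ⟶ X) :
    absFrobenius p g n ≫ h = h ≫ absFrobenius p f n := by
  refine Scheme.Hom.ext (by ext x; rfl) fun U => ?_
  ext s
  have h1 := congrArg (fun φ : Γ(Y, h ⁻¹ᵁ U) ⟶ Γ(Y, h ⁻¹ᵁ U) => φ.hom (((h.app U).hom s) ^ p ^ n))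
    (Y.presheaf.map_id (Opposite.op (h ⁻¹ᵁ U)))
  exact Eq.trans h1 (map_pow (h.app U).hom s (p ^ n)).symm

/-- The relative Frobenius morphism is an inverse of the projection of the twist, up to the absolute
Frobenius morphisms. -/
lemma fst_relFrobenius (n : ℕ) : pullback.fst f (Spec.map (CommRingCat.ofHom
    (iterateFrobenius K p n))) ≫ relFrobenius p f n = absFrobenius p (twistHom p f n) n := by
  apply pullback.hom_ext
  · rw [Category.assoc, relFrobenius, pullback.lift_fst]
    exact (absFrobenius_naturality p f (twistHom p f n) n _).symm
  · rw [Category.assoc, relFrobenius, pullback.lift_snd, absFrobenius_comp]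
    exact pullback.condition

lemma absFrobenius_stalkMap (n : ℕ) (x : X) (a : X.presheaf.stalk x) :
    ((absFrobenius p f n).stalkMap x).hom a = (a ^ p ^ n : X.presheaf.stalk x) := by
  obtain ⟨U, hxU, s, rfl⟩ := X.presheaf.exists_germ_eq a
  refine (Scheme.Hom.germ_stalkMap_apply (absFrobenius p f n) U x hxU s).trans ?_
  exact map_pow (X.presheaf.germ U x hxU).hom s (p ^ n)

end Frobenius

lemma toStalk_stalkMap {K : Type u} [Field K] {X Y : Scheme.{u}} (h : X ⟶ Y)
    (g : Y ⟶ Spec (CommRingCat.of K)) (x : X) :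
    toStalk g (h x) ≫ h.stalkMap x = toStalk (h ≫ g) x := by
  have h1 := Scheme.Hom.germ_stalkMap h ⊤ x trivial
  simp only [toStalk, Category.assoc, Scheme.Hom.comp_appTop]
  rw [h1]
  rfl

lemma toStalk_stalkSpecializes {K : Type u} [Field K] {X : Scheme.{u}}
    (f : X ⟶ Spec (CommRingCat.of K)) {x y : X} (h : x ⤳ y) :
    toStalk f y ≫ X.presheaf.stalkSpecializes h = toStalk f x := by
  simp only [toStalk, Category.assoc]
  rw [X.presheaf.germ_stalkSpecializes (U := ⊤) trivial h]

/-! ### Sections and local rings of the normalization -/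

section Normalization

variable (X : Scheme.{u}) [IsIntegral X] [QuasiSeparatedSpace X]

/-- The sections of the spectrum of the function field over the preimage of an affine open subset. -/
lemma exists_iso_sections_genericInclusion (U : X.Opens) [hU : Nonempty U] :
    ∃ E : X.functionField ≅ Γ(Spec X.functionField, genericInclusion X ⁻¹ᵁ U),
      X.germToFunctionField U ≫ E.hom = (genericInclusion X).app U := by
  have hgen : genericPoint X ∈ U :=
    ((genericPoint_spec X).mem_open_set_iff U.isOpen).2 (by simpa using hU)
  have htop : ⊤ = genericInclusion X ⁻¹ᵁ U := by
    refine (eq_top_iff.2 fun y _ => ?_).symm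
    have h : genericInclusion X y ⤳ genericPoint X := by
      have : genericInclusion X y ∈ Set.range (genericInclusion X) := ⟨y, rfl⟩
      rwa [Scheme.range_fromSpecStalk] at this
    exact h.mem_open U.isOpen hgen
  refine ⟨(Scheme.ΓSpecIso _).symm ≪≫
    (Spec X.functionField).presheaf.mapIso (eqToIso htop.symm).op, ?_⟩
  rw [Scheme.fromSpecStalk_app hgen]
  rfl

/-- The sections of the normalization over the preimage of an affine open subset. -/
lemma normalization_sections {U : X.Opens} (hU : IsAffineOpen U) [Nonempty U] :
    ∃ ψ : Γ(normalization X, normalizationHom X ⁻¹ᵁ U) →+* X.functionField,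
      Function.Injective ψ ∧
      (∀ s, ψ (((normalizationHom X).app U).hom s) = (X.germToFunctionField U).hom s) ∧
      ∀ z, z ∈ ψ.range ↔ (X.germToFunctionField U).hom.IsIntegralElem z := by
  obtain ⟨E, hE⟩ := exists_iso_sections_genericInclusion X U
  let _ := ((genericInclusion X).app U).hom.toAlgebra
  let I := integralClosure Γ(X, U) Γ(Spec X.functionField, genericInclusion X ⁻¹ᵁ U)
  let N := (genericInclusion X).normalizationObjIso hU
  have hE' : ∀ s, E.inv.hom (((genericInclusion X).app U).hom s) =
      (X.germToFunctionField U).hom s := fun s => by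
    rw [← hE]
    simp
  have hEinj : Function.Injective E.inv.hom := E.commRingCatIsoToRingEquiv.symm.injective
  have hNinj : Function.Injective N.hom.hom := N.commRingCatIsoToRingEquiv.injective
  have hN : ∀ s, (N.hom.hom (((normalizationHom X).app U).hom s) : I) = algebraMap _ I s := by
    intro s
    rw [Scheme.Hom.fromNormalization_app _ hU]
    exact N.commRingCatIsoToRingEquiv.apply_symm_apply _
  refine ⟨E.inv.hom.comp ((I.val : I →+* _).comp N.hom.hom),
    hEinj.comp (Subtype.val_injective.comp hNinj), fun s => ?_, fun z => ⟨?_, fun hz => ?_⟩⟩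
  · refine Eq.trans ?_ (hE' s)
    exact congrArg (fun b : I => E.inv.hom (b : Γ(Spec X.functionField, genericInclusion X ⁻¹ᵁ U)))
      (hN s)
  · rintro ⟨b, rfl⟩
    obtain ⟨q, hq, h⟩ := (N.hom.hom b : I).2
    refine ⟨q, hq, ?_⟩
    have h1 := congrArg E.inv.hom h
    rw [Polynomial.hom_eval₂, map_zero] at h1
    rw [← h1]
    exact congrArg (fun φ => Polynomial.eval₂ φ _ q) (RingHom.ext hE').symm
  · obtain ⟨q, hq, h⟩ := hz
    have h0 : IsIntegral Γ(X, U) (E.hom.hom z) := by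
      refine ⟨q, hq, ?_⟩
      have h1 := congrArg E.hom.hom h
      rw [Polynomial.hom_eval₂, map_zero] at h1
      rw [← h1]
      exact congrArg (fun φ : Γ(X, U) ⟶ _ => Polynomial.eval₂ φ.hom _ q) hE.symm
    refine ⟨N.inv.hom (⟨_, h0⟩ : I), ?_⟩
    have h1 : N.hom.hom (N.inv.hom (⟨_, h0⟩ : I)) = (⟨_, h0⟩ : I) :=
      N.commRingCatIsoToRingEquiv.apply_symm_apply _
    refine Eq.trans (congrArg (fun b : I => E.inv.hom
      (b : Γ(Spec X.functionField, genericInclusion X ⁻¹ᵁ U))) h1) ?_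
    exact E.commRingCatIsoToRingEquiv.symm_apply_apply z

/-- The normalization has integrally closed local rings. -/
lemma isIntegrallyClosed_stalk_normalization (Q : normalization X) :
    IsIntegrallyClosed ((normalization X).presheaf.stalk Q) := by
  obtain ⟨U, hU, hx, -⟩ := exists_isAffineOpen_mem_and_subset (x := normalizationHom X Q)
    (U := ⊤) trivial
  have : Nonempty U := ⟨⟨_, hx⟩⟩
  obtain ⟨ψ, hψ, hψU, hrange⟩ := normalization_sections X hU
  have hW : IsAffineOpen (normalizationHom X ⁻¹ᵁ U) := hU.preimage _
  have hQ : Q ∈ normalizationHom X ⁻¹ᵁ U := hx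
  have : Nonempty (normalizationHom X ⁻¹ᵁ U : (normalization X).Opens) := ⟨⟨Q, hQ⟩⟩
  have := functionField_isFractionRing_of_isAffineOpen X U hU
  let _ : Algebra Γ(normalization X, normalizationHom X ⁻¹ᵁ U) X.functionField := ψ.toAlgebra
  have : FaithfulSMul Γ(normalization X, normalizationHom X ⁻¹ᵁ U) X.functionField :=
    (faithfulSMul_iff_algebraMap_injective _ _).2 hψ
  have : IsFractionRing Γ(normalization X, normalizationHom X ⁻¹ᵁ U) X.functionField :=
    IsFractionRing.of_field _ _ fun z => by
      obtain ⟨a, b, -, rfl⟩ := IsFractionRing.div_surjective (A := Γ(X, U)) z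
      exact ⟨_, _, congrArg₂ (· / ·) (hψU a).symm (hψU b).symm⟩
  have h1 : IsIntegrallyClosed Γ(normalization X, normalizationHom X ⁻¹ᵁ U) := by
    refine (isIntegrallyClosed_iff X.functionField).2 fun {z} hz => ?_
    let _ : Algebra Γ(X, U) Γ(normalization X, normalizationHom X ⁻¹ᵁ U) :=
      ((normalizationHom X).app U).hom.toAlgebra
    have : IsScalarTower Γ(X, U) Γ(normalization X, normalizationHom X ⁻¹ᵁ U) X.functionField :=
      IsScalarTower.of_algebraMap_eq fun s => (hψU s).symm
    have : Algebra.IsIntegral Γ(X, U) Γ(normalization X, normalizationHom X ⁻¹ᵁ U) :=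
      ⟨fun b => (isIntegral_algHom_iff (IsScalarTower.toAlgHom Γ(X, U)
        Γ(normalization X, normalizationHom X ⁻¹ᵁ U) X.functionField) hψ).1
        ((hrange (ψ b)).1 ⟨b, rfl⟩)⟩
    exact (hrange z).2 (isIntegral_trans (R := Γ(X, U)) z hz)
  let _ := TopCat.Presheaf.algebra_section_stalk (normalization X).presheaf
    (⟨Q, hQ⟩ : (normalizationHom X ⁻¹ᵁ U : (normalization X).Opens))
  have : IsLocalization.AtPrime ((normalization X).presheaf.stalk Q)
    (hW.primeIdealOf ⟨Q, hQ⟩).asIdeal := hW.isLocalization_stalk ⟨Q, hQ⟩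
  exact isIntegrallyClosed_of_isLocalization ((normalization X).presheaf.stalk Q)
    (hW.primeIdealOf ⟨Q, hQ⟩).asIdeal.primeCompl (Ideal.primeCompl_le_nonZeroDivisors _)

/-- The local rings of the normalization, as overrings of the local rings. -/
lemma normalization_stalkMap (Q : normalization X) :
    Function.Injective ((normalizationHom X).stalkMap Q).hom ∧
    (∀ d, ∃ x y, y ≠ 0 ∧
      d * ((normalizationHom X).stalkMap Q).hom y = ((normalizationHom X).stalkMap Q).hom x) ∧
    ∀ d, ∃ s t, ((normalizationHom X).stalkMap Q).hom.IsIntegralElem s ∧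
      ((normalizationHom X).stalkMap Q).hom.IsIntegralElem t ∧ IsUnit t ∧ d * t = s := by
  obtain ⟨U, hU, hx, -⟩ := exists_isAffineOpen_mem_and_subset (x := normalizationHom X Q)
    (U := ⊤) trivial
  have : Nonempty U := ⟨⟨_, hx⟩⟩
  obtain ⟨ψ, hψ, hψU, hrange⟩ := normalization_sections X hU
  have hW : IsAffineOpen (normalizationHom X ⁻¹ᵁ U) := hU.preimage _
  have hQ : Q ∈ normalizationHom X ⁻¹ᵁ U := hx
  have : Nonempty (normalizationHom X ⁻¹ᵁ U : (normalization X).Opens) := ⟨⟨Q, hQ⟩⟩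
  have := functionField_isFractionRing_of_isAffineOpen X U hU
  set ν := ((normalizationHom X).stalkMap Q).hom with hν
  let γ := (X.presheaf.germ U _ hx).hom
  let δ := ((normalization X).presheaf.germ _ Q hQ).hom
  let α := ((normalizationHom X).app U).hom
  have hδ : Function.Injective δ := germ_injective_of_isIntegral _ Q hQ
  have hcomm : ∀ s, ν (γ s) = δ (α s) := fun s =>
    Scheme.Hom.germ_stalkMap_apply (normalizationHom X) U Q hx s
  have hfrac : ∀ b, ∃ x y, y ≠ 0 ∧ b * α y = α x := by
    intro b
    obtain ⟨x, y, hy, h⟩ := IsFractionRing.div_surjective (A := Γ(X, U)) (ψ b)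
    refine ⟨x, y, nonZeroDivisors.ne_zero hy, hψ ?_⟩
    rw [map_mul, hψU, hψU, ← h]
    exact div_mul_cancel₀ _ (IsFractionRing.to_map_ne_zero_of_mem_nonZeroDivisors hy)
  have hα : Function.Injective α := fun x y h => by
    have := congrArg ψ h
    rw [hψU, hψU] at this
    exact X.germToFunctionField_injective U this
  have hint : ∀ b, ν.IsIntegralElem (δ b) := by
    intro b
    obtain ⟨q, hq, h⟩ := (hrange _).1 ⟨b, rfl⟩
    have h1 : q.eval₂ α b = 0 := by
      apply hψ
      rw [Polynomial.hom_eval₂, map_zero, ← h]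
      exact congrArg (fun φ => Polynomial.eval₂ φ _ q) (RingHom.ext hψU)
    refine ⟨q.map γ, hq.map γ, ?_⟩
    have h2 := congrArg δ h1
    rw [Polynomial.hom_eval₂, map_zero] at h2
    rw [Polynomial.eval₂_map, ← h2]
    exact congrArg (fun φ => Polynomial.eval₂ φ _ q) (RingHom.ext hcomm)
  refine ⟨?_, fun d => ?_, fun d => ?_⟩
  · rw [injective_iff_map_eq_zero]
    intro m hm
    obtain ⟨s, t, ht, h⟩ := IsAffineOpen.exists_germ_mul hU hx m
    have h1 : s = 0 := hα (hδ (by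
      rw [← hcomm, map_zero, map_zero]
      have h2 := congrArg ν h
      rw [map_mul, hm, zero_mul] at h2
      exact h2.symm))
    rw [h1, map_zero] at h
    exact ht.mul_left_eq_zero.1 h
  · obtain ⟨b, c, hc, h⟩ := IsAffineOpen.exists_germ_mul hW hQ d
    obtain ⟨x, y, hy, hb⟩ := hfrac b
    obtain ⟨x', y', hy', hc'⟩ := hfrac c
    have hc0 : c ≠ 0 := by
      rintro rfl
      exact hc.ne_zero (map_zero _)
    have hx' : x' ≠ 0 := by
      rintro rfl
      rw [map_zero] at hc'
      exact mul_ne_zero hc0 ((map_ne_zero_iff α hα).2 hy') hc'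
    refine ⟨γ (x * y'), γ (x' * y), ?_, ?_⟩
    · exact (map_ne_zero_iff γ (germ_injective_of_isIntegral X _ hx)).2 (mul_ne_zero hx' hy)
    · have h' : d * δ c = δ b := h
      have hx0 : δ (α x) = δ b * δ (α y) := by rw [← hb]; exact map_mul δ _ _
      have hx0' : δ (α x') = δ c * δ (α y') := by rw [← hc']; exact map_mul δ _ _
      rw [map_mul, map_mul, map_mul, map_mul, hcomm, hcomm, hcomm, hcomm, hx0, hx0', ← h']
      ring
  · obtain ⟨b, c, hc, h⟩ := IsAffineOpen.exists_germ_mul hW hQ d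
    exact ⟨_, _, hint b, hint c, hc, h⟩

end Normalization

/-! ### Local rings of the twists and of the tower curves -/

section Twist

variable {K : Type u} [Field K] (p : ℕ) [Fact p.Prime] [CharP K p] {X : Scheme.{u}}
  (f : X ⟶ Spec (CommRingCat.of K))

lemma fst_relFrobenius_apply (n : ℕ) (x : X) :
    pullback.fst f (Spec.map (CommRingCat.ofHom (iterateFrobenius K p n)))
      (relFrobenius p f n x) = x := by
  rw [← Scheme.Hom.comp_apply, relFrobenius, pullback.lift_fst]
  rfl

lemma toStalk_relFrobenius (n : ℕ) (x : X) :
    toStalk (twistHom p f n) (relFrobenius p f n x) ≫ (relFrobenius p f n).stalkMap x =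
      toStalk f x := by
  rw [toStalk_stalkMap]
  congr 1
  exact pullback.lift_snd _ _ _

/-- The map from the local ring at a point to the local ring of the twist at its image. -/
noncomputable def twistStalkMap (n : ℕ) (x : X) :
    X.presheaf.stalk x ⟶ (twist p f n).presheaf.stalk (relFrobenius p f n x) :=
  X.presheaf.stalkSpecializes (specializes_of_eq (fst_relFrobenius_apply p f n x)) ≫
    (pullback.fst f (Spec.map (CommRingCat.ofHom (iterateFrobenius K p n)))).stalkMap
      (relFrobenius p f n x)

lemma twistStalkMap_germ (n : ℕ) {U : X.Opens} {x : X} (hx : x ∈ U) (s : Γ(X, U))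
    (hx' : relFrobenius p f n x ∈ pullback.fst f (Spec.map (CommRingCat.ofHom
      (iterateFrobenius K p n))) ⁻¹ᵁ U) :
    (twistStalkMap p f n x).hom (X.presheaf.germ U x hx s) =
      (twist p f n).presheaf.germ _ (relFrobenius p f n x) hx'
        ((pullback.fst f (Spec.map (CommRingCat.ofHom
          (iterateFrobenius K p n)))).app U s) := by
  have h1 := X.presheaf.germ_stalkSpecializes (U := U) hx
    (specializes_of_eq (fst_relFrobenius_apply p f n x))
  have h2 := Scheme.Hom.germ_stalkMap (pullback.fst f (Spec.map (CommRingCat.ofHom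
      (iterateFrobenius K p n)))) U (relFrobenius p f n x) hx'
  have h3 : X.presheaf.germ U x hx ≫ twistStalkMap p f n x = _ :=
    (Category.assoc _ _ _).symm.trans ((congrArg (· ≫ _) h1).trans h2)
  exact congrArg (fun φ => φ.hom s) h3

/-- The projection of the twist after the relative Frobenius is the absolute Frobenius. The
specialization maps only correct for base points that are equal but not definitionally so. -/
lemma twistStalkMap_relFrobenius (n : ℕ) (x : X) (a : X.presheaf.stalk x) :
    ((relFrobenius p f n).stalkMap x).hom ((twistStalkMap p f n x).hom a) =
      (a ^ p ^ n : X.presheaf.stalk x) := by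
  rw [← absFrobenius_stalkMap p f n x a]
  have h0 : relFrobenius p f n ≫ pullback.fst f (Spec.map (CommRingCat.ofHom
      (iterateFrobenius K p n))) = absFrobenius p f n := pullback.lift_fst _ _ _
  have h1 := Scheme.Hom.stalkMap_congr_hom _ _ h0 x
  rw [Scheme.Hom.stalkMap_comp] at h1
  have h2 : twistStalkMap p f n x ≫ (relFrobenius p f n).stalkMap x =
      (absFrobenius p f n).stalkMap x := by
    rw [twistStalkMap, Category.assoc, h1]
    refine (X.presheaf.stalkSpecializes_comp_assoc
      (specializes_of_eq (fst_relFrobenius_apply p f n x).symm) _ _).trans ?_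
    exact (congrArg (· ≫ _) (X.presheaf.stalkSpecializes_refl x)).trans (Category.id_comp _)
  exact congrArg (fun φ => φ.hom a) h2

/-- The composite in the other order is the absolute Frobenius of the twist, by `fst_relFrobenius`.
-/
lemma relFrobenius_twistStalkMap (n : ℕ) (x : X)
    (m : (twist p f n).presheaf.stalk (relFrobenius p f n x)) :
    (twistStalkMap p f n x).hom (((relFrobenius p f n).stalkMap x).hom m) =
      (m ^ p ^ n : (twist p f n).presheaf.stalk (relFrobenius p f n x)) := by
  rw [← absFrobenius_stalkMap p (twistHom p f n) n _ m]
  have h1 := Scheme.Hom.stalkMap_congr_hom _ _ (fst_relFrobenius p f n) (relFrobenius p f n x)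
  rw [Scheme.Hom.stalkMap_comp] at h1
  have h2 : (relFrobenius p f n).stalkMap x ≫ twistStalkMap p f n x =
      (absFrobenius p (twistHom p f n) n).stalkMap (relFrobenius p f n x) := by
    have h3 := Scheme.Hom.stalkSpecializes_stalkMap (relFrobenius p f n) _ _
      (specializes_of_eq (fst_relFrobenius_apply p f n x))
    rw [twistStalkMap, ← Category.assoc]
    refine (congrArg (· ≫ _) h3.symm).trans ((Category.assoc _ _ _).trans ?_)
    refine (congrArg (_ ≫ ·) h1).trans ?_
    refine ((twist p f n).presheaf.stalkSpecializes_comp_assoc (specializes_of_eq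
      (congrArg (relFrobenius p f n) (fst_relFrobenius_apply p f n x)).symm) _ _).trans ?_
    exact (congrArg (· ≫ _) ((twist p f n).presheaf.stalkSpecializes_refl _)).trans
      (Category.id_comp _)
  exact congrArg (fun φ => φ.hom m) h2

/-- The sections of the twist over the preimage of an affine open subset have germs that are
polynomials in `p ^ n`-th powers. -/
lemma relFrobenius_germ_mem_powAdjoin (n : ℕ) {U : X.Opens} (hU : IsAffineOpen U) {x : X}
    (hx : x ∈ U)
    (hx' : relFrobenius p f n x ∈ pullback.fst f (Spec.map (CommRingCat.ofHom
      (iterateFrobenius K p n))) ⁻¹ᵁ U) (v) :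
    (((relFrobenius p f n).stalkMap x).hom ((twist p f n).presheaf.germ _ _ hx' v) :
      LocalRing f x) ∈ powAdjoin K (LocalRing f x) (p ^ n) := by
  let S := (powAdjoin K (LocalRing f x) (p ^ n)).toSubring.comap
    ((relFrobenius p f n).stalkMap x).hom |>.comap ((twist p f n).presheaf.germ _ _ hx').hom
  have key : ∀ a b : LocalRing f x, a = b → b ∈ powAdjoin K (LocalRing f x) (p ^ n) →
      a ∈ powAdjoin K (LocalRing f x) (p ^ n) := fun a b h hb => h ▸ hb
  -- Sections of the base change are generated by sections over U, which become p^n-th powers, and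
  -- by constants.
  have hS : S = ⊤ := by
    rw [eq_top_iff, ← CommRingCat.closure_range_union_range_eq_top_of_isPushout
      (isPushout_sections f (iterateFrobenius K p n) hU), Subring.closure_le]
    rintro _ (⟨s, rfl⟩ | ⟨k, rfl⟩)
    · have h1 := twistStalkMap_relFrobenius p f n x (X.presheaf.germ U x hx s)
      rw [twistStalkMap_germ p f n hx s hx'] at h1
      have h2 : ((X.presheaf.germ U x hx s : LocalRing f x) ^ p ^ n) ∈
          powAdjoin K (LocalRing f x) (p ^ n) :=
        Algebra.subset_adjoin ⟨(X.presheaf.germ U x hx s : LocalRing f x), rfl⟩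
      exact (key _ _ h1 h2 :)
    · have h1 := congrArg (fun φ => φ.hom k) (toStalk_relFrobenius p f n x)
      have h2 := congrArg (fun φ => ((relFrobenius p f n).stalkMap x).hom (φ.hom k))
        (toSections_germ (twistHom p f n) hx')
      exact (key _ _ (h2.trans h1)
        (Subalgebra.algebraMap_mem (powAdjoin K (LocalRing f x) (p ^ n)) k) :)
  exact (hS ▸ Subring.mem_top v : v ∈ S)

/-- The local rings of the tower are the rings of fractions of `p ^ n`-th powers. -/
theorem nonempty_algEquiv_localRing_tower [GeometricallyIntegral f] [QuasiSeparated f] (x : X)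
    [IsDomain (LocalRing f x)] [IsIntegrallyClosed (LocalRing f x)] (n : ℕ) (Q : towerCurve p f n)
    (hQ : towerToTwist p f n Q = relFrobenius p f n x) :
    Nonempty (LocalRing (towerHom p f n) Q ≃ₐ[K] frobSub K (LocalRing f x) (p ^ n)) := by
  obtain ⟨U, hU, hx, -⟩ := exists_isAffineOpen_mem_and_subset (x := x) (U := ⊤) trivial
  have hx' : relFrobenius p f n x ∈ pullback.fst f (Spec.map (CommRingCat.ofHom
      (iterateFrobenius K p n))) ⁻¹ᵁ U := by
    change pullback.fst f _ _ ∈ U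
    rwa [fst_relFrobenius_apply]
  have : IsAffineHom (pullback.fst f (Spec.map (CommRingCat.ofHom (iterateFrobenius K p n)))) :=
    MorphismProperty.of_isPullback (P := @IsAffineHom) (IsPullback.of_hasPullback f _).flip
      inferInstance
  have hV := hU.preimage (pullback.fst f (Spec.map (CommRingCat.ofHom (iterateFrobenius K p n))))
  obtain ⟨hν, hfrac, hint⟩ := normalization_stalkMap (twist p f n) Q
  have := isIntegrallyClosed_stalk_normalization (twist p f n) Q
  have hνK : toStalk (twistHom p f n) (towerToTwist p f n Q) ≫ (towerToTwist p f n).stalkMap Q =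
    toStalk (towerHom p f n) Q := toStalk_stalkMap _ _ _
  obtain ⟨j, hjK, π, hjπ, hπj, hgen⟩ : ∃ j : LocalRing (twistHom p f n) (towerToTwist p f n Q) →+*
      LocalRing f x, (∀ k, j (algebraMap K _ k) = algebraMap K _ k) ∧
      ∃ π : LocalRing f x →+* LocalRing (twistHom p f n) (towerToTwist p f n Q),
      (∀ a, j (π a) = a ^ p ^ n) ∧ (∀ m, π (j m) = m ^ p ^ n) ∧
      ∀ m, ∃ y ∈ powAdjoin K (LocalRing f x) (p ^ n), ∃ z ∈ powAdjoin K (LocalRing f x) (p ^ n),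
        z ≠ 0 ∧ j m * z = y := by
    rw [hQ]
    refine ⟨((relFrobenius p f n).stalkMap x).hom,
      fun k => congrArg (fun φ => φ.hom k) (toStalk_relFrobenius p f n x),
      (twistStalkMap p f n x).hom, twistStalkMap_relFrobenius p f n x,
      relFrobenius_twistStalkMap p f n x, fun m => ?_⟩
    obtain ⟨s, t, ht, h⟩ := IsAffineOpen.exists_germ_mul hV hx' m
    refine ⟨_, relFrobenius_germ_mem_powAdjoin p f n hU hx hx' s, _,
      relFrobenius_germ_mem_powAdjoin p f n hU hx hx' t, ?_, ?_⟩
    · exact (ht.map ((relFrobenius p f n).stalkMap x).hom).ne_zero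
    · exact (map_mul ((relFrobenius p f n).stalkMap x).hom m _).symm.trans
        (congrArg ((relFrobenius p f n).stalkMap x).hom h)
  have : IsDomain (LocalRing (towerHom p f n) Q) :=
    inferInstanceAs (IsDomain ((towerCurve p f n).presheaf.stalk Q))
  have : IsDomain (LocalRing (twistHom p f n) (towerToTwist p f n Q)) :=
    inferInstanceAs (IsDomain ((twist p f n).presheaf.stalk (towerToTwist p f n Q)))
  have : IsIntegrallyClosed (LocalRing (towerHom p f n) Q) := ‹_›
  let ν : LocalRing (twistHom p f n) (towerToTwist p f n Q) →+* LocalRing (towerHom p f n) Q :=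
    ((towerToTwist p f n).stalkMap Q).hom
  have : IsLocalHom ν := inferInstanceAs (IsLocalHom ((towerToTwist p f n).stalkMap Q).hom)
  exact nonempty_algEquiv_frobSub (FractionRing (LocalRing (towerHom p f n) Q))
    (pow_pos (Fact.out : p.Prime).pos n) j hjK π hjπ hπj ν
    (fun k => congrArg (fun φ => φ.hom k) hνK) hν hfrac hint hgen

end Twist

/-! ### Dimension of local rings, sections and curves -/

section Dimension

variable {X : Scheme.{u}}

lemma ringKrullDim_stalk_le (x : X) :
    ringKrullDim (X.presheaf.stalk x) ≤ topologicalKrullDim X := by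
  rw [← PrimeSpectrum.topologicalKrullDim_eq_ringKrullDim]
  exact (X.fromSpecStalk x).isEmbedding.isInducing.topologicalKrullDim_le

lemma ringKrullDim_sections_le {U : X.Opens} (hU : IsAffineOpen U) :
    ringKrullDim Γ(X, U) ≤ topologicalKrullDim X := by
  rw [← PrimeSpectrum.topologicalKrullDim_eq_ringKrullDim]
  exact hU.fromSpec.isOpenEmbedding.isInducing.topologicalKrullDim_le

/-- The local rings of a regular scheme of dimension at most one are principal ideal domains. -/
lemma isPrincipalIdealRing_stalk [IsIntegral X] (hdim : topologicalKrullDim X ≤ 1) (x : X)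
    [IsRegularLocalRing (X.presheaf.stalk x)] : IsPrincipalIdealRing (X.presheaf.stalk x) := by
  have h1 := (IsRegularLocalRing.iff_finrank_cotangentSpace (X.presheaf.stalk x)).1 inferInstance
  have h2 := h1.trans_le ((ringKrullDim_stalk_le x).trans hdim)
  exact ((tfae_of_isNoetherianRing_of_isLocalRing_of_isDomain (X.presheaf.stalk x)).out 5 0).1
    (by exact_mod_cast h2)

/-- If the function field of an integral scheme over a field is algebraic, the scheme is a point. -/
lemma subsingleton_of_isAlgebraic_functionField {K : Type u} [Field K] [IsIntegral X]
    (f : X ⟶ Spec (CommRingCat.of K))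
    (h : ∀ z : X.functionField, (toStalk f (genericPoint X)).hom.IsIntegralElem z) :
    Subsingleton X := by
  suffices hx : ∀ x : X, x = genericPoint X from ⟨fun x y => (hx x).trans (hx y).symm⟩
  intro x
  obtain ⟨U, hU, hx, -⟩ := exists_isAffineOpen_mem_and_subset (x := x) (U := ⊤) trivial
  have : Nonempty U := ⟨⟨_, hx⟩⟩
  have hgen : genericPoint X ∈ U :=
    ((genericPoint_spec X).mem_open_set_iff U.isOpen).2 (by simpa using ‹Nonempty U›)
  let _ : Algebra K Γ(X, U) := (toSections f U).hom.toAlgebra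
  have hint : Algebra.IsIntegral K Γ(X, U) := by
    refine ⟨fun s => ?_⟩
    obtain ⟨q, hq, h0⟩ := h ((X.germToFunctionField U).hom s)
    refine ⟨q, hq, X.germToFunctionField_injective U ?_⟩
    have h1 := Polynomial.hom_eval₂ q (algebraMap K Γ(X, U)) (X.germToFunctionField U).hom s
    refine h1.trans (Eq.trans ?_ (h0.trans (map_zero (X.germToFunctionField U).hom).symm))
    exact congrArg (fun φ : CommRingCat.of K ⟶ _ => Polynomial.eval₂ φ.hom _ q)
      (toSections_germ f hgen)
  have hfield : IsField Γ(X, U) := isField_of_isIntegral_of_isField' (Field.toIsField K)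
  let _ := hfield.toField
  have hsub : Subsingleton (Spec Γ(X, U)) :=
    inferInstanceAs (Subsingleton (PrimeSpectrum Γ(X, U)))
  have hrange := hU.range_fromSpec
  obtain ⟨y, rfl⟩ : x ∈ Set.range hU.fromSpec := by rw [hrange]; exact hx
  obtain ⟨z, hz⟩ : genericPoint X ∈ Set.range hU.fromSpec := by rw [hrange]; exact hgen
  rw [← hz, Subsingleton.elim y z]

end Dimension

/-! ### Finiteness of the function field, and the theorem for curves -/

lemma finiteType_toSections {K : Type u} [Field K] {X : Scheme.{u}}
    (f : X ⟶ Spec (CommRingCat.of K)) [LocallyOfFiniteType f] {U : X.Opens}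
    (hU : IsAffineOpen U) : (toSections f U).hom.FiniteType := by
  have h1 := f.finiteType_appLE (isAffineOpen_top _) hU le_top
  have h2 : toSections f U = (Scheme.ΓSpecIso (CommRingCat.of K)).inv ≫ f.appLE ⊤ U le_top := by
    simp [toSections, Scheme.Hom.appLE]
  rw [h2]
  exact h1.comp (RingHom.FiniteType.of_surjective _
    (Scheme.ΓSpecIso (CommRingCat.of K)).symm.commRingCatIsoToRingEquiv.surjective)

/-- The function field of a geometrically integral curve over a perfect extension of the base
field has degree at most `p` over its `p`-th powers. -/
lemma exists_frobenius_dependence_stalk {K L : Type u} [Field K] [Field L] [Algebra K L] (p : ℕ)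
    [hp : Fact p.Prime] [CharP L p] [PerfectField L] {X : Scheme.{u}}
    (f : X ⟶ Spec (CommRingCat.of K)) [GeometricallyIntegral f] [LocallyOfFiniteType f]
    (hdim : topologicalKrullDim X ≤ 1) (x : X) [IsDomain (L ⊗[K] LocalRing f x)]
    (z : ℕ → FractionRing (L ⊗[K] LocalRing f x)) :
    ∃ a : ℕ → FractionRing (L ⊗[K] LocalRing f x), (∃ j < p + 1, a j ≠ 0) ∧
      ∑ j ∈ Finset.range (p + 1), a j ^ p * z j = 0 := by
  have := isIntegral_of_geometricallyIntegral f
  obtain ⟨U, hU, hx, -⟩ := exists_isAffineOpen_mem_and_subset (x := x) (U := ⊤) trivial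
  have : Nonempty U := ⟨⟨_, hx⟩⟩
  let _ : Algebra K Γ(X, U) := (toSections f U).hom.toAlgebra
  have : Algebra.FiniteType K Γ(X, U) := finiteType_toSections f hU
  have : Ring.KrullDimLE 1 Γ(X, U) := by
    rw [Ring.krullDimLE_iff]
    exact_mod_cast (ringKrullDim_sections_le hU).trans hdim
  let M := FractionRing (L ⊗[K] LocalRing f x)
  have : CharP M p := charP_of_injective_algebraMap (algebraMap L M).injective p
  let γ : Γ(X, U) →ₐ[K] LocalRing f x :=
    { (X.presheaf.germ U x hx).hom with
      commutes' := fun k => congrArg (fun g => g.hom k) (toSections_germ f hx) }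
  let ι : LocalRing f x →ₐ[K] L ⊗[K] LocalRing f x := Algebra.TensorProduct.includeRight
  refine exists_frobenius_dependence (K := K) (L := L) (R := Γ(X, U)) p
    ((algebraMap (L ⊗[K] LocalRing f x) M).comp ((ι.comp γ : Γ(X, U) →ₐ[K] _) : Γ(X, U) →+* _))
    (fun k => ?_) (fun F hF => ?_) z
  · rw [RingHom.comp_apply, RingHom.coe_coe, AlgHom.commutes,
      IsScalarTower.algebraMap_apply K L (L ⊗[K] LocalRing f x), ← IsScalarTower.algebraMap_apply]
  · have h1 : ∀ m : LocalRing f x, algebraMap (L ⊗[K] LocalRing f x) M (ι m) ∈ F := by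
      intro m
      obtain ⟨s, t, ht, h⟩ := IsAffineOpen.exists_germ_mul hU hx m
      have h0 : algebraMap (L ⊗[K] LocalRing f x) M (ι (γ t)) ≠ 0 :=
        ((IsUnit.map ι ht).map (algebraMap (L ⊗[K] LocalRing f x) M)).ne_zero
      have h3 : m * γ t = γ s := h
      have h4 : algebraMap (L ⊗[K] LocalRing f x) M (ι m) =
          algebraMap (L ⊗[K] LocalRing f x) M (ι (γ s)) /
            algebraMap (L ⊗[K] LocalRing f x) M (ι (γ t)) := by
        rw [eq_div_iff h0, ← h3, map_mul, map_mul]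
      rw [h4]
      exact div_mem (hF s) (hF t)
    have h2 : ∀ w : L ⊗[K] LocalRing f x, algebraMap (L ⊗[K] LocalRing f x) M w ∈ F := by
      intro w
      induction w with
      | zero => simp
      | add a b ha hb => simpa using add_mem ha hb
      | tmul l m =>
        have h3 : l ⊗ₜ[K] m = algebraMap L _ l * ι m := by
          simp [ι, Algebra.TensorProduct.algebraMap_apply]
        rw [h3, map_mul, ← IsScalarTower.algebraMap_apply]
        exact mul_mem (F.algebraMap_mem l) (h1 m)
    refine eq_top_iff.2 fun w _ => ?_
    obtain ⟨a, b, -, rfl⟩ := IsFractionRing.div_surjective (A := L ⊗[K] LocalRing f x) w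
    exact div_mem (h2 a) (h2 b)

theorem mainTheorem9 {K : Type u} [Field K] [IsSepClosed K] (p : ℕ) [Fact p.Prime] [CharP K p]
    {C : Scheme.{u}} (f : C ⟶ Spec (CommRingCat.of K)) [GeometricallyIntegral f]
    [IsSeparated f] [LocallyOfFiniteType f] [QuasiCompact f]
    (hdim : topologicalKrullDim C = 1)
    (hreg : ∀ x : C, IsRegularLocalRing (C.presheaf.stalk x))
    (P : C) (Q : ∀ i : ℕ, FrobeniusTower.towerCurve p f i)
    (hQ : ∀ i : ℕ, FrobeniusTower.towerToTwist p f i (Q i) = FrobeniusTower.relFrobenius p f i P)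
    (n : ℕ) (hn : 0 < n)
    (hrat : FrobeniusTower.IsRationalPoint (FrobeniusTower.towerHom p f n) (Q n)) :
    (∃ c : ℕ, ∀ l : ℕ, c ≤ l → l ∈ FrobeniusTower.geomSemigroup f P) ∧
    (∀ i < n, Module.Finite (AlgebraicClosure K)
      (FrobeniusTower.DifferentialCoker (FrobeniusTower.towerHom p f i) (Q i))) ∧
    FrobeniusTower.conductor f P =
      ∑ i ∈ Finset.range n,
        (p - 1) * (FrobeniusTower.differentialDegree (FrobeniusTower.towerHom p f i) (Q i) - 1)
          * p ^ i := by
  have := isIntegral_of_geometricallyIntegral f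
  have := hreg P
  have : IsDomain (LocalRing f P) := inferInstanceAs (IsDomain (C.presheaf.stalk P))
  have : IsLocalRing (LocalRing f P) := inferInstanceAs (IsLocalRing (C.presheaf.stalk P))
  have : IsPrincipalIdealRing (LocalRing f P) := isPrincipalIdealRing_stalk hdim.le P
  have e : ∀ i, LocalRing (towerHom p f i) (Q i) ≃ₐ[K] frobSub K (LocalRing f P) (p ^ i) :=
    fun i => (nonempty_algEquiv_localRing_tower p f P i (Q i) (hQ i)).some
  -- Rationality of the point on the n-th curve, carried to A. An inverse found in A already lies in
  -- `frobSub`, which is closed under division.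
  have hres : ∀ a ∈ frobSub K (LocalRing f P) (p ^ n), ∃ k : K,
      ¬ IsUnit (a - algebraMap K (LocalRing f P) k) := by
    intro a ha
    let d := (e n).symm ⟨a, ha⟩
    obtain ⟨k, hk⟩ := hrat.2 (((towerCurve p f n).residue (Q n)).hom d)
    refine ⟨k, fun hu => ?_⟩
    have hd : ¬ IsUnit (d - algebraMap K _ k) := by
      intro hu
      refine (hu.map ((towerCurve p f n).residue (Q n)).hom).ne_zero ?_
      exact (map_sub ((towerCurve p f n).residue (Q n)).hom d _).trans (sub_eq_zero.2 hk.symm)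
    have hmem : a - algebraMap K _ k ∈ frobSub K (LocalRing f P) (p ^ n) :=
      sub_mem ha (Subalgebra.algebraMap_mem _ k)
    obtain ⟨b, hb⟩ := hu.exists_right_inv
    have hb' := frobSub_div _ 1 (one_mem _) _ hmem hu.ne_zero b hb.symm
    refine hd (IsUnit.of_mul_eq_one ((e n).symm ⟨b, hb'⟩) ?_)
    have h1 : d - algebraMap K _ k = (e n).symm ⟨_, hmem⟩ := by
      rw [← (e n).symm.commutes k, ← map_sub]
      rfl
    rw [h1, ← map_mul]
    exact (congrArg (e n).symm (Subtype.ext hb)).trans (map_one _)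
  have hA : IsDiscreteValuationRing (LocalRing f P) := by
    refine { (inferInstance : IsPrincipalIdealRing (LocalRing f P)),
      (inferInstance : IsLocalRing (LocalRing f P)) with not_a_field' := fun h0 => ?_ }
    have hfield : IsField (LocalRing f P) := IsLocalRing.isField_iff_maximalIdeal_eq.2 h0
    -- If the local ring were a field, `hres` would put the p^n-th power of each of its elements in
    -- K. The function field would then be algebraic over K and C a point, against dimension one.
    have hsub : Subsingleton C := by
      refine subsingleton_of_isAlgebraic_functionField f fun z => ?_
      let φ : LocalRing f P →+* C.functionField :=
        (C.presheaf.stalkSpecializes ((genericPoint_spec C).specializes (Set.mem_univ P))).hom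
      obtain ⟨a, b, hb, hz⟩ : ∃ a b : LocalRing f P, φ b ≠ 0 ∧ φ a / φ b = z := by
        obtain ⟨a, b, hb, h⟩ := IsFractionRing.div_surjective (A := C.presheaf.stalk P) z
        exact ⟨a, b, IsFractionRing.to_map_ne_zero_of_mem_nonZeroDivisors hb, h⟩
      obtain ⟨b', hbb⟩ := hfield.mul_inv_cancel (fun h => hb (by rw [h, map_zero]) : b ≠ 0)
      obtain ⟨c, rfl⟩ : ∃ c, φ c = z := by
        refine ⟨a * b', ?_⟩
        rw [← hz, eq_div_iff hb, ← map_mul, mul_assoc, mul_comm b', hbb, mul_one]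
      obtain ⟨k, hk⟩ := hres (c ^ p ^ n) (pow_mem_frobSub _ c)
      have hk' : c ^ p ^ n = algebraMap K (LocalRing f P) k := by
        by_contra h
        obtain ⟨w, hw⟩ := hfield.mul_inv_cancel (sub_ne_zero.2 h)
        exact hk (IsUnit.of_mul_eq_one w hw)
      have hgen : (toStalk f (genericPoint C)).hom k =
          φ (algebraMap K (LocalRing f P) k) := congrArg (fun φ => φ.hom k) (toStalk_stalkSpecializes f
          ((genericPoint_spec C).specializes (Set.mem_univ P))).symm
      refine ⟨Polynomial.X ^ p ^ n - Polynomial.C k, Polynomial.monic_X_pow_sub_C _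
        (pow_ne_zero n (Fact.out : p.Prime).ne_zero), ?_⟩
      rw [Polynomial.eval₂_sub, Polynomial.eval₂_X_pow, Polynomial.eval₂_C, hgen, ← hk', map_pow,
        sub_self]
    have : DiscreteTopology C := inferInstance
    have := hdim.symm.trans_le (topologicalKrullDim_zero_of_discreteTopology C)
    norm_num at this
  have : CharP (AlgebraicClosure K) p := inferInstance
  have : IsDomain (AlgebraicClosure K ⊗[K] LocalRing f P) := isDomain_tensor_stalk f P
  obtain ⟨h1, h2, h3⟩ := conductor_formula (L := AlgebraicClosure K) p
    (exists_frobenius_dependence_stalk p f hdim.le P) n hres e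
  refine ⟨h1, h2, h3.trans (Finset.sum_congr rfl fun i _ => ?_)⟩
  rw [differentialDegree, Nat.add_sub_cancel_left]
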